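/- Let $n\ge 1$, $m\in\mathbb N_0$, $1\le p<\infty$, $-1<a<p(m+1)-1$, and put $s:=m+1-\frac{a+1}{p}>0$. Let $\ell$ be the largest integer with $0\le \ell<s$ and $\sigma:=s-\ell\in(0,1]$. For $\Delta_h g(x):=g(x+h)-g(x)$ and $g\in L^p_{\mathrm{loc}}(\mathbb R^n)$ set $$|g|_{B^{\sigma,p}(\mathbb R^n)}:=\Big(\int_{\mathbb R^n}\big\|\Delta_h^{\lfloor\sigma\rfloor+1}g\big\|_{L^p(\mathbb R^n)}^p\,\frac{dh}{|h|^{n+\sigma p}}\Big)^{1/p},$$ and let $\dot B^{s,p}(\mathbb R^n)$ be the space of all real-valued $f\in W^{\ell,p}_{\mathrm{loc}}(\mathbb R^n)$ such that $$|f|_{B^{s,p}(\mathbb R^n)}:=\sum_{|\alpha|=\ell}\Big|\frac{\partial^\alpha f}{\partial x^\alpha}\Big|_{B^{\sigma,p}(\mathbb R^n)}<\infty ,$$ the derivatives being weak derivatives. For $t>0$ let $W_t(x):=(4\pi t^2)^{-n/2}\exp(-|x|^2/(4t^2))$. Theorem. There is a constant $C<\infty$, depending only on $n,m,p,a$, such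 that for every $f\in\dot B^{s,p}(\mathbb R^n)$ the integral $$u(x,t):=(W_t*f)(x)=\int_{\mathbb R^n}W_t(x-y)f(y)\,dy$$ converges absolutely for all $(x,t)\in\mathbb R^{n+1}_+:=\mathbb R^n\times(0,\infty)$, the function $u$ is of class $C^{m+1}$ on $\mathbb R^{n+1}_+$, and $$\int_{\mathbb R^{n+1}_+}t^a\,|\nabla^{m+1}u(x,t)|^p\,dx\,dt\le C\,|f|_{B^{s,p}(\mathbb R^n)}^p ,$$ where $\nabla^{m+1}u$ is the tensor of all partial derivatives of $u$ of order $m+1$ jointly in $(x,t)$ and $|\cdot|$ is its Euclidean norm. -/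

import Mathlib

open MeasureTheory
open scoped ENNReal NNReal

noncomputable section

namespace HeatBesov

/-! ### Classical and weak partial derivatives on `ℝⁿ` -/

/-- The classical partial derivative `∂φ/∂xᵢ`. -/
def partialDeriv {n : ℕ} (i : Fin n) (φ : EuclideanSpace ℝ (Fin n) → ℝ) :
    EuclideanSpace ℝ (Fin n) → ℝ :=
  fun x => fderiv ℝ φ x (EuclideanSpace.single i 1)

/-- The classical derivative `∂^α φ = ∂₁^{α₁} ⋯ ∂ₙ^{αₙ} φ` for a multi-index `α ∈ ℕ₀ⁿ`. -/
def multiDeriv {n : ℕ} (α : Fin n → ℕ) (φ : EuclideanSpace ℝ (Fin n) → ℝ) :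
    EuclideanSpace ℝ (Fin n) → ℝ :=
  (List.finRange n).foldr (fun i ψ => (partialDeriv i)^[α i] ψ) φ

/-- The locally integrable function `g` is a weak derivative `∂^α f` of the locally integrable
function `f`: one has `∫ f ∂^α φ = (-1)^{|α|} ∫ g φ` for every `φ ∈ C_c^∞(ℝⁿ)`. -/
def HasWeakDeriv {n : ℕ} (α : Fin n → ℕ) (f g : EuclideanSpace ℝ (Fin n) → ℝ) : Prop :=
  LocallyIntegrable f ∧ LocallyIntegrable g ∧
    ∀ φ : EuclideanSpace ℝ (Fin n) → ℝ, ContDiff ℝ (⊤ : ℕ∞) φ → HasCompactSupport φ →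
      ∫ x, f x * multiDeriv α φ x = (-1 : ℝ) ^ (∑ i, α i) * ∫ x, g x * φ x

open Classical in
/-- The weak derivative `∂^α f` (unique up to a null set) where it exists, and `0` otherwise. -/
def weakDeriv {n : ℕ} (α : Fin n → ℕ) (f : EuclideanSpace ℝ (Fin n) → ℝ) :
    EuclideanSpace ℝ (Fin n) → ℝ :=
  if h : ∃ g, HasWeakDeriv α f g then h.choose else 0

/-- `f ∈ L^p_loc(ℝⁿ)`. -/
def MemLpLoc {n : ℕ} (f : EuclideanSpace ℝ (Fin n) → ℝ) (p : ℝ) : Prop :=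
  ∀ K : Set (EuclideanSpace ℝ (Fin n)), IsCompact K →
    MemLp f (ENNReal.ofReal p) (volume.restrict K)

/-- `f ∈ W^{ℓ,p}_loc(ℝⁿ)`: all weak derivatives of order at most `ℓ` exist and are in `L^p_loc`. -/
def MemSobolevLoc {n : ℕ} (ℓ : ℕ) (p : ℝ) (f : EuclideanSpace ℝ (Fin n) → ℝ) : Prop :=
  MemLpLoc f p ∧
    ∀ α : Fin n → ℕ, ∑ i, α i ≤ ℓ → ∃ g, HasWeakDeriv α f g ∧ MemLpLoc g p

/-! ### Homogeneous Besov spaces -/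

/-- For `0 < σ ≤ 1`, the Besov seminorm
`|f|_{B^{σ,p}} = (∫ ‖Δ_h^{⌊σ⌋+1} f‖_{L^p}^p dh / |h|^{n+σp})^{1/p} ∈ [0, ∞]`,
with `Δ_h f (x) = f (x + h) - f x`. -/
def besovSeminormBase {n : ℕ} (σ p : ℝ) (f : EuclideanSpace ℝ (Fin n) → ℝ) : ℝ≥0∞ :=
  (∫⁻ h : EuclideanSpace ℝ (Fin n),
    eLpNorm ((fwdDiff h)^[⌊σ⌋₊ + 1] f) (ENNReal.ofReal p) volume ^ p
      / ‖h‖ₑ ^ ((n : ℝ) + σ * p)) ^ (1 / p)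

/-- The largest natural number that is strictly smaller than `s > 0`. -/
def besovOrder (s : ℝ) : ℕ := ⌈s⌉₊ - 1

theorem besovOrder_isGreatest {s : ℝ} (hs : 0 < s) :
    IsGreatest {k : ℕ | (k : ℝ) < s} (besovOrder s) := by
  have h1 : 0 < ⌈s⌉₊ := Nat.ceil_pos.mpr hs
  refine ⟨?_, ?_⟩
  · have : besovOrder s < ⌈s⌉₊ := by unfold besovOrder; omega
    exact Nat.lt_ceil.mp this
  · intro k hk
    have : k < ⌈s⌉₊ := Nat.lt_ceil.mpr hk
    unfold besovOrder
    omega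

/-- For `s > 0` and `ℓ` the largest natural number below `s`, the homogeneous seminorm
`|f|_{B^{s,p}} = ∑_{|α| = ℓ} |∂^α f|_{B^{s-ℓ,p}}`, with weak derivatives `∂^α f`. When `s ≤ 1` one
has `ℓ = 0`, and the sum is the single term `|f|_{B^{s,p}}`. -/
def besovSeminorm {n : ℕ} (s p : ℝ) (f : EuclideanSpace ℝ (Fin n) → ℝ) : ℝ≥0∞ :=
  ∑ α ∈ Finset.piAntidiag (Finset.univ : Finset (Fin n)) (besovOrder s),
    besovSeminormBase (s - besovOrder s) p (weakDeriv α f)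

/-- `f` belongs to the homogeneous Besov space `Ḃ^{s,p}(ℝⁿ)`, `s > 0`: `f ∈ W^{ℓ,p}_loc(ℝⁿ)` for
`ℓ` the largest natural number below `s`, and `|∂^α f|_{B^{s-ℓ,p}} < ∞` whenever `|α| = ℓ`. -/
def MemHomBesov {n : ℕ} (s p : ℝ) (f : EuclideanSpace ℝ (Fin n) → ℝ) : Prop :=
  MemSobolevLoc (besovOrder s) p f ∧
    ∀ α : Fin n → ℕ, ∑ i, α i = besovOrder s →
      besovSeminormBase (s - besovOrder s) p (weakDeriv α f) < ∞

/-! ### The rescaled heat extension -/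

/-- The Gaussian `W(x) = exp(-|x|²/4) / (4π)^{n/2}`. -/
def gaussW {n : ℕ} (x : EuclideanSpace ℝ (Fin n)) : ℝ :=
  Real.exp (-‖x‖ ^ 2 / 4) / (4 * Real.pi) ^ ((n : ℝ) / 2)

/-- `W_t(x) = t^{-n} W(x/t)`. -/
def gaussWt {n : ℕ} (t : ℝ) (x : EuclideanSpace ℝ (Fin n)) : ℝ :=
  1 / t ^ n * gaussW (t⁻¹ • x)

/-- `u(x,t) = (W_t * f)(x) = ∫ W_t(x - y) f(y) dy`. -/
def heatExt {n : ℕ} (f : EuclideanSpace ℝ (Fin n) → ℝ) (z : EuclideanSpace ℝ (Fin n) × ℝ) : ℝ :=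
  ∫ y, gaussWt z.2 (z.1 - y) * f y

/-- The open half-space `ℝⁿ × (0, ∞)`. -/
def halfSpace (n : ℕ) : Set (EuclideanSpace ℝ (Fin n) × ℝ) := {z | 0 < z.2}

/-- The standard basis of `ℝⁿ × ℝ`. -/
def stdBasis {n : ℕ} : Fin n ⊕ Unit → EuclideanSpace ℝ (Fin n) × ℝ :=
  Sum.elim (fun i => (EuclideanSpace.single i 1, 0)) (fun _ => (0, 1))

/-- The Euclidean norm `|∇^k u(z)|` of the tensor of all partial derivatives of order `k`, jointly
in `(x,t)`. -/
def gradNorm {n : ℕ} (k : ℕ) (u : EuclideanSpace ℝ (Fin n) × ℝ → ℝ)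
    (z : EuclideanSpace ℝ (Fin n) × ℝ) : ℝ :=
  Real.sqrt (∑ i : Fin k → Fin n ⊕ Unit,
    (iteratedFDeriv ℝ k u z (fun j => stdBasis (i j))) ^ 2)

end HeatBesov

end

/-!
The `t`-derivatives of the Gaussian family carry as much cancellation as the `x`-derivatives. If
`Φ_t(x) = t^(-n-j) K(x/t)`, then `∂ᵢ Φ_t` is the dilation of `∂ᵢK`, while `∂ₜ Φ_t` is the dilation
of `-(n + j) K - x·∇K`; for `j = 0` the latter is `-∑ᵢ ∂ᵢ(xᵢ K)`, and it stays a sum of derivatives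
of one order more for `j > 0` because the Euler operator `x·∇` commutes with `∂ᵢ` up to a multiple of
`∂ᵢ` (`IsSumDeriv.dilation`). Hence every derivative of order `k = m + 1` of `u` equals
`t^(-k) (K_t * f)`, with `K_t(x) = t^(-n) K(x/t)`, for a Schwartz function `K` that is a sum of
spatial derivatives of order `k` (`iteratedFDeriv_heatExt`).

With `ℓ < s < k` as in the statement, `ℓ` of these derivatives are moved onto `f`
(`exists_dilConv_eq_sum`). What is left is `t^(-(k-ℓ)) (M_t * ∂^β f)` with `|β| = ℓ`, where `M` is
still a sum of derivatives of order `k - ℓ ≥ ⌊σ⌋ + 1`. Since `a - (k - ℓ) p = -σp - 1`, it remains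
to show, for `g = ∂^β f` and `d = ⌊σ⌋ + 1 ∈ {1, 2}`,

  `∫₀^∞ ∫ t^(-σp-1) |(M_t * g)(x)|^p dx dt ≤ C ∫ ‖Δ_h^d g‖_p^p |h|^(-n-σp) dh`

(`IsSumDeriv.besovBounded`). For `d = 1` the mean of `M` vanishes, so
`(M_t * g)(x) = -∫ M(z) (Δ_{tz} g)(x - tz) dz`. For `d = 2` and even `M` the symmetrized integrand
is a second difference. An odd `M = ∂ᵢN` reduces to the even kernels `N` and `∂ᵢ∂ᵢN`, since a first
derivative along a step of length `t` is controlled by the function and its second derivative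
(`BesovBounded.pd_of_pd_pd`). After Hölder's inequality with weight `|M|`, the substitution `h = tz`
and the integral in `t` produce the power `|h|^(-n-σp)` (`lintegral_average_fwdDiff_le`).

The convergence of all these integrals rests on `f` having polynomial growth on average
(`PolyInt`). For `g = ∂^β f` with `|β| = ℓ`, finiteness of the Besov seminorm bounds the average of
`|g|` near `2h` by the one near `h`, up to an integrable error, and a weight that decays fast enough
absorbs the main term (`polyInt_of_besovInt`). The growth of the derivatives of lower order, and of
`f` itself, follows by integrating the weak gradient along segments (`polyInt_of_hasWeakPartial`).
-/

open scoped SchwartzMap LineDeriv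

namespace HeatBesov

/-! ### The Gaussian as a Schwartz function, and sums of iterated partial derivatives -/

section Kernels

variable {n : ℕ}

/-- Any power of `1 + r` is absorbed by `exp (-r² / 4)`, as `1 + r - r² / 4 ≤ 2`. -/
theorem one_add_pow_le_exp_sq (M : ℕ) {r : ℝ} (hr : 0 ≤ r) :
    (1 + r) ^ M * Real.exp (-r ^ 2 / 4) ≤ M.factorial * Real.exp 2 := by
  have h1 : (1 + r) ^ M ≤ M.factorial * Real.exp (1 + r) := by
    have := Real.pow_div_factorial_le_exp (1 + r) (by linarith) M
    rwa [div_le_iff₀' (by positivity)] at this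
  calc (1 + r) ^ M * Real.exp (-r ^ 2 / 4)
      ≤ M.factorial * Real.exp (1 + r) * Real.exp (-r ^ 2 / 4) := by gcongr
    _ = M.factorial * Real.exp (1 + r + -r ^ 2 / 4) := by rw [mul_assoc, ← Real.exp_add]
    _ ≤ M.factorial * Real.exp 2 := by
        gcongr
        nlinarith [sq_nonneg (r - 2)]

/-- Every derivative of `exp (-‖x‖² / 4)` is bounded by a polynomial times the Gaussian
itself (Faà di Bruno), which gives the Schwartz decay. -/
theorem exists_decay_exp_sq (k l : ℕ) : ∃ C, ∀ x : EuclideanSpace ℝ (Fin n),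
    ‖x‖ ^ k * ‖iteratedFDeriv ℝ l (fun x : EuclideanSpace ℝ (Fin n) =>
      Real.exp (-‖x‖ ^ 2 / 4)) x‖ ≤ C := by
  have hT : Function.HasTemperateGrowth fun x : EuclideanSpace ℝ (Fin n) => -‖x‖ ^ 2 / 4 := by
    have h1 := (Function.HasTemperateGrowth.const (E := EuclideanSpace ℝ (Fin n)) (-1 / 4 : ℝ)).mul
      (Function.hasTemperateGrowth_norm_sq (EuclideanSpace ℝ (Fin n)))
    have h2 : (fun x : EuclideanSpace ℝ (Fin n) => -‖x‖ ^ 2 / 4) =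
        (fun _ => (-1 / 4 : ℝ)) * fun x => ‖x‖ ^ 2 := by
      funext x
      simp only [Pi.mul_apply]
      ring
    rw [h2]
    exact h1
  obtain ⟨q, C, hC, hb⟩ := hT.norm_iteratedFDeriv_le_uniform l
  refine ⟨l.factorial * (1 + C) ^ l * ((k + q * l).factorial * Real.exp 2), fun x => ?_⟩
  have key := norm_iteratedFDeriv_comp_le (𝕜 := ℝ) (g := Real.exp) (n := l) (N := (⊤ : ℕ∞))
    Real.contDiff_exp hT.1 (by exact_mod_cast le_top) x
    (C := Real.exp (-‖x‖ ^ 2 / 4)) (D := (1 + C) * (1 + ‖x‖) ^ q)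
    (by
      intro i _
      rw [norm_iteratedFDeriv_eq_norm_iteratedDeriv, iteratedDeriv_eq_iterate, Real.iter_deriv_exp,
        Real.norm_of_nonneg (Real.exp_pos _).le])
    (by
      intro i hi hil
      have h1 : 1 ≤ (1 + ‖x‖) ^ q := one_le_pow₀ (by linarith [norm_nonneg x])
      have h2 : 1 ≤ (1 + C) * (1 + ‖x‖) ^ q := by nlinarith
      calc _ ≤ C * (1 + ‖x‖) ^ q := hb i hil x
        _ ≤ (1 + C) * (1 + ‖x‖) ^ q := by gcongr; linarith
        _ ≤ _ := le_self_pow₀ h2 (by omega))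
  have key' : ‖iteratedFDeriv ℝ l (fun x : EuclideanSpace ℝ (Fin n) =>
      Real.exp (-‖x‖ ^ 2 / 4)) x‖ ≤ _ := key
  have h3 := one_add_pow_le_exp_sq (k + q * l) (norm_nonneg x)
  calc _ ≤ (1 + ‖x‖) ^ k * (l.factorial * Real.exp (-‖x‖ ^ 2 / 4) *
        ((1 + C) * (1 + ‖x‖) ^ q) ^ l) := by
        gcongr
        linarith
    _ = l.factorial * (1 + C) ^ l * ((1 + ‖x‖) ^ (k + q * l) * Real.exp (-‖x‖ ^ 2 / 4)) := by
        rw [mul_pow, ← pow_mul, pow_add]; ring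
    _ ≤ _ := by gcongr

/-- The Gaussian `gaussW` as a Schwartz function. -/
noncomputable def gaussSchwartz (n : ℕ) : 𝓢(EuclideanSpace ℝ (Fin n), ℝ) :=
  ((4 * Real.pi) ^ ((n : ℝ) / 2))⁻¹ •
    { toFun := fun x => Real.exp (-‖x‖ ^ 2 / 4)
      smooth' := Real.contDiff_exp.comp (((contDiff_norm_sq ℝ).neg).div_const 4)
      decay' := exists_decay_exp_sq }

theorem gaussSchwartz_apply (x : EuclideanSpace ℝ (Fin n)) : gaussSchwartz n x = gaussW x := by
  rw [gaussSchwartz, smul_apply, gaussW, smul_eq_mul]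
  exact (div_eq_inv_mul _ _).symm

/-- The `i`-th partial derivative of a Schwartz function. -/
noncomputable def pd (i : Fin n) (K : 𝓢(EuclideanSpace ℝ (Fin n), ℝ)) :
    𝓢(EuclideanSpace ℝ (Fin n), ℝ) :=
  ∂_{(EuclideanSpace.single i 1 : EuclideanSpace ℝ (Fin n))} K

theorem pd_apply (i : Fin n) (K : 𝓢(EuclideanSpace ℝ (Fin n), ℝ)) (x : EuclideanSpace ℝ (Fin n)) :
    pd i K x = fderiv ℝ K x (EuclideanSpace.single i 1) :=
  SchwartzMap.lineDerivOp_apply_eq_fderiv _ _ _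

theorem pd_add (i : Fin n) (K L : 𝓢(EuclideanSpace ℝ (Fin n), ℝ)) :
    pd i (K + L) = pd i K + pd i L := LineDeriv.lineDerivOp_add _ _ _

theorem pd_smul (i : Fin n) (c : ℝ) (K : 𝓢(EuclideanSpace ℝ (Fin n), ℝ)) :
    pd i (c • K) = c • pd i K := LineDeriv.lineDerivOp_smul _ _ _

theorem pd_zero (i : Fin n) : pd i (0 : 𝓢(EuclideanSpace ℝ (Fin n), ℝ)) = 0 := by
  simpa using pd_smul i 0 (0 : 𝓢(EuclideanSpace ℝ (Fin n), ℝ))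

/-- Multiplication of a Schwartz function by the `i`-th coordinate. -/
noncomputable def coordMul (i : Fin n) (K : 𝓢(EuclideanSpace ℝ (Fin n), ℝ)) :
    𝓢(EuclideanSpace ℝ (Fin n), ℝ) :=
  SchwartzMap.smulLeftCLM ℝ (fun x : EuclideanSpace ℝ (Fin n) => x i) K

theorem hasTemperateGrowth_coord (i : Fin n) :
    Function.HasTemperateGrowth fun x : EuclideanSpace ℝ (Fin n) => x i :=
  (EuclideanSpace.proj (𝕜 := ℝ) i : EuclideanSpace ℝ (Fin n) →L[ℝ] ℝ).hasTemperateGrowth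

theorem coordMul_apply (i : Fin n) (K : 𝓢(EuclideanSpace ℝ (Fin n), ℝ))
    (x : EuclideanSpace ℝ (Fin n)) : coordMul i K x = x i * K x := by
  rw [coordMul, SchwartzMap.smulLeftCLM_apply_apply (hasTemperateGrowth_coord i), smul_eq_mul]

theorem pd_coordMul_apply (i : Fin n) (K : 𝓢(EuclideanSpace ℝ (Fin n), ℝ))
    (x : EuclideanSpace ℝ (Fin n)) : pd i (coordMul i K) x = K x + x i * pd i K x := by
  have h1 : (coordMul i K : EuclideanSpace ℝ (Fin n) → ℝ) =
      fun x => (EuclideanSpace.proj (𝕜 := ℝ) i : EuclideanSpace ℝ (Fin n) →L[ℝ] ℝ) x * K x := by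
    funext y; rw [coordMul_apply]; rfl
  have h2 := ((EuclideanSpace.proj (𝕜 := ℝ) i :
    EuclideanSpace ℝ (Fin n) →L[ℝ] ℝ).hasFDerivAt (x := x)).mul (K.hasFDerivAt x)
  replace h2 : HasFDerivAt (fun x => (EuclideanSpace.proj (𝕜 := ℝ) i :
    EuclideanSpace ℝ (Fin n) →L[ℝ] ℝ) x * K x) _ x := h2
  rw [pd_apply, pd_apply, h1, h2.fderiv]
  simp
  ring

/-- The Euler operator `K ↦ ∑ᵢ xᵢ ∂ᵢK`. -/
noncomputable def euler (K : 𝓢(EuclideanSpace ℝ (Fin n), ℝ)) : 𝓢(EuclideanSpace ℝ (Fin n), ℝ) :=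
  ∑ i, coordMul i (pd i K)

theorem sum_coord_smul_single (x : EuclideanSpace ℝ (Fin n)) :
    ∑ i, x i • (EuclideanSpace.single i 1 : EuclideanSpace ℝ (Fin n)) = x := by
  have := (EuclideanSpace.basisFun (Fin n) ℝ).sum_repr x
  simpa using this

theorem clm_apply_eq_sum (T : EuclideanSpace ℝ (Fin n) →L[ℝ] ℝ) (x : EuclideanSpace ℝ (Fin n)) :
    T x = ∑ i, x i * T (EuclideanSpace.single i 1) := by
  conv_lhs => rw [← sum_coord_smul_single x]
  simp [map_sum]

theorem euler_apply (K : 𝓢(EuclideanSpace ℝ (Fin n), ℝ)) (x : EuclideanSpace ℝ (Fin n)) :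
    euler K x = fderiv ℝ K x x := by
  rw [clm_apply_eq_sum (fderiv ℝ K x) x, euler, sum_apply]
  simp only [coordMul_apply, pd_apply]

theorem hasFDerivAt_fderiv (K : 𝓢(EuclideanSpace ℝ (Fin n), ℝ)) (x : EuclideanSpace ℝ (Fin n)) :
    HasFDerivAt (fderiv ℝ K) (fderiv ℝ (fderiv ℝ K) x) x :=
  (((K.smooth ⊤).fderiv_right (m := 1) (by norm_cast)).differentiable (by norm_num) x).hasFDerivAt

/-- `∂ᵢ (x · ∇K) = ∂ᵢK + x · ∇∂ᵢK`. -/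
theorem pd_euler (i : Fin n) (K : 𝓢(EuclideanSpace ℝ (Fin n), ℝ)) :
    pd i (euler K) = pd i K + euler (pd i K) := by
  ext x
  rw [add_apply, euler_apply, pd_apply, pd_apply]
  have h1 : (euler K : EuclideanSpace ℝ (Fin n) → ℝ) = fun x => fderiv ℝ K x x :=
    funext fun y => euler_apply K y
  have h2 : (pd i K : EuclideanSpace ℝ (Fin n) → ℝ) =
      fun x => fderiv ℝ K x (EuclideanSpace.single i 1) := funext fun y => pd_apply i K y
  have h3 := (hasFDerivAt_fderiv K x).clm_apply (hasFDerivAt_id x)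
  have h4 := (hasFDerivAt_fderiv K x).clm_apply
    (hasFDerivAt_const (EuclideanSpace.single i (1 : ℝ) : EuclideanSpace ℝ (Fin n)) x)
  have hs : IsSymmSndFDerivAt ℝ K x :=
    (K.contDiffAt 2 (x := x)).isSymmSndFDerivAt (by simp)
  rw [h1, h2]
  simp only [id] at h3
  rw [h3.fderiv, h4.fderiv]
  simp [hs.eq (EuclideanSpace.single i 1) x]

/-- `K` is a sum of partial derivatives of order `k` of Schwartz functions. -/
def IsSumDeriv : ℕ → 𝓢(EuclideanSpace ℝ (Fin n), ℝ) → Prop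
  | 0, _ => True
  | k + 1, K => ∃ L : Fin n → 𝓢(EuclideanSpace ℝ (Fin n), ℝ),
      (∀ i, IsSumDeriv k (L i)) ∧ K = ∑ i, pd i (L i)

theorem IsSumDeriv.zero (k : ℕ) : IsSumDeriv k (0 : 𝓢(EuclideanSpace ℝ (Fin n), ℝ)) := by
  induction k with
  | zero => trivial
  | succ k ih => exact ⟨fun _ => 0, fun _ => ih, by simp [pd_zero]⟩

theorem IsSumDeriv.add {k : ℕ} {K L : 𝓢(EuclideanSpace ℝ (Fin n), ℝ)} (hK : IsSumDeriv k K)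
    (hL : IsSumDeriv k L) : IsSumDeriv k (K + L) := by
  induction k generalizing K L with
  | zero => trivial
  | succ k ih =>
    obtain ⟨A, hA, rfl⟩ := hK
    obtain ⟨B, hB, rfl⟩ := hL
    exact ⟨fun i => A i + B i, fun i => ih (hA i) (hB i), by
      simp only [pd_add, Finset.sum_add_distrib]⟩

theorem IsSumDeriv.sum {ι : Type*} {k : ℕ} {K : ι → 𝓢(EuclideanSpace ℝ (Fin n), ℝ)}
    (s : Finset ι) (hK : ∀ i ∈ s, IsSumDeriv k (K i)) : IsSumDeriv k (∑ i ∈ s, K i) := by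
  classical
  induction s using Finset.induction_on with
  | empty => simpa using IsSumDeriv.zero k
  | insert a s ha ih =>
    rw [Finset.sum_insert ha]
    exact (hK a (by simp)).add (ih fun i hi => hK i (by simp [hi]))

theorem IsSumDeriv.partial_succ {k : ℕ} {K : 𝓢(EuclideanSpace ℝ (Fin n), ℝ)} (hK : IsSumDeriv k K)
    (i : Fin n) : IsSumDeriv (k + 1) (pd i K) := by
  refine ⟨fun j => if j = i then K else 0, fun j => ?_, ?_⟩
  · dsimp only
    split_ifs
    · exact hK
    · exact .zero k
  · rw [Finset.sum_eq_single i]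
    · simp
    · intro j _ hj
      simp [hj, pd_zero]
    · simp

/-- The `t`-derivative of `t^(-n-k) K((x-y)/t)` gains one order of cancellation: already
`-n K - x·∇K = -∑ᵢ ∂ᵢ(xᵢ K)`, and the Euler operator commutes with `∂ᵢ` up to a multiple of `∂ᵢ`. -/
theorem IsSumDeriv.dilation {k : ℕ} {K : 𝓢(EuclideanSpace ℝ (Fin n), ℝ)} (hK : IsSumDeriv k K) :
    IsSumDeriv (k + 1) ((-(n : ℝ) - k) • K - euler K) := by
  induction k generalizing K with
  | zero =>
    refine ⟨fun i => (-1 : ℝ) • coordMul i K, fun _ => trivial, ?_⟩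
    ext x
    simp only [sub_apply, smul_apply, sum_apply, pd_smul,
      pd_coordMul_apply, euler, coordMul_apply, smul_eq_mul, ← Finset.mul_sum,
      Finset.sum_add_distrib, Finset.sum_const, Finset.card_univ, Fintype.card_fin, nsmul_eq_mul]
    push_cast
    ring
  | succ k ih =>
    obtain ⟨A, hA, rfl⟩ := hK
    refine ⟨fun i => (-(n : ℝ) - k) • A i - euler (A i), fun i => ih (hA i), ?_⟩
    have hE : euler (∑ i, pd i (A i)) = ∑ i, euler (pd i (A i)) := by
      ext x
      have hd : ∀ i ∈ Finset.univ, HasFDerivAt (pd i (A i)) (fderiv ℝ (pd i (A i)) x) x :=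
        fun i _ => (pd i (A i)).hasFDerivAt x
      have h1 := HasFDerivAt.fun_sum hd
      have h2 : ((∑ i, pd i (A i) : 𝓢(EuclideanSpace ℝ (Fin n), ℝ)) :
          EuclideanSpace ℝ (Fin n) → ℝ) = fun y => ∑ i, pd i (A i) y := by
        funext y; rw [sum_apply]
      rw [euler_apply, h2, h1.fderiv, sum_apply]
      simp [euler_apply]
    rw [hE, Finset.smul_sum, ← Finset.sum_sub_distrib]
    refine Finset.sum_congr rfl fun i _ => ?_
    dsimp only
    rw [sub_eq_add_neg ((-(n : ℝ) - k) • A i) (euler (A i)), pd_add, pd_smul,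
      ← neg_one_smul ℝ (euler (A i)), pd_smul, pd_euler]
    push_cast
    module

end Kernels

/-! ### Smoothness of convolutions with dilated Schwartz kernels -/

section DilConv

variable {n : ℕ}

/-- `f` has polynomial growth on average: it is integrable against some negative power of
`1 + ‖x‖`. -/
def PolyInt (f : EuclideanSpace ℝ (Fin n) → ℝ) : Prop :=
  ∃ N : ℕ, Integrable fun x => ((1 + ‖x‖) ^ N)⁻¹ * f x

theorem PolyInt.aestronglyMeasurable {f : EuclideanSpace ℝ (Fin n) → ℝ} (hf : PolyInt f) :
    AEStronglyMeasurable f volume := by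
  obtain ⟨N, hN⟩ := hf
  have hc : Continuous fun x : EuclideanSpace ℝ (Fin n) => (1 + ‖x‖) ^ N := by fun_prop
  have h1 := hc.aestronglyMeasurable (μ := volume).mul hN.aestronglyMeasurable
  refine h1.congr (.of_forall fun x => ?_)
  have : (1 + ‖x‖) ^ N ≠ 0 := by positivity
  simp only [Pi.mul_apply]
  field_simp

theorem PolyInt.congr {f g : EuclideanSpace ℝ (Fin n) → ℝ} (hf : PolyInt f)
    (h : f =ᵐ[volume] g) : PolyInt g := by
  obtain ⟨N, hN⟩ := hf
  refine ⟨N, hN.congr ?_⟩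
  filter_upwards [h] with x hx
  rw [hx]

/-- A rapidly decreasing function is integrable against `f` when `f` has polynomial growth on
average. -/
theorem PolyInt.integrable_mul {f φ : EuclideanSpace ℝ (Fin n) → ℝ} (hf : PolyInt f)
    (hφ : AEStronglyMeasurable φ volume)
    (hb : ∀ N : ℕ, ∃ C, ∀ x, |φ x| ≤ C * ((1 + ‖x‖) ^ N)⁻¹) :
    Integrable fun x => φ x * f x := by
  have hm := hf.aestronglyMeasurable
  obtain ⟨N, hN⟩ := hf
  obtain ⟨C, hC⟩ := hb N
  refine (hN.norm.const_mul C).mono' (hφ.mul hm) (.of_forall fun x => ?_)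
  rw [norm_mul, norm_mul, Real.norm_eq_abs, Real.norm_of_nonneg (r := ((1 + ‖x‖) ^ N)⁻¹)
    (by positivity), ← mul_assoc]
  gcongr
  exact hC x

theorem schwartz_decay (K : 𝓢(EuclideanSpace ℝ (Fin n), ℝ)) (N : ℕ) :
    ∃ C, 0 ≤ C ∧ ∀ x, |K x| ≤ C * ((1 + ‖x‖) ^ N)⁻¹ := by
  refine ⟨2 ^ N * ((Finset.Iic (N, 0)).sup fun m => SchwartzMap.seminorm ℝ m.1 m.2) K,
    by positivity, fun x => ?_⟩
  rw [← div_eq_mul_inv, le_div_iff₀' (by positivity)]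
  have := SchwartzMap.one_add_le_sup_seminorm_apply (𝕜 := ℝ) (m := (N, 0)) le_rfl le_rfl K x
  simpa using this

/-- The dilated kernel `(x, t), y ↦ t^e K((x - y) / t)`, with `z = (x, t)`. It is only meaningful
for `t > 0`. The exponent `e` is free, since differentiation lowers it by one. -/
noncomputable def dilKer (e : ℤ) (K : 𝓢(EuclideanSpace ℝ (Fin n), ℝ))
    (z : EuclideanSpace ℝ (Fin n) × ℝ)
    (y : EuclideanSpace ℝ (Fin n)) : ℝ :=
  z.2 ^ e * K (z.2⁻¹ • (z.1 - y))

/-- The convolution `(x, t) ↦ ∫ t^e K((x - y) / t) f(y) dy`. -/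
noncomputable def dilConv (e : ℤ) (K : 𝓢(EuclideanSpace ℝ (Fin n), ℝ))
    (f : EuclideanSpace ℝ (Fin n) → ℝ)
    (z : EuclideanSpace ℝ (Fin n) × ℝ) : ℝ :=
  ∫ y, dilKer e K z y * f y

theorem heatExt_eq_dilConv (f : EuclideanSpace ℝ (Fin n) → ℝ) :
    heatExt f = dilConv (-n) (gaussSchwartz n) f := by
  funext z
  simp only [heatExt, dilConv, dilKer, gaussWt, gaussSchwartz_apply, one_div, zpow_neg,
    zpow_natCast]

theorem gaussWt_eq_dilKer (t : ℝ) (x y : EuclideanSpace ℝ (Fin n)) :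
    gaussWt t (x - y) = dilKer (-n) (gaussSchwartz n) (x, t) y := by
  simp only [dilKer, gaussWt, gaussSchwartz_apply, one_div, zpow_neg, zpow_natCast]

theorem isOpen_halfSpace : IsOpen (halfSpace n) := isOpen_lt continuous_const continuous_snd

/-- Near a point of the half-space, dilated kernels decay rapidly in `y`, uniformly in `(x, t)`. -/
theorem dilKer_bound (e : ℤ) (K : 𝓢(EuclideanSpace ℝ (Fin n), ℝ)) (N : ℕ)
    {z₀ : EuclideanSpace ℝ (Fin n) × ℝ} (hz₀ : 0 < z₀.2) :
    ∃ C, ∀ z ∈ Metric.ball z₀ (z₀.2 / 2), ∀ y, |dilKer e K z y| ≤ C * ((1 + ‖y‖) ^ N)⁻¹ := by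
  have hpos : ∀ z ∈ Metric.closedBall z₀ (z₀.2 / 2), z₀.2 / 2 ≤ z.2 := by
    intro z hz
    have h1 : dist z.2 z₀.2 ≤ z₀.2 / 2 := (le_max_right _ _).trans (Metric.mem_closedBall.1 hz)
    rw [Real.dist_eq, abs_le] at h1
    linarith
  obtain ⟨A, hA⟩ := (isCompact_closedBall z₀ (z₀.2 / 2)).exists_bound_of_continuousOn
    (f := fun z => z.2 ^ e) (continuousOn_snd.zpow₀ e fun z hz => Or.inl
      (by have := hpos z hz; intro h; linarith))
  obtain ⟨B, hB⟩ := (isCompact_closedBall z₀ (z₀.2 / 2)).exists_bound_of_continuousOn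
    (f := fun z => z) continuousOn_id
  obtain ⟨C, hC0, hC⟩ := schwartz_decay K N
  refine ⟨A * (C * (1 + 2 * B) ^ N), fun z hz y => ?_⟩
  replace hz := Metric.ball_subset_closedBall hz
  have hz2 : 0 < z.2 := by have := hpos z hz; linarith
  have hn1 : ‖z.1‖ ≤ B := (norm_fst_le z).trans (hB z hz)
  have hn2 : z.2 ≤ B := (le_abs_self _).trans ((norm_snd_le z).trans (hB z hz))
  set w := z.2⁻¹ • (z.1 - y) with hw
  have hy : y = z.1 - z.2 • w := by rw [hw, smul_inv_smul₀ hz2.ne']; abel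
  have h1 : 1 + ‖y‖ ≤ (1 + 2 * B) * (1 + ‖w‖) := by
    have : ‖y‖ ≤ ‖z.1‖ + z.2 * ‖w‖ := by
      conv_lhs => rw [hy]
      refine (norm_sub_le _ _).trans ?_
      rw [norm_smul, Real.norm_of_nonneg hz2.le]
    nlinarith [norm_nonneg w]
  have hA0 : 0 ≤ A := (norm_nonneg _).trans (hA z hz)
  have hB0 : 0 ≤ B := hz2.le.trans hn2
  rw [dilKer, abs_mul, mul_assoc]
  refine mul_le_mul (hA z hz) ?_ (abs_nonneg _) hA0
  refine (hC w).trans ?_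
  rw [mul_assoc]
  refine mul_le_mul_of_nonneg_left ?_ hC0
  rw [← div_eq_mul_inv, le_div_iff₀ (by positivity), inv_mul_le_iff₀ (by positivity), ← mul_pow,
    mul_comm (1 + ‖w‖)]
  gcongr

theorem continuous_dilKer (e : ℤ) (K : 𝓢(EuclideanSpace ℝ (Fin n), ℝ))
    (z : EuclideanSpace ℝ (Fin n) × ℝ) : Continuous (dilKer e K z) := by
  have := K.continuous
  unfold dilKer
  fun_prop

theorem integrable_dilKer_mul (e : ℤ) (K : 𝓢(EuclideanSpace ℝ (Fin n), ℝ))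
    {f : EuclideanSpace ℝ (Fin n) → ℝ} (hf : PolyInt f) {z : EuclideanSpace ℝ (Fin n) × ℝ}
    (hz : 0 < z.2) : Integrable fun y => dilKer e K z y * f y := by
  refine hf.integrable_mul (continuous_dilKer e K z).aestronglyMeasurable fun N => ?_
  obtain ⟨C, hC⟩ := dilKer_bound e K N hz
  exact ⟨C, fun y => hC z (Metric.mem_ball_self (by linarith)) y⟩

theorem dilConv_sum {ι : Type*} (s : Finset ι) (e : ℤ)
    (K : ι → 𝓢(EuclideanSpace ℝ (Fin n), ℝ))
    {f : EuclideanSpace ℝ (Fin n) → ℝ} (hf : PolyInt f) {z : EuclideanSpace ℝ (Fin n) × ℝ}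
    (hz : 0 < z.2) : dilConv e (∑ i ∈ s, K i) f z = ∑ i ∈ s, dilConv e (K i) f z := by
  unfold dilConv
  rw [← integral_finsetSum s fun i _ => integrable_dilKer_mul e (K i) hf hz]
  congr 1
  funext y
  simp only [dilKer, sum_apply, Finset.mul_sum, Finset.sum_mul]

/-- The kernel obtained from `K` when `(x, t) ↦ t^e K((x - y) / t)` is differentiated in the
direction of a basis vector. -/
noncomputable def dirOp (e : ℤ) (K : 𝓢(EuclideanSpace ℝ (Fin n), ℝ)) :
    Fin n ⊕ Unit → 𝓢(EuclideanSpace ℝ (Fin n), ℝ) :=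
  Sum.elim (fun i => pd i K) (fun _ => (e : ℝ) • K - euler K)

/-- The coordinate functionals dual to `stdBasis`. -/
noncomputable def coordCLM : Fin n ⊕ Unit → (EuclideanSpace ℝ (Fin n) × ℝ →L[ℝ] ℝ) :=
  Sum.elim
    (fun i => (EuclideanSpace.proj (𝕜 := ℝ) i : EuclideanSpace ℝ (Fin n) →L[ℝ] ℝ) ∘L
      ContinuousLinearMap.fst ℝ _ _)
    (fun _ => ContinuousLinearMap.snd ℝ _ _)

theorem coordCLM_stdBasis (b c : Fin n ⊕ Unit) :
    coordCLM b (stdBasis (n := n) c) = if b = c then 1 else 0 := by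
  rcases b with i | _ <;> rcases c with j | _ <;> simp [coordCLM, stdBasis]

theorem hasFDerivAt_dilKer (e : ℤ) (K : 𝓢(EuclideanSpace ℝ (Fin n), ℝ))
    {z : EuclideanSpace ℝ (Fin n) × ℝ} (hz : 0 < z.2) (y : EuclideanSpace ℝ (Fin n)) :
    HasFDerivAt (fun z => dilKer e K z y)
      (∑ b, dilKer (e - 1) (dirOp e K b) z y • coordCLM b) z := by
  have h1 : HasFDerivAt (fun z : EuclideanSpace ℝ (Fin n) × ℝ => z.1 - y)
      (ContinuousLinearMap.fst ℝ _ _) z := hasFDerivAt_fst.sub_const y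
  have h2 : HasFDerivAt (fun z : EuclideanSpace ℝ (Fin n) × ℝ => z.2⁻¹)
      (-(z.2 ^ 2)⁻¹ • ContinuousLinearMap.snd ℝ (EuclideanSpace ℝ (Fin n)) ℝ) z :=
    (hasDerivAt_inv hz.ne').comp_hasFDerivAt z hasFDerivAt_snd
  have h3 : HasFDerivAt (fun z : EuclideanSpace ℝ (Fin n) × ℝ => z.2 ^ e)
      ((e * z.2 ^ (e - 1)) • ContinuousLinearMap.snd ℝ (EuclideanSpace ℝ (Fin n)) ℝ) z :=
    (hasDerivAt_zpow e z.2 (Or.inl hz.ne')).comp_hasFDerivAt z hasFDerivAt_snd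
  have h4 := (K.hasFDerivAt (z.2⁻¹ • (z.1 - y))).comp z (h2.smul h1)
  have h5 := h3.mul h4
  refine h5.congr_fderiv ?_
  ext v
  · simp only [Fintype.sum_sum_type, dirOp, coordCLM, dilKer, Sum.elim_inl, Sum.elim_inr]
    simp [pd_apply]
    rw [clm_apply_eq_sum _ v, zpow_sub_one₀ hz.ne']
    simp only [Finset.mul_sum]
    refine Finset.sum_congr rfl fun i _ => ?_
    ring
  · simp only [Fintype.sum_sum_type, dirOp, coordCLM, dilKer, Sum.elim_inl, Sum.elim_inr]
    simp [euler_apply, sub_apply, smul_apply]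
    rw [zpow_sub_one₀ hz.ne']
    field_simp
    ring

/-- Differentiation under the integral sign; each derivative of the kernel is again a dilated
kernel, with exponent `e - 1`. -/
theorem hasFDerivAt_dilConv (e : ℤ) (K : 𝓢(EuclideanSpace ℝ (Fin n), ℝ))
    {f : EuclideanSpace ℝ (Fin n) → ℝ} (hf : PolyInt f) {z : EuclideanSpace ℝ (Fin n) × ℝ}
    (hz : 0 < z.2) :
    HasFDerivAt (dilConv e K f)
      (∑ b, dilConv (e - 1) (dirOp e K b) f z • coordCLM b) z := by
  obtain ⟨N, hN⟩ := id hf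
  have hb := fun b => dilKer_bound (e - 1) (dirOp e K b) N hz
  choose C hC using hb
  have hpos : ∀ x ∈ Metric.ball z (z.2 / 2), 0 < x.2 := by
    intro x hx
    have h1 : dist x.2 z.2 < z.2 / 2 := (le_max_right _ _).trans_lt (Metric.mem_ball.1 hx)
    rw [Real.dist_eq, abs_lt] at h1
    linarith
  have hm := hf.aestronglyMeasurable
  have hI : ∀ b, Integrable fun y => (dilKer (e - 1) (dirOp e K b) z y * f y) • coordCLM b :=
    fun b => (integrable_dilKer_mul (e - 1) (dirOp e K b) hf hz).smul_const _
  have hbound : Integrable fun y =>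
      ∑ b, (C b * ‖((1 + ‖y‖) ^ N)⁻¹ * f y‖) * ‖coordCLM (n := n) b‖ :=
    integrable_finsetSum _ fun b _ => (hN.norm.const_mul _).mul_const _
  have hle : ∀ y, ∀ x ∈ Metric.ball z (z.2 / 2),
      ‖∑ b, (dilKer (e - 1) (dirOp e K b) x y * f y) • coordCLM b‖ ≤
        ∑ b, (C b * ‖((1 + ‖y‖) ^ N)⁻¹ * f y‖) * ‖coordCLM (n := n) b‖ := by
    intro y x hx
    refine (norm_sum_le _ _).trans (Finset.sum_le_sum fun b _ => ?_)
    rw [norm_smul, norm_mul, norm_mul, Real.norm_of_nonneg (r := ((1 + ‖y‖) ^ N)⁻¹)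
      (by positivity), ← mul_assoc]
    refine mul_le_mul_of_nonneg_right ?_ (norm_nonneg _)
    exact mul_le_mul_of_nonneg_right (hC b x hx y) (norm_nonneg _)
  have hder : ∀ y, ∀ x ∈ Metric.ball z (z.2 / 2), HasFDerivAt (fun x => dilKer e K x y * f y)
      (∑ b, (dilKer (e - 1) (dirOp e K b) x y * f y) • coordCLM b) x := by
    intro y x hx
    refine ((hasFDerivAt_dilKer e K (hpos x hx) y).mul_const (f y)).congr_fderiv ?_
    rw [Finset.smul_sum]
    refine Finset.sum_congr rfl fun b _ => ?_
    rw [smul_smul, mul_comm]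
  have hS : Integrable fun y => ∑ b, (dilKer (e - 1) (dirOp e K b) z y * f y) • coordCLM b :=
    integrable_finsetSum Finset.univ (f := fun b y =>
      (dilKer (e - 1) (dirOp e K b) z y * f y) • coordCLM (n := n) b) fun b _ => hI b
  have key : HasFDerivAt (fun z => ∫ y, dilKer e K z y * f y)
      (∫ y, ∑ b, (dilKer (e - 1) (dirOp e K b) z y * f y) • coordCLM b) z := by
    refine hasFDerivAt_integral_of_dominated_of_fderiv_le
      (F' := fun x y => ∑ b, (dilKer (e - 1) (dirOp e K b) x y * f y) • coordCLM b)
      (Metric.ball_mem_nhds z (half_pos hz)) (.of_forall fun x => ?_)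
      (integrable_dilKer_mul e K hf hz) hS.aestronglyMeasurable
      (.of_forall hle) hbound (.of_forall hder)
    exact (continuous_dilKer e K x).aestronglyMeasurable.mul hm
  refine key.congr_fderiv ?_
  rw [integral_finsetSum Finset.univ (f := fun b y =>
    (dilKer (e - 1) (dirOp e K b) z y * f y) • coordCLM (n := n) b) fun b _ => hI b]
  refine Finset.sum_congr rfl fun b _ => ?_
  rw [integral_smul_const, dilConv]

theorem contDiffOn_dilConv (j : ℕ) (e : ℤ) (K : 𝓢(EuclideanSpace ℝ (Fin n), ℝ))
    {f : EuclideanSpace ℝ (Fin n) → ℝ} (hf : PolyInt f) :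
    ContDiffOn ℝ j (dilConv e K f) (halfSpace n) := by
  induction j generalizing e K with
  | zero =>
    exact contDiffOn_zero.2 fun z hz =>
      (hasFDerivAt_dilConv e K hf hz).continuousAt.continuousWithinAt
  | succ j ih =>
    push_cast
    rw [contDiffOn_succ_iff_fderiv_of_isOpen isOpen_halfSpace]
    refine ⟨fun z hz => (hasFDerivAt_dilConv e K hf hz).differentiableAt.differentiableWithinAt,
      fun h => by simp at h, ?_⟩
    refine ContDiffOn.congr (f := fun z => ∑ b, dilConv (e - 1) (dirOp e K b) f z • coordCLM b)
      ?_ fun z hz => (hasFDerivAt_dilConv e K hf hz).fderiv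
    exact ContDiffOn.sum fun b _ => (ih (e - 1) (dirOp e K b)).smul contDiffOn_const

theorem fderiv_dilConv_stdBasis (e : ℤ) (K : 𝓢(EuclideanSpace ℝ (Fin n), ℝ))
    {f : EuclideanSpace ℝ (Fin n) → ℝ} (hf : PolyInt f) {z : EuclideanSpace ℝ (Fin n) × ℝ}
    (hz : 0 < z.2) (b : Fin n ⊕ Unit) :
    fderiv ℝ (dilConv e K f) z (stdBasis b) = dilConv (e - 1) (dirOp e K b) f z := by
  rw [(hasFDerivAt_dilConv e K hf hz).fderiv]
  simp [coordCLM_stdBasis, -Fintype.sum_sum_type]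

/-- Every partial derivative of order `k` of `W_t * f` is a convolution with a dilated kernel that
is itself a sum of spatial derivatives of order `k`, whatever the number of `t`-derivatives. -/
theorem iteratedFDeriv_heatExt (k : ℕ) (b : Fin k → Fin n ⊕ Unit) :
    ∃ K : 𝓢(EuclideanSpace ℝ (Fin n), ℝ), IsSumDeriv k K ∧
      ∀ f : EuclideanSpace ℝ (Fin n) → ℝ, PolyInt f → ∀ z ∈ halfSpace n,
        iteratedFDeriv ℝ k (heatExt f) z (fun j => stdBasis (b j)) = dilConv (-n - k) K f z := by
  induction k with
  | zero =>
    refine ⟨gaussSchwartz n, trivial, fun f _ z _ => ?_⟩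
    rw [iteratedFDeriv_zero_apply, heatExt_eq_dilConv]
    simp
  | succ k ih =>
    obtain ⟨K, hK, hrep⟩ := ih (Fin.tail b)
    refine ⟨dirOp (-n - k) K (b 0), ?_, fun f hf z hz => ?_⟩
    · rcases b 0 with i | u
      · exact hK.partial_succ i
      -- the `t`-derivative gains an order of cancellation thanks to the exponent `-n - k`
      · have := hK.dilation
        simpa [dirOp] using this
    · have hd : DifferentiableAt ℝ (iteratedFDeriv ℝ k (heatExt f)) z := by
        rw [heatExt_eq_dilConv]
        have h1 : ContDiffAt ℝ (k + 1 : ℕ) (dilConv (-n) (gaussSchwartz n) f) z :=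
          (contDiffOn_dilConv (k + 1) _ _ hf).contDiffAt (isOpen_halfSpace.mem_nhds hz)
        exact h1.differentiableAt_iteratedFDeriv (by exact_mod_cast k.lt_succ_self)
      rw [iteratedFDeriv_succ_apply_left]
      have h2 : (fun z' => iteratedFDeriv ℝ k (heatExt f) z' (fun j => stdBasis (Fin.tail b j)))
          =ᶠ[nhds z] dilConv (-n - k) K f := by
        filter_upwards [isOpen_halfSpace.mem_nhds hz] with z' hz'
        exact hrep f hf z' hz'
      have h3 := hd.hasFDerivAt.continuousMultilinear_apply_const
        (fun j => stdBasis (n := n) (Fin.tail b j))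
      have h4 := h2.fderiv_eq (𝕜 := ℝ)
      rw [h3.fderiv] at h4
      have h5 := DFunLike.congr_fun h4 (stdBasis (b 0))
      rw [fderiv_dilConv_stdBasis _ _ hf hz] at h5
      have h6 : (-n - (k + 1 : ℕ) : ℤ) = -n - k - 1 := by push_cast; ring
      rw [h6, ← h5]
      rfl

end DilConv

/-! ### Weak derivatives and integration by parts -/

section WeakDerivatives

variable {n : ℕ}

theorem contDiff_partialDeriv {φ : EuclideanSpace ℝ (Fin n) → ℝ} (hφ : ContDiff ℝ (⊤ : ℕ∞) φ)
    (i : Fin n) : ContDiff ℝ (⊤ : ℕ∞) (partialDeriv i φ) :=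
  (hφ.fderiv_right (m := (⊤ : ℕ∞)) (by norm_cast)).clm_apply contDiff_const

theorem hasCompactSupport_partialDeriv {φ : EuclideanSpace ℝ (Fin n) → ℝ}
    (hφ : HasCompactSupport φ) (i : Fin n) : HasCompactSupport (partialDeriv i φ) :=
  hφ.fderiv_apply (𝕜 := ℝ) _

theorem partialDeriv_comm {φ : EuclideanSpace ℝ (Fin n) → ℝ} (hφ : ContDiff ℝ (⊤ : ℕ∞) φ)
    (i j : Fin n) : partialDeriv i (partialDeriv j φ) = partialDeriv j (partialDeriv i φ) := by
  funext x
  have h1 : HasFDerivAt (fderiv ℝ φ) (fderiv ℝ (fderiv ℝ φ) x) x :=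
    ((hφ.fderiv_right (m := 1) (by norm_cast)).differentiable (by norm_num) x).hasFDerivAt
  have h2 (k : Fin n) := h1.clm_apply
    (hasFDerivAt_const (EuclideanSpace.single k (1 : ℝ) : EuclideanSpace ℝ (Fin n)) x)
  have hs : IsSymmSndFDerivAt ℝ φ x :=
    (hφ.contDiffAt.of_le (m := 2) (by norm_cast)).isSymmSndFDerivAt (by simp)
  unfold partialDeriv
  rw [(h2 j).fderiv, (h2 i).fderiv]
  simp [hs.eq (EuclideanSpace.single i 1) (EuclideanSpace.single j 1)]

theorem contDiff_iterate_partialDeriv {φ : EuclideanSpace ℝ (Fin n) → ℝ}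
    (hφ : ContDiff ℝ (⊤ : ℕ∞) φ) (i : Fin n) (k : ℕ) :
    ContDiff ℝ (⊤ : ℕ∞) ((partialDeriv i)^[k] φ) := by
  induction k with
  | zero => exact hφ
  | succ k ih =>
    rw [Function.iterate_succ_apply']
    exact contDiff_partialDeriv ih i

theorem partialDeriv_iterate_comm {φ : EuclideanSpace ℝ (Fin n) → ℝ}
    (hφ : ContDiff ℝ (⊤ : ℕ∞) φ) (i j : Fin n) (k : ℕ) :
    partialDeriv i ((partialDeriv j)^[k] φ) = (partialDeriv j)^[k] (partialDeriv i φ) := by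
  induction k with
  | zero => rfl
  | succ k ih =>
    rw [Function.iterate_succ_apply', Function.iterate_succ_apply',
      partialDeriv_comm (contDiff_iterate_partialDeriv hφ j k), ih]

theorem contDiff_foldr_partialDeriv {φ : EuclideanSpace ℝ (Fin n) → ℝ}
    (hφ : ContDiff ℝ (⊤ : ℕ∞) φ) (α : Fin n → ℕ) (l : List (Fin n)) :
    ContDiff ℝ (⊤ : ℕ∞) (l.foldr (fun i ψ => (partialDeriv i)^[α i] ψ) φ) := by
  induction l with
  | nil => exact hφ
  | cons j l ih => exact contDiff_iterate_partialDeriv ih j _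

theorem partialDeriv_foldr_comm {φ : EuclideanSpace ℝ (Fin n) → ℝ}
    (hφ : ContDiff ℝ (⊤ : ℕ∞) φ) (α : Fin n → ℕ) (i : Fin n) (l : List (Fin n)) :
    partialDeriv i (l.foldr (fun i ψ => (partialDeriv i)^[α i] ψ) φ) =
      l.foldr (fun i ψ => (partialDeriv i)^[α i] ψ) (partialDeriv i φ) := by
  induction l with
  | nil => rfl
  | cons j l ih =>
    simp only [List.foldr_cons]
    rw [partialDeriv_iterate_comm (contDiff_foldr_partialDeriv hφ α l), ih]

theorem multiDeriv_add_single {φ : EuclideanSpace ℝ (Fin n) → ℝ}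
    (hφ : ContDiff ℝ (⊤ : ℕ∞) φ) (α : Fin n → ℕ) (i : Fin n) :
    multiDeriv (α + Pi.single i 1) φ = multiDeriv α (partialDeriv i φ) := by
  have hnot : ∀ l : List (Fin n), i ∉ l →
      l.foldr (fun j ψ => (partialDeriv j)^[(α + Pi.single i 1 : Fin n → ℕ) j] ψ) φ =
        l.foldr (fun j ψ => (partialDeriv j)^[α j] ψ) φ := by
    intro l
    induction l with
    | nil => intro _; rfl
    | cons j l ih =>
      intro h
      rw [List.mem_cons, not_or] at h
      simp only [List.foldr_cons]
      rw [ih h.2]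
      simp [Ne.symm h.1]
  have hmem : ∀ l : List (Fin n), l.Nodup → i ∈ l →
      l.foldr (fun j ψ => (partialDeriv j)^[(α + Pi.single i 1 : Fin n → ℕ) j] ψ) φ =
        l.foldr (fun j ψ => (partialDeriv j)^[α j] ψ) (partialDeriv i φ) := by
    intro l
    induction l with
    | nil => intro _ h; simp at h
    | cons j l ih =>
      intro hl h
      rw [List.nodup_cons] at hl
      simp only [List.foldr_cons]
      by_cases hj : i = j
      · subst hj
        rw [hnot l hl.1, Pi.add_apply, Pi.single_eq_same, Function.iterate_succ_apply,
          partialDeriv_foldr_comm hφ]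
      · rw [ih hl.2 ((List.mem_cons.1 h).resolve_left hj)]
        simp [Ne.symm hj]
  exact hmem _ (List.nodup_finRange n) (List.mem_finRange i)

/-- `g` is the weak partial derivative `∂ᵢf`. -/
def HasWeakPartial (i : Fin n) (f g : EuclideanSpace ℝ (Fin n) → ℝ) : Prop :=
  LocallyIntegrable f ∧ LocallyIntegrable g ∧
    ∀ φ : EuclideanSpace ℝ (Fin n) → ℝ, ContDiff ℝ (⊤ : ℕ∞) φ → HasCompactSupport φ →
      ∫ x, f x * partialDeriv i φ x = -∫ x, g x * φ x

theorem HasWeakDeriv.hasWeakPartial {α : Fin n → ℕ} {i : Fin n}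
    {f g h : EuclideanSpace ℝ (Fin n) → ℝ} (hg : HasWeakDeriv α f g)
    (hh : HasWeakDeriv (α + Pi.single i 1) f h) : HasWeakPartial i g h := by
  refine ⟨hg.2.1, hh.2.1, fun φ hφ hc => ?_⟩
  have h1 := hg.2.2 _ (contDiff_partialDeriv hφ i) (hasCompactSupport_partialDeriv hc i)
  have h2 := hh.2.2 φ hφ hc
  rw [multiDeriv_add_single hφ, h1] at h2
  have h3 : ∑ j, (α + Pi.single i 1 : Fin n → ℕ) j = ∑ j, α j + 1 := by
    simp [Finset.sum_add_distrib]
  rw [h3, pow_succ, mul_assoc] at h2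
  have h4 := mul_left_cancel₀ (pow_ne_zero _ (by norm_num)) h2
  rw [h4]
  ring

theorem HasWeakDeriv.ae_eq_of_zero {f g : EuclideanSpace ℝ (Fin n) → ℝ}
    (h : HasWeakDeriv 0 f g) : f =ᵐ[volume] g := by
  refine ae_eq_of_integral_contDiff_smul_eq h.1 h.2.1 fun φ hφ hc => ?_
  have h0 : multiDeriv (0 : Fin n → ℕ) φ = φ := by
    unfold multiDeriv
    induction List.finRange n with
    | nil => rfl
    | cons j l ih => simp
  have := h.2.2 φ hφ hc
  rw [h0] at this
  simpa [mul_comm] using this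

/-- The identity defining a weak partial derivative, against smooth functions without compact
support for which all the integrals converge. -/
theorem HasWeakPartial.integral_eq {i : Fin n} {f g φ : EuclideanSpace ℝ (Fin n) → ℝ}
    (h : HasWeakPartial i f g) (hφ : ContDiff ℝ (⊤ : ℕ∞) φ)
    (h1 : Integrable fun x => f x * φ x) (h2 : Integrable fun x => f x * partialDeriv i φ x)
    (h3 : Integrable fun x => g x * φ x) :
    ∫ x, f x * partialDeriv i φ x = -∫ x, g x * φ x := by
  let χ : ContDiffBump (0 : EuclideanSpace ℝ (Fin n)) := ⟨1, 2, one_pos, one_lt_two⟩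
  have hχ : ContDiff ℝ (⊤ : ℕ∞) χ := χ.contDiff
  have hχc : HasCompactSupport χ := χ.hasCompactSupport
  obtain ⟨B, hB⟩ := (hasCompactSupport_partialDeriv hχc i).exists_bound_of_continuous
    (contDiff_partialDeriv hχ i).continuous
  -- the test functions are `χ(c_N x) φ(x)`, and `c_N → 0`
  let c : ℕ → ℝ := fun N => ((N : ℝ) + 1)⁻¹
  have hcpos : ∀ N, 0 < c N := fun N => by positivity
  have hcle : ∀ N, c N ≤ 1 := fun N => inv_le_one_of_one_le₀ (by
    have : (0 : ℝ) ≤ N := N.cast_nonneg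
    linarith)
  have hct : Filter.Tendsto c Filter.atTop (nhds 0) := by
    have := tendsto_one_div_add_atTop_nhds_zero_nat (𝕜 := ℝ)
    simpa [c, one_div] using this
  have hχ1 : ∀ x, Filter.Tendsto (fun N => χ (c N • x)) Filter.atTop (nhds 1) := by
    intro x
    have h0 : χ (0 : EuclideanSpace ℝ (Fin n)) = 1 :=
      χ.one_of_mem_closedBall (Metric.mem_closedBall_self χ.rIn_pos.le)
    have h4 : Filter.Tendsto (fun N => c N • x) Filter.atTop (nhds 0) := by
      simpa using hct.smul_const x
    have := (hχ.continuous.tendsto 0).comp h4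
    rwa [h0] at this
  have hχs : ∀ N, ContDiff ℝ (⊤ : ℕ∞) fun x => χ (c N • x) * φ x := fun N =>
    (hχ.comp (contDiff_const_smul (c N))).mul hφ
  have hχd : ∀ N x, partialDeriv i (fun x => χ (c N • x) * φ x) x =
      χ (c N • x) * partialDeriv i φ x + c N * partialDeriv i χ (c N • x) * φ x := by
    intro N x
    have h5 : HasFDerivAt (fun x => χ (c N • x))
        ((fderiv ℝ χ (c N • x)).comp (c N • ContinuousLinearMap.id ℝ _)) x :=
      ((hχ.differentiable (by simp)) (c N • x)).hasFDerivAt.comp x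
        ((hasFDerivAt_id x).const_smul (c N))
    have h6 : HasFDerivAt (fun x => χ (c N • x) * φ x) _ x :=
      h5.mul ((hφ.differentiable (by simp)) x).hasFDerivAt
    unfold partialDeriv
    rw [h6.fderiv]
    simp
    ring
  have hid : ∀ N, ∫ x, f x * (χ (c N • x) * partialDeriv i φ x +
      c N * partialDeriv i χ (c N • x) * φ x) = -∫ x, g x * (χ (c N • x) * φ x) := by
    intro N
    have hcs : HasCompactSupport fun x => χ (c N • x) * φ x :=
      (hχc.comp_smul (hcpos N).ne').mul_right
    have := h.2.2 _ (hχs N) hcs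
    simp only [hχd] at this
    exact this
  have hcχ : ∀ N, Continuous fun x => χ (c N • x) := fun N =>
    hχ.continuous.comp (continuous_const_smul _)
  have hcχ' : ∀ N, Continuous fun x => partialDeriv i χ (c N • x) := fun N =>
    (contDiff_partialDeriv hχ i).continuous.comp (continuous_const_smul _)
  have hφ' := (contDiff_partialDeriv hφ i).continuous
  have hfm := h.1.aestronglyMeasurable
  have hgm := h.2.1.aestronglyMeasurable
  have hbχ : ∀ y, |χ y| ≤ 1 := fun y => by
    rw [abs_of_nonneg χ.nonneg]; exact χ.le_one
  have ht1 : Filter.Tendsto (fun N => ∫ x, f x * (χ (c N • x) * partialDeriv i φ x +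
      c N * partialDeriv i χ (c N • x) * φ x)) Filter.atTop
      (nhds (∫ x, f x * partialDeriv i φ x)) := by
    refine tendsto_integral_of_dominated_convergence
      (fun x => ‖f x * partialDeriv i φ x‖ + B * ‖f x * φ x‖) (fun N => ?_)
      (h2.norm.add (h1.norm.const_mul B)) (fun N => .of_forall fun x => ?_)
      (.of_forall fun x => ?_)
    · refine hfm.mul (Continuous.aestronglyMeasurable ?_)
      exact ((hcχ N).mul hφ').add ((continuous_const.mul (hcχ' N)).mul hφ.continuous)
    · rw [mul_add]
      refine (norm_add_le _ _).trans (add_le_add ?_ ?_)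
      · rw [norm_mul, norm_mul, norm_mul]
        have := hbχ (c N • x)
        rw [← Real.norm_eq_abs] at this
        have h7 := mul_le_mul_of_nonneg_right this (norm_nonneg (partialDeriv i φ x))
        rw [one_mul] at h7
        gcongr
      · rw [norm_mul, norm_mul, norm_mul, norm_mul, Real.norm_of_nonneg (hcpos N).le]
        have h7 : c N * ‖partialDeriv i χ (c N • x)‖ ≤ B :=
          (mul_le_of_le_one_left (norm_nonneg _) (hcle N)).trans (hB _)
        calc ‖f x‖ * (c N * ‖partialDeriv i χ (c N • x)‖ * ‖φ x‖)
            ≤ ‖f x‖ * (B * ‖φ x‖) := by gcongr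
          _ = _ := by ring
    · have h8 : Filter.Tendsto (fun N => c N * partialDeriv i χ (c N • x)) Filter.atTop
          (nhds 0) := by
        refine hct.zero_mul_isBoundedUnder_le ?_
        exact Filter.isBoundedUnder_of ⟨B, fun N => hB _⟩
      have := (((hχ1 x).mul_const (partialDeriv i φ x)).add (h8.mul_const (φ x))).const_mul (f x)
      simpa using this
  have ht2 : Filter.Tendsto (fun N => -∫ x, g x * (χ (c N • x) * φ x)) Filter.atTop
      (nhds (-∫ x, g x * φ x)) := by
    refine (tendsto_integral_of_dominated_convergence (fun x => ‖g x * φ x‖) (fun N => ?_)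
      h3.norm (fun N => .of_forall fun x => ?_) (.of_forall fun x => ?_)).neg
    · exact hgm.mul ((hcχ N).mul hφ.continuous).aestronglyMeasurable
    · rw [norm_mul, norm_mul, norm_mul]
      have := hbχ (c N • x)
      rw [← Real.norm_eq_abs] at this
      have h7 := mul_le_mul_of_nonneg_right this (norm_nonneg (φ x))
      rw [one_mul] at h7
      gcongr
    · have := ((hχ1 x).mul_const (φ x)).const_mul (g x)
      simpa using this
  simp only [hid] at ht1
  exact tendsto_nhds_unique ht1 ht2

/-- A derivative of the kernel can be moved onto `f`, at the cost of a factor `t`. -/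
theorem dilConv_pd (e : ℤ) (L : 𝓢(EuclideanSpace ℝ (Fin n), ℝ)) {i : Fin n}
    {f g : EuclideanSpace ℝ (Fin n) → ℝ} (h : HasWeakPartial i f g) (hf : PolyInt f)
    (hg : PolyInt g) {z : EuclideanSpace ℝ (Fin n) × ℝ} (hz : 0 < z.2) :
    dilConv e (pd i L) f z = dilConv (e + 1) L g z := by
  let φ : EuclideanSpace ℝ (Fin n) → ℝ := fun y => L (z.2⁻¹ • (z.1 - y))
  have hφ : ContDiff ℝ (⊤ : ℕ∞) φ :=
    (L.smooth ⊤).comp ((contDiff_const.sub contDiff_id).const_smul _)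
  have hφd : ∀ y, partialDeriv i φ y = -z.2⁻¹ * pd i L (z.2⁻¹ • (z.1 - y)) := by
    intro y
    have h1 : HasFDerivAt (fun y => z.2⁻¹ • (z.1 - y))
        (z.2⁻¹ • -ContinuousLinearMap.id ℝ (EuclideanSpace ℝ (Fin n))) y :=
      ((hasFDerivAt_id y).const_sub z.1).fun_const_smul _
    have h2 : HasFDerivAt φ _ y := (L.hasFDerivAt (z.2⁻¹ • (z.1 - y))).comp y h1
    rw [partialDeriv, h2.fderiv, pd_apply]
    simp
  have hker : ∀ (K : 𝓢(EuclideanSpace ℝ (Fin n), ℝ)) (q : EuclideanSpace ℝ (Fin n) → ℝ),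
      PolyInt q → Integrable fun y => q y * K (z.2⁻¹ • (z.1 - y)) := by
    intro K q hq
    have := integrable_dilKer_mul 0 K hq hz
    simpa [dilKer, mul_comm] using this
  have key := h.integral_eq hφ (hker L f hf)
    (by simp only [hφd]
        refine ((hker (pd i L) f hf).const_mul (-z.2⁻¹)).congr (.of_forall fun y => ?_)
        dsimp only
        ring)
    (hker L g hg)
  have e1 : dilConv e (pd i L) f z = -z.2 ^ (e + 1) * ∫ y, f y * partialDeriv i φ y := by
    rw [dilConv, ← integral_const_mul]
    congr 1
    funext y
    rw [hφd, dilKer, zpow_add_one₀ hz.ne']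
    field_simp
  rw [e1, key, dilConv, neg_mul_neg, ← integral_const_mul]
  congr 1
  funext y
  rw [dilKer]
  ring

/-- If `K` is a sum of derivatives of order `j + r`, then `j` of them can be moved onto `f`,
leaving kernels that are sums of derivatives of order `r` and do not depend on `f`. Here `G α` is
the family of weak derivatives of `f` of order at most `l`. -/
theorem exists_dilConv_eq_sum (l r j : ℕ) (α : Fin n → ℕ) (hα : ∑ i, α i + j = l)
    (K : 𝓢(EuclideanSpace ℝ (Fin n), ℝ)) (hK : IsSumDeriv (j + r) K) :
    ∃ L : (Fin n → ℕ) → 𝓢(EuclideanSpace ℝ (Fin n), ℝ), (∀ β, IsSumDeriv r (L β)) ∧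
      ∀ G : (Fin n → ℕ) → EuclideanSpace ℝ (Fin n) → ℝ,
        (∀ β, ∑ i, β i ≤ l → PolyInt (G β)) →
        (∀ β i, ∑ i, β i < l → HasWeakPartial i (G β) (G (β + Pi.single i 1))) →
        ∀ (e : ℤ) (z : EuclideanSpace ℝ (Fin n) × ℝ), 0 < z.2 →
          dilConv e K (G α) z =
            ∑ β ∈ Finset.piAntidiag (Finset.univ : Finset (Fin n)) l,
              dilConv (e + j) (L β) (G β) z := by
  induction j generalizing α K with
  | zero =>
    classical
    refine ⟨fun β => if β = α then K else 0, fun β => ?_, fun G hG _ e z hz => ?_⟩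
    · dsimp only
      split_ifs
      · simpa using hK
      · exact .zero r
    · rw [Finset.sum_eq_single α]
      · simp
      · intro β _ hβ
        simp [hβ, dilConv, dilKer]
      · intro h
        exact absurd (Finset.mem_piAntidiag.2 ⟨by simpa using hα, fun i _ => Finset.mem_univ i⟩) h
  | succ j ih =>
    rw [show j + 1 + r = (j + r) + 1 by omega] at hK
    obtain ⟨A, hA, rfl⟩ := hK
    have hs : ∀ i, ∑ k, (α + Pi.single i 1 : Fin n → ℕ) k = ∑ k, α k + 1 := fun i => by
      simp [Finset.sum_add_distrib]
    have hi := fun i => ih (α + Pi.single i 1) (by rw [hs]; omega) (A i) (hA i)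
    choose L hL hrep using hi
    refine ⟨fun β => ∑ i, L i β, fun β => .sum _ fun i _ => hL i β, fun G hG hW e z hz => ?_⟩
    have h1 : ∀ i, dilConv e (pd i (A i)) (G α) z = ∑ β ∈ Finset.piAntidiag Finset.univ l,
        dilConv (e + (j + 1 : ℕ)) (L i β) (G β) z := by
      intro i
      rw [dilConv_pd e (A i) (hW α i (by omega)) (hG α (by omega)) (hG _ (by rw [hs]; omega)) hz,
        hrep i G hG hW (e + 1) z hz]
      push_cast
      rw [show e + 1 + (j : ℤ) = e + (j + 1) by ring]
    rw [dilConv_sum _ e _ (hG α (by omega)) hz, Finset.sum_congr rfl fun i _ => h1 i,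
      Finset.sum_comm]
    refine Finset.sum_congr rfl fun β hβ => ?_
    have hβ' : ∑ i, β i = l := (Finset.mem_piAntidiag.1 hβ).1
    rw [dilConv_sum _ _ _ (hG β hβ'.le) hz]

end WeakDerivatives

/-! ### Growth at infinity of functions with finite Besov seminorm -/

section Growth

variable {n : ℕ}

/-- The weight `(1 + ‖x‖)^(-N)` with values in `ℝ≥0∞`. -/
noncomputable def wt (N : ℕ) (x : EuclideanSpace ℝ (Fin n)) : ℝ≥0∞ :=
  ENNReal.ofReal (((1 + ‖x‖) ^ N)⁻¹)

theorem measurable_wt (N : ℕ) : Measurable (wt (n := n) N) := by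
  have : Continuous fun x : EuclideanSpace ℝ (Fin n) => ((1 + ‖x‖) ^ N)⁻¹ :=
    Continuous.inv₀ (by fun_prop) fun x => by positivity
  exact this.measurable.ennreal_ofReal

theorem lintegral_wt_lt_top {N : ℕ} (hN : n < N) :
    ∫⁻ x : EuclideanSpace ℝ (Fin n), wt N x < ⊤ := by
  have h := finite_integral_one_add_norm (E := EuclideanSpace ℝ (Fin n)) (μ := volume) (r := N)
    (by simpa using hN)
  refine lt_of_eq_of_lt (lintegral_congr fun x => ?_) h
  rw [wt, Real.rpow_neg (by positivity), Real.rpow_natCast]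

theorem wt_anti {N M : ℕ} (h : N ≤ M) (x : EuclideanSpace ℝ (Fin n)) : wt M x ≤ wt N x := by
  unfold wt
  gcongr
  linarith [norm_nonneg x]

theorem polyInt_of_lintegral {f : EuclideanSpace ℝ (Fin n) → ℝ}
    (hf : AEStronglyMeasurable f volume) (N : ℕ) (h : ∫⁻ x, wt N x * ‖f x‖ₑ < ⊤) : PolyInt f := by
  refine ⟨N, ?_, ?_⟩
  · have : Continuous fun x : EuclideanSpace ℝ (Fin n) => ((1 + ‖x‖) ^ N)⁻¹ :=
      Continuous.inv₀ (by fun_prop) fun x => by positivity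
    exact this.aestronglyMeasurable.mul hf
  · refine lt_of_eq_of_lt (lintegral_congr fun x => ?_) h
    rw [enorm_mul, wt, Real.enorm_of_nonneg (by positivity)]

theorem PolyInt.lintegral_lt_top {f : EuclideanSpace ℝ (Fin n) → ℝ} (hf : PolyInt f) :
    ∃ N, ∫⁻ x, wt N x * ‖f x‖ₑ < ⊤ := by
  obtain ⟨N, hN⟩ := hf
  refine ⟨N, lt_of_eq_of_lt (lintegral_congr fun x => ?_) hN.2⟩
  rw [enorm_mul, wt, Real.enorm_of_nonneg (r := ((1 + ‖x‖) ^ N)⁻¹) (by positivity)]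

theorem lintegral_comp_smul_euclidean {c : ℝ} (hc : 0 < c)
    (F : EuclideanSpace ℝ (Fin n) → ℝ≥0∞) :
    ENNReal.ofReal (c ^ n) * ∫⁻ x, F (c • x) = ∫⁻ x, F x := by
  have h1 : ∫⁻ x, F (c • x) = ENNReal.ofReal |(c ^ n)⁻¹| * ∫⁻ x, F x := by
    have := Measure.map_addHaar_smul (volume : Measure (EuclideanSpace ℝ (Fin n))) hc.ne'
    rw [finrank_euclideanSpace_fin] at this
    rw [← smul_eq_mul, ← lintegral_smul_measure, ← this]
    exact (lintegral_map_equiv F (Homeomorph.smulOfNeZero c hc.ne').toMeasurableEquiv).symm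
  rw [h1, ← mul_assoc, ← ENNReal.ofReal_mul (by positivity), abs_of_pos (by positivity),
    mul_inv_cancel₀ (by positivity), ENNReal.ofReal_one, one_mul]

theorem setLIntegral_ball_add_le (F : EuclideanSpace ℝ (Fin n) → ℝ≥0∞) (r : ℝ)
    (h : EuclideanSpace ℝ (Fin n)) :
    ∫⁻ x in Metric.ball 0 r, F (x + h) ≤ ∫⁻ x in Metric.ball 0 (r + ‖h‖), F x := by
  rw [← lintegral_indicator measurableSet_ball, ← lintegral_indicator measurableSet_ball,
    ← lintegral_add_right_eq_self ((Metric.ball 0 (r + ‖h‖)).indicator F) h]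
  refine lintegral_mono fun x => ?_
  by_cases hx : x ∈ Metric.ball (0 : EuclideanSpace ℝ (Fin n)) r
  · have hx' : x + h ∈ Metric.ball (0 : EuclideanSpace ℝ (Fin n)) (r + ‖h‖) := by
      rw [mem_ball_zero_iff] at hx ⊢
      linarith [norm_add_le x h]
    rw [Set.indicator_of_mem hx, Set.indicator_of_mem hx']
  · rw [Set.indicator_of_notMem hx]
    exact zero_le

theorem setLIntegral_ball_lt_top {f : EuclideanSpace ℝ (Fin n) → ℝ}
    (hf : LocallyIntegrable f) (r : ℝ) : ∫⁻ x in Metric.ball 0 r, ‖f x‖ₑ < ⊤ :=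
  ((hf.integrableOn_isCompact (isCompact_closedBall 0 r)).mono_set
    Metric.ball_subset_closedBall).2

/-- The integral of `‖f‖` over the unit ball centred at `h`. -/
noncomputable def ballInt (f : EuclideanSpace ℝ (Fin n) → ℝ) (h : EuclideanSpace ℝ (Fin n)) :
    ℝ≥0∞ :=
  ∫⁻ x in Metric.ball 0 1, ‖f (x + h)‖ₑ

theorem measurable_ballInt {f : EuclideanSpace ℝ (Fin n) → ℝ} (hf : Measurable f) :
    Measurable (ballInt f) :=
  Measurable.lintegral_prod_right' (f := fun z : EuclideanSpace ℝ (Fin n) × _ => ‖f (z.2 + z.1)‖ₑ)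
    (hf.comp (measurable_snd.add measurable_fst)).enorm

theorem ballInt_le {f : EuclideanSpace ℝ (Fin n) → ℝ} {h : EuclideanSpace ℝ (Fin n)} {r : ℝ}
    (hr : ‖h‖ ≤ r) : ballInt f h ≤ ∫⁻ x in Metric.ball 0 (1 + r), ‖f x‖ₑ :=
  (setLIntegral_ball_add_le (fun x => ‖f x‖ₑ) 1 h).trans
    (lintegral_mono_set (Metric.ball_subset_ball (by linarith)))

/-- By Tonelli's theorem the hypothesis is a weighted integral over translates of `f` by vectors of
the unit ball, so one of these translates is integrable against the weight, and `f` is too. -/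
theorem polyInt_of_ballInt {f : EuclideanSpace ℝ (Fin n) → ℝ} (hf : Measurable f) (N : ℕ)
    (h : ∫⁻ y, wt N y * ballInt f y < ⊤) : PolyInt f := by
  have hm : Measurable fun z : EuclideanSpace ℝ (Fin n) × EuclideanSpace ℝ (Fin n) =>
      wt N z.1 * ‖f (z.2 + z.1)‖ₑ :=
    ((measurable_wt N).comp measurable_fst).mul
      (hf.comp (measurable_snd.add measurable_fst)).enorm
  have h1 : ∫⁻ y, wt N y * ballInt f y =
      ∫⁻ x in Metric.ball 0 1, ∫⁻ y, wt N y * ‖f (x + y)‖ₑ := by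
    rw [← lintegral_lintegral_swap (f := fun y x => wt N y * ‖f (x + y)‖ₑ) hm.aemeasurable]
    refine lintegral_congr fun y => ?_
    exact (lintegral_const_mul _ (hf.comp (measurable_id.add_const y)).enorm).symm
  rw [h1] at h
  have hm2 : Measurable fun x => ∫⁻ y, wt N y * ‖f (x + y)‖ₑ :=
    Measurable.lintegral_prod_right'
      (f := fun z : EuclideanSpace ℝ (Fin n) × _ => wt N z.2 * ‖f (z.1 + z.2)‖ₑ)
      (((measurable_wt N).comp measurable_snd).mul
        (hf.comp (measurable_fst.add measurable_snd)).enorm)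
  have hae := ae_lt_top hm2 h.ne
  rw [ae_restrict_iff' measurableSet_ball] at hae
  have hpos : 0 < volume (Metric.ball (0 : EuclideanSpace ℝ (Fin n)) 1) :=
    Metric.measure_ball_pos _ _ one_pos
  obtain ⟨x, hx, hxf⟩ : ∃ x ∈ Metric.ball (0 : EuclideanSpace ℝ (Fin n)) 1,
      ∫⁻ y, wt N y * ‖f (x + y)‖ₑ < ⊤ := by
    by_contra! hcon
    have : Metric.ball (0 : EuclideanSpace ℝ (Fin n)) 1 ⊆
        {x | ¬(x ∈ Metric.ball (0 : EuclideanSpace ℝ (Fin n)) 1 →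
          ∫⁻ y, wt N y * ‖f (x + y)‖ₑ < ⊤)} := by
      intro x hx h'
      exact (h' hx).not_ge (hcon x hx)
    exact hpos.ne' (measure_mono_null this hae)
  refine polyInt_of_lintegral hf.aestronglyMeasurable N ?_
  have h2 : ∫⁻ z, wt N (z - x) * ‖f z‖ₑ < ⊤ := by
    rw [← lintegral_add_left_eq_self _ x]
    simpa using hxf
  calc ∫⁻ z, wt N z * ‖f z‖ₑ ≤ ∫⁻ z, ENNReal.ofReal (2 ^ N) * (wt N (z - x) * ‖f z‖ₑ) := by
        refine lintegral_mono fun z => ?_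
        rw [← mul_assoc]
        gcongr
        unfold wt
        rw [← ENNReal.ofReal_mul (by positivity)]
        apply ENNReal.ofReal_le_ofReal
        rw [← div_eq_mul_inv, le_div_iff₀ (by positivity), inv_mul_le_iff₀ (by positivity),
          ← mul_pow]
        gcongr
        rw [mem_ball_zero_iff] at hx
        linarith [norm_sub_le z x, norm_nonneg z]
    _ = ENNReal.ofReal (2 ^ N) * ∫⁻ z, wt N (z - x) * ‖f z‖ₑ :=
        lintegral_const_mul' _ _ ENNReal.ofReal_ne_top
    _ < ⊤ := ENNReal.mul_lt_top ENNReal.ofReal_lt_top h2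

/-- A doubling inequality for the averages over unit balls gives polynomial growth: with a weight
of large enough order, the integral over a ball of radius `2R` is at most a constant plus half the
integral over the ball of radius `R`, and the latter term is absorbed. -/
theorem polyInt_of_doubling {g : EuclideanSpace ℝ (Fin n) → ℝ} (hg : Measurable g)
    (hl : LocallyIntegrable g) (D : EuclideanSpace ℝ (Fin n) → ℝ≥0∞) (N₀ : ℕ)
    (hD : ∫⁻ h, wt N₀ h * D h < ⊤)
    (h : ∀ h, ballInt g ((2 : ℝ) • h) ≤ D h + 2 * ballInt g h) : PolyInt g := by
  obtain ⟨N₁, hN₁⟩ := pow_unbounded_of_one_lt ((2 : ℝ) ^ (n + 2)) (by norm_num : (1 : ℝ) < 3 / 2)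
  set N := max N₀ N₁ with hN
  -- outside the unit ball `1 + 2‖x‖ ≥ (3 / 2) (1 + ‖x‖)`, so doubling gains `(3 / 2)^N`, which
  -- beats the Jacobian `2^n`, the factor `2` of the hypothesis and the `2` needed for absorption
  have hNbig : (2 : ℝ) ^ (n + 2) ≤ (3 / 2) ^ N :=
    hN₁.le.trans (pow_le_pow_right₀ (by norm_num) (le_max_right _ _))
  have h2 : ENNReal.ofReal (2 ^ n) * 2 = ENNReal.ofReal (2 ^ (n + 1)) := by
    rw [pow_succ, ENNReal.ofReal_mul (by positivity), ENNReal.ofReal_ofNat]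
  have hhalf : ∀ r : ℝ, ENNReal.ofReal r / 2 = ENNReal.ofReal (r / 2) := fun r => by
    rw [ENNReal.ofReal_div_of_pos (by norm_num), ENNReal.ofReal_ofNat]
  have hwt : ∀ x : EuclideanSpace ℝ (Fin n), ENNReal.ofReal (2 ^ n) * (wt N ((2 : ℝ) • x) * 2) ≤
      wt N x / 2 + (Metric.ball (0 : EuclideanSpace ℝ (Fin n)) 1).indicator
        (fun _ => ENNReal.ofReal (2 ^ (n + 1))) x := by
    intro x
    have e1 : ENNReal.ofReal (2 ^ n) * (wt N ((2 : ℝ) • x) * 2) =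
        ENNReal.ofReal (2 ^ (n + 1) * ((1 + 2 * ‖x‖) ^ N)⁻¹) := by
      rw [wt, norm_smul, Real.norm_of_nonneg (by norm_num), mul_comm _ (2 : ℝ≥0∞), ← mul_assoc,
        h2, ← ENNReal.ofReal_mul (by positivity)]
    by_cases hx : x ∈ Metric.ball (0 : EuclideanSpace ℝ (Fin n)) 1
    · rw [Set.indicator_of_mem hx, e1]
      refine le_add_left (ENNReal.ofReal_le_ofReal ?_)
      refine mul_le_of_le_one_right (by positivity) (inv_le_one_of_one_le₀ (one_le_pow₀ ?_))
      linarith [norm_nonneg x]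
    · rw [Set.indicator_of_notMem hx, add_zero, e1, wt, hhalf]
      apply ENNReal.ofReal_le_ofReal
      rw [mem_ball_zero_iff, not_lt] at hx
      have h3 : (3 / 2 * (1 + ‖x‖)) ^ N ≤ (1 + 2 * ‖x‖) ^ N := by gcongr; linarith
      rw [mul_pow] at h3
      rw [← div_eq_mul_inv, div_le_div_iff₀ (by positivity) (by norm_num),
        le_inv_mul_iff₀ (by positivity)]
      calc (1 + ‖x‖) ^ N * (2 ^ (n + 1) * 2) = 2 ^ (n + 2) * (1 + ‖x‖) ^ N := by ring
        _ ≤ (3 / 2) ^ N * (1 + ‖x‖) ^ N := by gcongr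
        _ ≤ _ := h3
  have hmA := measurable_ballInt hg
  set Φ : ℝ → ℝ≥0∞ := fun R => ∫⁻ x in Metric.ball 0 R, wt N x * ballInt g x with hΦ
  set C : ℝ≥0∞ := ENNReal.ofReal (2 ^ n) * (∫⁻ x, wt N₀ x * D x) +
    ENNReal.ofReal (2 ^ (n + 1)) * ∫⁻ x in Metric.ball 0 1, ballInt g x with hC
  have hball : ∀ R : ℝ, ∫⁻ x in Metric.ball 0 R, ballInt g x < ⊤ := by
    intro R
    refine (setLIntegral_mono measurable_const (fun x hx => ballInt_le (r := R) ?_)).trans_lt ?_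
    · exact (mem_ball_zero_iff.1 hx).le
    · rw [setLIntegral_const]
      exact ENNReal.mul_lt_top (setLIntegral_ball_lt_top hl _) measure_ball_lt_top
  have hCfin : C < ⊤ := ENNReal.add_lt_top.2
    ⟨ENNReal.mul_lt_top ENNReal.ofReal_lt_top hD,
      ENNReal.mul_lt_top ENNReal.ofReal_lt_top (hball 1)⟩
  have hΦfin : ∀ R, Φ R < ⊤ := fun R => by
    refine (lintegral_mono fun x => ?_).trans_lt (hball R)
    refine mul_le_of_le_one_left zero_le ?_
    rw [wt, ← ENNReal.ofReal_one]
    apply ENNReal.ofReal_le_ofReal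
    exact inv_le_one_of_one_le₀ (one_le_pow₀ (by linarith [norm_nonneg x]))
  have hrec : ∀ R : ℝ, 0 ≤ R → Φ (2 * R) ≤ C + Φ R / 2 := by
    intro R hR
    have e2 : Φ (2 * R) = ENNReal.ofReal (2 ^ n) * ∫⁻ x in Metric.ball 0 R,
        wt N ((2 : ℝ) • x) * ballInt g ((2 : ℝ) • x) := by
      simp only [hΦ]
      rw [← lintegral_indicator measurableSet_ball, ← lintegral_indicator measurableSet_ball,
        ← lintegral_comp_smul_euclidean two_pos]
      congr 1
      refine lintegral_congr fun x => ?_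
      have : (2 : ℝ) • x ∈ Metric.ball (0 : EuclideanSpace ℝ (Fin n)) (2 * R) ↔
          x ∈ Metric.ball (0 : EuclideanSpace ℝ (Fin n)) R := by
        rw [mem_ball_zero_iff, mem_ball_zero_iff, norm_smul, Real.norm_of_nonneg (by norm_num)]
        constructor <;> intro h <;> linarith
      by_cases hx : x ∈ Metric.ball (0 : EuclideanSpace ℝ (Fin n)) R
      · rw [Set.indicator_of_mem hx, Set.indicator_of_mem (this.2 hx)]
      · rw [Set.indicator_of_notMem hx, Set.indicator_of_notMem (mt this.1 hx)]
    rw [e2, ← lintegral_const_mul' _ _ ENNReal.ofReal_ne_top]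
    calc ∫⁻ x in Metric.ball 0 R, ENNReal.ofReal (2 ^ n) *
          (wt N ((2 : ℝ) • x) * ballInt g ((2 : ℝ) • x))
        ≤ ∫⁻ x in Metric.ball 0 R, (ENNReal.ofReal (2 ^ n) * (wt N₀ x * D x) +
            (wt N x / 2 * ballInt g x + (Metric.ball (0 : EuclideanSpace ℝ (Fin n)) 1).indicator
              (fun x => ENNReal.ofReal (2 ^ (n + 1)) * ballInt g x) x)) := by
          refine lintegral_mono fun x => ?_
          have h4 : wt N ((2 : ℝ) • x) ≤ wt N₀ x := by
            refine le_trans ?_ (wt_anti (le_max_left N₀ N₁) x)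
            unfold wt
            apply ENNReal.ofReal_le_ofReal
            gcongr
            rw [norm_smul, Real.norm_of_nonneg (by norm_num)]
            linarith [norm_nonneg x]
          have h5 : (Metric.ball (0 : EuclideanSpace ℝ (Fin n)) 1).indicator
              (fun x => ENNReal.ofReal (2 ^ (n + 1)) * ballInt g x) x =
              (Metric.ball (0 : EuclideanSpace ℝ (Fin n)) 1).indicator
              (fun _ => ENNReal.ofReal (2 ^ (n + 1))) x * ballInt g x := by
            by_cases hx : x ∈ Metric.ball (0 : EuclideanSpace ℝ (Fin n)) 1
            · rw [Set.indicator_of_mem hx, Set.indicator_of_mem hx]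
            · rw [Set.indicator_of_notMem hx, Set.indicator_of_notMem hx, zero_mul]
          calc ENNReal.ofReal (2 ^ n) * (wt N ((2 : ℝ) • x) * ballInt g ((2 : ℝ) • x))
              ≤ ENNReal.ofReal (2 ^ n) * (wt N ((2 : ℝ) • x) * (D x + 2 * ballInt g x)) := by
                gcongr
                exact h x
            _ = ENNReal.ofReal (2 ^ n) * (wt N ((2 : ℝ) • x) * D x) +
                ENNReal.ofReal (2 ^ n) * (wt N ((2 : ℝ) • x) * 2) * ballInt g x := by ring
            _ ≤ ENNReal.ofReal (2 ^ n) * (wt N₀ x * D x) +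
                (wt N x / 2 + (Metric.ball (0 : EuclideanSpace ℝ (Fin n)) 1).indicator
                  (fun _ => ENNReal.ofReal (2 ^ (n + 1))) x) * ballInt g x := by
                gcongr
                exact hwt x
            _ = _ := by rw [add_mul, h5]
      _ = (∫⁻ x in Metric.ball 0 R, ENNReal.ofReal (2 ^ n) * (wt N₀ x * D x)) +
          ((∫⁻ x in Metric.ball 0 R, wt N x / 2 * ballInt g x) +
            ∫⁻ x in Metric.ball 0 R, (Metric.ball (0 : EuclideanSpace ℝ (Fin n)) 1).indicator
              (fun x => ENNReal.ofReal (2 ^ (n + 1)) * ballInt g x) x) := by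
          have hm1 : Measurable fun x => wt N x / 2 * ballInt g x :=
            ((measurable_wt N).div_const 2).mul hmA
          have hm2 : Measurable ((Metric.ball (0 : EuclideanSpace ℝ (Fin n)) 1).indicator
              (fun x => ENNReal.ofReal (2 ^ (n + 1)) * ballInt g x)) :=
            (hmA.const_mul _).indicator measurableSet_ball
          rw [← lintegral_add_left hm1]
          exact lintegral_add_right _ (hm1.add hm2)
      _ ≤ ENNReal.ofReal (2 ^ n) * (∫⁻ x, wt N₀ x * D x) + (Φ R / 2 +
            ENNReal.ofReal (2 ^ (n + 1)) * ∫⁻ x in Metric.ball 0 1, ballInt g x) := by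
          refine add_le_add ?_ (add_le_add (le_of_eq ?_) ?_)
          · rw [lintegral_const_mul' _ _ ENNReal.ofReal_ne_top]
            gcongr
            exact Measure.restrict_le_self
          · simp only [hΦ, div_eq_mul_inv]
            rw [← lintegral_mul_const' _ _ (by simp)]
            refine lintegral_congr fun x => ?_
            ring
          · refine (lintegral_mono' Measure.restrict_le_self le_rfl).trans ?_
            rw [lintegral_indicator measurableSet_ball,
              lintegral_const_mul' _ _ ENNReal.ofReal_ne_top]
      _ = C + Φ R / 2 := by rw [hC]; ring
  have hbound : ∀ R : ℝ, 0 ≤ R → Φ R ≤ 2 * C := by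
    intro R hR
    -- absorption is legitimate because `Φ` is finite
    have hmono : Φ R ≤ Φ (2 * R) :=
      lintegral_mono_set (Metric.ball_subset_ball (by linarith))
    refine hmono.trans ?_
    have h6 : Φ (2 * R) / 2 + Φ (2 * R) / 2 ≤ C + Φ (2 * R) / 2 := by
      rw [ENNReal.add_halves]
      exact (hrec R hR).trans (by gcongr)
    have h7 : Φ (2 * R) / 2 ≤ C :=
      (ENNReal.add_le_add_iff_right (ENNReal.div_lt_top (hΦfin _).ne (by norm_num)).ne).1 h6
    rw [ENNReal.div_le_iff (by norm_num) (by norm_num)] at h7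
    rwa [mul_comm C] at h7
  refine polyInt_of_ballInt hg N ?_
  have h8 : ∫⁻ y, wt N y * ballInt g y = ⨆ k : ℕ, Φ k := by
    simp only [hΦ]
    rw [← setLIntegral_iUnion_of_directed, Metric.iUnion_ball_nat, setLIntegral_univ]
    exact directed_of_isDirected_le fun a b hab =>
      Metric.ball_subset_ball (by exact_mod_cast hab)
  rw [h8]
  exact (iSup_le fun k : ℕ => hbound k k.cast_nonneg).trans_lt
    (ENNReal.mul_lt_top (by norm_num) hCfin)

/-- The integral `∫ ‖Δ_h^d g‖_p^p dh / |h|^q` behind the Besov seminorm. -/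
noncomputable def besovInt (d : ℕ) (q p : ℝ) (g : EuclideanSpace ℝ (Fin n) → ℝ) : ℝ≥0∞ :=
  ∫⁻ h : EuclideanSpace ℝ (Fin n),
    eLpNorm ((fwdDiff h)^[d] g) (ENNReal.ofReal p) volume ^ p / ‖h‖ₑ ^ q

theorem besovSeminormBase_eq (σ p : ℝ) (g : EuclideanSpace ℝ (Fin n) → ℝ) :
    besovSeminormBase σ p g = besovInt (⌊σ⌋₊ + 1) (n + σ * p) p g ^ (1 / p) := rfl

theorem fwdDiff_iter_ae_eq {f g : EuclideanSpace ℝ (Fin n) → ℝ} (h : f =ᵐ[volume] g) (d : ℕ)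
    (v : EuclideanSpace ℝ (Fin n)) :
    ((fwdDiff v)^[d] f : EuclideanSpace ℝ (Fin n) → ℝ) =ᵐ[volume] (fwdDiff v)^[d] g := by
  induction d generalizing f g with
  | zero => exact h
  | succ d ih =>
    rw [Function.iterate_succ_apply, Function.iterate_succ_apply]
    refine ih ?_
    have h1 := (measurePreserving_add_right volume v).quasiMeasurePreserving.ae_eq_comp h
    filter_upwards [h, h1] with x hx hx1
    simp only [Function.comp_apply] at hx1
    rw [fwdDiff, fwdDiff, hx, hx1]

theorem besovInt_congr {f g : EuclideanSpace ℝ (Fin n) → ℝ} (h : f =ᵐ[volume] g) (d : ℕ)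
    (q p : ℝ) : besovInt d q p f = besovInt d q p g :=
  lintegral_congr fun v => by rw [eLpNorm_congr_ae (fwdDiff_iter_ae_eq h d v)]

theorem fwdDiff_two_apply (h : EuclideanSpace ℝ (Fin n)) (g : EuclideanSpace ℝ (Fin n) → ℝ)
    (x : EuclideanSpace ℝ (Fin n)) :
    (fwdDiff h)^[2] g x = g (x + (2 : ℝ) • h) - 2 * g (x + h) + g x := by
  simp only [Function.iterate_succ, Function.iterate_zero, Function.comp_apply, id, fwdDiff]
  rw [two_smul, ← add_assoc]
  ring

theorem eLpNorm_fwdDiff_le {F : EuclideanSpace ℝ (Fin n) → ℝ} (hF : Measurable F) {p : ℝ≥0∞}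
    (hp : 1 ≤ p) (h : EuclideanSpace ℝ (Fin n)) :
    eLpNorm (fwdDiff h F) p volume ≤ 2 * eLpNorm F p volume := by
  have h2 : eLpNorm (F ∘ fun x => x + h) p volume = eLpNorm F p volume :=
    eLpNorm_comp_measurePreserving hF.aestronglyMeasurable (measurePreserving_add_right volume h)
  have h3 : eLpNorm ((F ∘ fun x => x + h) - F) p volume ≤
      eLpNorm (F ∘ fun x => x + h) p volume + eLpNorm F p volume :=
    eLpNorm_sub_le (hF.comp (measurable_id.add_const h)).aestronglyMeasurable
      hF.aestronglyMeasurable hp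
  rw [h2, ← two_mul] at h3
  exact h3

theorem measurable_fwdDiff {g : EuclideanSpace ℝ (Fin n) → ℝ} (hg : Measurable g)
    (h : EuclideanSpace ℝ (Fin n)) : Measurable (fwdDiff h g) :=
  (hg.comp (measurable_id.add_const h)).sub hg

theorem eLpNorm_fwdDiff_two_le {g : EuclideanSpace ℝ (Fin n) → ℝ} (hg : Measurable g) {p : ℝ≥0∞}
    (hp : 1 ≤ p) (h : EuclideanSpace ℝ (Fin n)) :
    eLpNorm ((fwdDiff h)^[2] g) p volume ≤ 2 * eLpNorm ((fwdDiff h)^[1] g) p volume := by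
  rw [Function.iterate_succ_apply', Function.iterate_one]
  exact eLpNorm_fwdDiff_le (measurable_fwdDiff hg h) hp h

/-- A function with finite Besov integral has polynomial growth on average: the identity `g(x + 2v)
= Δ_v² g(x) - g(x) + 2 g(x + v)` is a doubling inequality whose error term is controlled by the
Besov integral, also for `d = 1` since `‖Δ_v² g‖_p ≤ 2 ‖Δ_v g‖_p`. -/
theorem polyInt_of_besovInt {g : EuclideanSpace ℝ (Fin n) → ℝ} (hl : LocallyIntegrable g) {p : ℝ}
    (hp : 1 ≤ p) {q : ℝ} (hq : 0 ≤ q) {d : ℕ} (hd : d = 1 ∨ d = 2) (h : besovInt d q p g < ⊤) :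
    PolyInt g := by
  wlog hg : Measurable g generalizing g
  · have hae := hl.aestronglyMeasurable.ae_eq_mk
    refine PolyInt.congr (this ?_ ?_ hl.aestronglyMeasurable.stronglyMeasurable_mk.measurable)
      hae.symm
    · exact hl.congr hae
    · rwa [← besovInt_congr hae]
  set ω : EuclideanSpace ℝ (Fin n) → ℝ≥0∞ := fun v =>
    eLpNorm ((fwdDiff v)^[d] g) (ENNReal.ofReal p) volume with hω
  have hω2 : ∀ v, eLpNorm ((fwdDiff v)^[2] g) (ENNReal.ofReal p) volume ≤ 2 * ω v := by
    intro v
    rcases hd with rfl | rfl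
    · exact eLpNorm_fwdDiff_two_le hg (by simpa using hp) v
    · exact le_mul_of_one_le_left zero_le (by norm_num)
  set B : Set (EuclideanSpace ℝ (Fin n)) := Metric.ball 0 1 with hB
  set c : ℝ≥0∞ := volume B ^ (1 - 1 / p) with hc
  have hcfin : c ≠ ⊤ := ENNReal.rpow_ne_top_of_nonneg
    (by rw [sub_nonneg, div_le_one (by linarith)]; exact hp) measure_ball_lt_top.ne
  have hm2 : ∀ v, Measurable ((fwdDiff v)^[2] g) := by
    intro v
    have : ((fwdDiff v)^[2] g) = fun x => g (x + (2 : ℝ) • v) - 2 * g (x + v) + g x :=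
      funext (fwdDiff_two_apply v g)
    rw [this]
    exact ((hg.comp (measurable_id.add_const _)).sub
      ((hg.comp (measurable_id.add_const _)).const_mul 2)).add hg
  have hdiff : ∀ v, ∫⁻ x in B, ‖(fwdDiff v)^[2] g x‖ₑ ≤ 2 * c * (1 + ω v ^ p) := by
    intro v
    have h1 := eLpNorm_le_eLpNorm_mul_rpow_measure_univ (μ := volume.restrict B) (p := 1)
      (q := ENNReal.ofReal p) (by simpa using hp) (hm2 v).aestronglyMeasurable
    rw [eLpNorm_one_eq_lintegral_enorm, ENNReal.toReal_ofReal (by linarith), ENNReal.toReal_one,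
      Measure.restrict_apply_univ, div_one] at h1
    have h2 : ω v ≤ 1 + ω v ^ p := by
      rcases le_total (ω v) 1 with h | h
      · exact h.trans le_self_add
      · exact (ENNReal.le_rpow_self_of_one_le h hp).trans le_add_self
    calc _ ≤ eLpNorm ((fwdDiff v)^[2] g) (ENNReal.ofReal p) (volume.restrict B) * c := h1
      _ ≤ 2 * ω v * c := by
          gcongr
          exact (eLpNorm_mono_measure _ Measure.restrict_le_self).trans (hω2 v)
      _ ≤ 2 * (1 + ω v ^ p) * c := by gcongr
      _ = _ := by ring
  obtain ⟨N₁, hN₁⟩ := exists_nat_ge q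
  set N := max N₁ (n + 1) with hN
  have hwtq : ∀ v : EuclideanSpace ℝ (Fin n), wt N v ≤ (‖v‖ₑ ^ q)⁻¹ := by
    intro v
    have e1 : ‖v‖ₑ ≤ ENNReal.ofReal (1 + ‖v‖) := by
      rw [← ofReal_norm]
      exact ENNReal.ofReal_le_ofReal (by linarith)
    have hone : 1 ≤ ENNReal.ofReal (1 + ‖v‖) := by
      rw [ENNReal.one_le_ofReal]; linarith [norm_nonneg v]
    unfold wt
    rw [ENNReal.ofReal_inv_of_pos (by positivity), ENNReal.inv_le_inv,
      ENNReal.ofReal_pow (by positivity), ← ENNReal.rpow_natCast]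
    calc ‖v‖ₑ ^ q ≤ ENNReal.ofReal (1 + ‖v‖) ^ q := ENNReal.rpow_le_rpow e1 hq
      _ ≤ _ := ENNReal.rpow_le_rpow_of_exponent_le hone
        (hN₁.trans (by exact_mod_cast le_max_left _ _))
  refine polyInt_of_doubling hg hl
    (fun v => 2 * c * (1 + ω v ^ p) + ballInt g 0) N ?_ fun v => ?_
  · have hfin : ∫⁻ v, wt N v * ω v ^ p < ⊤ := by
      refine (lintegral_mono fun v => ?_).trans_lt h
      rw [div_eq_mul_inv, mul_comm]
      gcongr
      exact hwtq v
    have hA0 : ballInt g 0 < ⊤ :=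
      (ballInt_le (r := 0) (by simp)).trans_lt (setLIntegral_ball_lt_top hl _)
    have hW := lintegral_wt_lt_top (n := n) (N := N) (by omega)
    have e2 : ∀ v, wt N v * (2 * c * (1 + ω v ^ p) + ballInt g 0) =
        (2 * c + ballInt g 0) * wt N v + 2 * c * (wt N v * ω v ^ p) := fun v => by ring
    simp only [e2]
    rw [lintegral_add_left ((measurable_wt N).const_mul _), lintegral_const_mul _ (measurable_wt N),
      lintegral_const_mul' _ _ (ENNReal.mul_ne_top (by norm_num) hcfin)]
    exact ENNReal.add_lt_top.2 ⟨ENNReal.mul_lt_top (ENNReal.add_lt_top.2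
      ⟨(ENNReal.mul_ne_top (by norm_num) hcfin).lt_top, hA0⟩) hW,
      ENNReal.mul_lt_top (ENNReal.mul_ne_top (by norm_num) hcfin).lt_top hfin⟩
  · have h3 : ∀ x, ‖g (x + (2 : ℝ) • v)‖ₑ ≤
        ‖(fwdDiff v)^[2] g x‖ₑ + (‖g (x + 0)‖ₑ + 2 * ‖g (x + v)‖ₑ) := by
      intro x
      have : g (x + (2 : ℝ) • v) = (fwdDiff v)^[2] g x + (-g (x + 0) + 2 * g (x + v)) := by
        rw [fwdDiff_two_apply, add_zero]; ring
      rw [this]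
      refine (enorm_add_le _ _).trans (add_le_add le_rfl ((enorm_add_le _ _).trans ?_))
      rw [enorm_neg, enorm_mul]
      simp [← ofReal_norm]
    have hmt : ∀ w : EuclideanSpace ℝ (Fin n), Measurable fun x => ‖g (x + w)‖ₑ := fun w =>
      (hg.comp (measurable_id.add_const w)).enorm
    calc ballInt g ((2 : ℝ) • v) ≤ ∫⁻ x in B, (‖(fwdDiff v)^[2] g x‖ₑ +
          (‖g (x + 0)‖ₑ + 2 * ‖g (x + v)‖ₑ)) := lintegral_mono h3
      _ = (∫⁻ x in B, ‖(fwdDiff v)^[2] g x‖ₑ) + (ballInt g 0 + 2 * ballInt g v) := by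
          rw [lintegral_add_left (hm2 v).enorm, lintegral_add_left (hmt 0),
            lintegral_const_mul _ (hmt v)]
          rfl
      _ ≤ 2 * c * (1 + ω v ^ p) + (ballInt g 0 + 2 * ballInt g v) := by
          gcongr
          exact hdiff v
      _ = _ := by ring

end Growth

/-! ### Growth at infinity of functions whose weak gradient has polynomial growth -/

section GradientGrowth

variable {n : ℕ}

theorem HasWeakPartial.congr {i : Fin n} {f f' g g' : EuclideanSpace ℝ (Fin n) → ℝ}
    (h : HasWeakPartial i f g) (hf : f =ᵐ[volume] f') (hg : g =ᵐ[volume] g') :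
    HasWeakPartial i f' g' := by
  refine ⟨h.1.congr hf, h.2.1.congr hg, fun φ hφ hc => ?_⟩
  have e1 : ∫ x, f' x * partialDeriv i φ x = ∫ x, f x * partialDeriv i φ x :=
    integral_congr_ae (by filter_upwards [hf] with x hx; rw [hx])
  have e2 : ∫ x, g' x * φ x = ∫ x, g x * φ x :=
    integral_congr_ae (by filter_upwards [hg] with x hx; rw [hx])
  rw [e1, e2]
  exact h.2.2 φ hφ hc

/-- The derivative of `τ ↦ ∫ f(x) φ(x - τ y) dx` for a test function `φ`. -/
theorem hasDerivAt_integral_translate {f φ : EuclideanSpace ℝ (Fin n) → ℝ}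
    (hf : LocallyIntegrable f) (hφ : ContDiff ℝ (⊤ : ℕ∞) φ) (hc : HasCompactSupport φ)
    (y : EuclideanSpace ℝ (Fin n)) (τ : ℝ) :
    HasDerivAt (fun τ : ℝ => ∫ x, f x * φ (x - τ • y))
      (-∫ x, f x * fderiv ℝ φ (x - τ • y) y) τ := by
  set ψ : EuclideanSpace ℝ (Fin n) → ℝ := fun x => φ (-x) with hψ
  have hψs : ContDiff ℝ 1 ψ := (hφ.comp contDiff_neg).of_le (by norm_cast)
  have hψc : HasCompactSupport ψ := hc.comp_homeomorph (Homeomorph.neg _)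
  have hd := hψc.hasFDerivAt_convolution_right (ContinuousLinearMap.mul ℝ ℝ) hf hψs (τ • y)
  have h1 := hd.comp_hasDerivAt τ ((hasDerivAt_id τ).smul_const y)
  have hψd : ∀ x, fderiv ℝ ψ x y = -fderiv ℝ φ (-x) y := by
    intro x
    have h2 : HasFDerivAt ψ _ x :=
      ((hφ.differentiable (by simp)) (-x)).hasFDerivAt.comp x (hasFDerivAt_id x).neg
    rw [h2.fderiv]
    simp
  simp only [id, one_smul] at h1
  rw [convolution_precompR_apply _ hf (hψc.fderiv ℝ) (hψs.continuous_fderiv one_ne_zero)] at h1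
  have e1 : (fun τ : ℝ => ∫ x, f x * φ (x - τ • y)) =
      convolution f ψ (ContinuousLinearMap.mul ℝ ℝ) volume ∘ fun τ : ℝ => τ • y := by
    funext τ
    simp [convolution, hψ]
  have e2 : -∫ x, f x * fderiv ℝ φ (x - τ • y) y =
      convolution f (fun a => fderiv ℝ ψ a y) (ContinuousLinearMap.mul ℝ ℝ) volume (τ • y) := by
    simp only [convolution, hψd, ContinuousLinearMap.mul_apply', neg_sub, mul_neg, integral_neg]
  rw [e1, e2]
  exact h1

/-- The directional derivative `y · g` at `x + τ y`. -/
noncomputable def segDeriv (g : Fin n → EuclideanSpace ℝ (Fin n) → ℝ)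
    (y x : EuclideanSpace ℝ (Fin n)) (τ : ℝ) : ℝ :=
  ∑ i, y i * g i (x + τ • y)

theorem measurable_segDeriv {g : Fin n → EuclideanSpace ℝ (Fin n) → ℝ}
    (hg : ∀ i, Measurable (g i)) (y : EuclideanSpace ℝ (Fin n)) :
    Measurable fun z : EuclideanSpace ℝ (Fin n) × ℝ => segDeriv g y z.1 z.2 := by
  refine Finset.measurable_fun_sum _ fun i _ => ((hg i).comp ?_).const_mul _
  fun_prop

theorem lintegral_segDeriv_le {g : Fin n → EuclideanSpace ℝ (Fin n) → ℝ}
    (hg : ∀ i, Measurable (g i)) (y : EuclideanSpace ℝ (Fin n)) (r : ℝ) :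
    ∫⁻ x in Metric.ball 0 r, ∫⁻ τ in Set.Ioc (0 : ℝ) 1, ‖segDeriv g y x τ‖ₑ ≤
      ‖y‖ₑ * ∑ i, ∫⁻ x in Metric.ball 0 (r + ‖y‖), ‖g i x‖ₑ := by
  rw [lintegral_lintegral_swap (measurable_segDeriv hg y).enorm.aemeasurable]
  have h1 : ∀ τ ∈ Set.Ioc (0 : ℝ) 1, ∫⁻ x in Metric.ball 0 r, ‖segDeriv g y x τ‖ₑ ≤
      ‖y‖ₑ * ∑ i, ∫⁻ x in Metric.ball 0 (r + ‖y‖), ‖g i x‖ₑ := by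
    intro τ hτ
    have hm : ∀ i, Measurable fun x => ‖g i (x + τ • y)‖ₑ := fun i =>
      ((hg i).comp (measurable_id.add_const _)).enorm
    calc ∫⁻ x in Metric.ball 0 r, ‖segDeriv g y x τ‖ₑ
        ≤ ∫⁻ x in Metric.ball 0 r, ‖y‖ₑ * ∑ i, ‖g i (x + τ • y)‖ₑ := by
          refine lintegral_mono fun x => ?_
          unfold segDeriv
          refine (enorm_sum_le _ _).trans ?_
          rw [Finset.mul_sum]
          refine Finset.sum_le_sum fun i _ => ?_
          rw [enorm_mul]
          gcongr
          rw [← ofReal_norm, ← ofReal_norm]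
          exact ENNReal.ofReal_le_ofReal (PiLp.norm_apply_le y i)
      _ = ‖y‖ₑ * ∑ i, ∫⁻ x in Metric.ball 0 r, ‖g i (x + τ • y)‖ₑ := by
          rw [lintegral_const_mul' _ _ (by simp), lintegral_finsetSum _ fun i _ => hm i]
      _ ≤ _ := by
          refine mul_le_mul' le_rfl (Finset.sum_le_sum fun i _ => ?_)
          refine (setLIntegral_ball_add_le (fun x => ‖g i x‖ₑ) r (τ • y)).trans
            (lintegral_mono_set (Metric.ball_subset_ball ?_))
          rw [norm_smul, Real.norm_of_nonneg hτ.1.le]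
          have := mul_le_of_le_one_left (norm_nonneg y) hτ.2
          linarith
  refine (setLIntegral_mono measurable_const h1).trans ?_
  rw [setLIntegral_const]
  simp

/-- Differences of `f` are integrals of its weak gradient along segments. -/
theorem ae_sub_eq_integral_segDeriv {f : EuclideanSpace ℝ (Fin n) → ℝ}
    {g : Fin n → EuclideanSpace ℝ (Fin n) → ℝ} (hf : LocallyIntegrable f)
    (hg : ∀ i, Measurable (g i)) (h : ∀ i, HasWeakPartial i f (g i))
    (y : EuclideanSpace ℝ (Fin n)) :
    ∀ᵐ x, f (x + y) - f x = ∫ τ in Set.Ioc (0 : ℝ) 1, segDeriv g y x τ := by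
  set ν : Measure ℝ := volume.restrict (Set.Ioc (0 : ℝ) 1) with hν
  have hmeas := measurable_segDeriv hg y
  have hI : ∀ r, Integrable (fun z : EuclideanSpace ℝ (Fin n) × ℝ => segDeriv g y z.1 z.2)
      ((volume.restrict (Metric.ball 0 r)).prod ν) := by
    intro r
    refine ⟨hmeas.aestronglyMeasurable, ?_⟩
    rw [hasFiniteIntegral_iff_enorm, lintegral_prod _ hmeas.enorm.aemeasurable]
    refine (lintegral_segDeriv_le hg y r).trans_lt (ENNReal.mul_lt_top (by simp) ?_)
    exact ENNReal.sum_lt_top.2 fun i _ => setLIntegral_ball_lt_top (h i).2.1 _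
  have hshift : LocallyIntegrable fun x => f (x + y) := by
    rw [locallyIntegrable_iff]
    intro k hk
    have hk' : IsCompact ((fun x => x + y) '' k) := hk.image (by fun_prop)
    have h1 := hf.integrableOn_isCompact hk'
    have h2 := (measurePreserving_add_right volume y).integrableOn_image
      (MeasurableEquiv.addRight y).measurableEmbedding (f := f) (s := k)
    exact h2.1 h1
  have hu : LocallyIntegrable fun x => ∫ τ, segDeriv g y x τ ∂ν := by
    rw [locallyIntegrable_iff]
    intro k hk
    obtain ⟨r, hr⟩ := hk.isBounded.subset_ball 0
    have h1 : IntegrableOn (fun x => ∫ τ, segDeriv g y x τ ∂ν) (Metric.ball 0 r) :=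
      (hI r).integral_prod_left
    exact h1.mono_set hr
  refine ae_eq_of_integral_contDiff_smul_eq (hshift.sub hf) hu fun φ hφ hc => ?_
  simp only [smul_eq_mul]
  have hc1 : ∀ v : EuclideanSpace ℝ (Fin n), HasCompactSupport fun x => φ (x - v) := fun v =>
    hc.comp_homeomorph (Homeomorph.subRight v)
  have hφ1 : ∀ v : EuclideanSpace ℝ (Fin n), ContDiff ℝ (⊤ : ℕ∞) fun x => φ (x - v) := fun v =>
    hφ.comp (contDiff_id.sub contDiff_const)
  have hint : ∀ {q : EuclideanSpace ℝ (Fin n) → ℝ}, LocallyIntegrable q → ∀ v,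
      Integrable fun x => q x * φ (x - v) := fun hq v =>
    hq.integrable_smul_right_of_hasCompactSupport (hφ1 v).continuous (hc1 v)
  -- Both sides are the increment over `[0, 1]` of `τ ↦ ∫ f(x) φ(x - τ y) dx`.
  set c : ℝ → ℝ := fun τ => ∫ x, f x * φ (x - τ • y) with hcdef
  have hL : ∫ x, φ x * (f (x + y) - f x) = c 1 - c 0 := by
    have e1 : c 1 = ∫ x, f (x + y) * φ x := by
      simp only [hcdef, one_smul]
      rw [← integral_add_right_eq_self _ y]
      simp
    rw [e1, hcdef]
    simp only [zero_smul, sub_zero]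
    have i1 : Integrable fun x => f (x + y) * φ x := by
      simpa using hint hshift 0
    have i2 : Integrable fun x => f x * φ x := by simpa using hint hf 0
    rw [← integral_sub i1 i2]
    congr 1
    funext x
    ring
  have hprod : Integrable (fun z : EuclideanSpace ℝ (Fin n) × ℝ => φ z.1 * segDeriv g y z.1 z.2)
      (volume.prod ν) := by
    obtain ⟨r, hr⟩ := hc.isCompact.isBounded.subset_ball 0
    obtain ⟨b, hb⟩ := hc.exists_bound_of_continuous hφ.continuous
    have h1 := (hI r).bdd_mul (c := b) (f := fun z => φ z.1)
      (hφ.continuous.comp continuous_fst).aestronglyMeasurable (.of_forall fun z => hb z.1)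
    have h2 : (volume.restrict (Metric.ball (0 : EuclideanSpace ℝ (Fin n)) r)).prod ν =
        (volume.prod ν).restrict (Metric.ball 0 r ×ˢ Set.univ) := by
      rw [← Measure.prod_restrict, Measure.restrict_univ]
    rw [h2] at h1
    refine (integrableOn_iff_integrable_of_support_subset ?_).1 h1
    intro z hz
    refine ⟨hr (subset_tsupport _ ?_), Set.mem_univ _⟩
    exact left_ne_zero_of_mul hz
  have hτ : ∀ τ : ℝ, ∫ x, φ x * segDeriv g y x τ = -∫ x, f x * fderiv ℝ φ (x - τ • y) y := by
    intro τ
    have e2 : ∫ x, φ x * segDeriv g y x τ = ∫ x, ∑ i, y i * (g i x * φ (x - τ • y)) := by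
      rw [← integral_add_right_eq_self (fun x => ∑ i, y i * (g i x * φ (x - τ • y))) (τ • y)]
      congr 1
      funext x
      simp only [segDeriv, add_sub_cancel_right, Finset.mul_sum]
      exact Finset.sum_congr rfl fun i _ => by ring
    have hpd : ∀ i x, partialDeriv i (fun x => φ (x - τ • y)) x =
        fderiv ℝ φ (x - τ • y) (EuclideanSpace.single i 1) := by
      intro i x
      unfold partialDeriv
      rw [fderiv_comp_sub]
    have i3 : ∀ i, Integrable fun x => f x * partialDeriv i (fun x => φ (x - τ • y)) x := fun i =>
      hf.integrable_smul_right_of_hasCompactSupport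
        (contDiff_partialDeriv (hφ1 _) i).continuous (hasCompactSupport_partialDeriv (hc1 _) i)
    rw [e2, integral_finsetSum _ fun i _ => (hint (h i).2.1 _).const_mul _]
    have e3 : ∀ i, ∫ x, y i * (g i x * φ (x - τ • y)) =
        -∫ x, y i * (f x * partialDeriv i (fun x => φ (x - τ • y)) x) := by
      intro i
      rw [integral_const_mul, integral_const_mul, (h i).2.2 _ (hφ1 _) (hc1 _)]
      ring
    rw [Finset.sum_congr rfl fun i _ => e3 i, Finset.sum_neg_distrib,
      ← integral_finsetSum _ fun i _ => (i3 i).const_mul _]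
    congr 2
    funext x
    rw [clm_apply_eq_sum _ y, Finset.mul_sum]
    refine Finset.sum_congr rfl fun i _ => ?_
    rw [hpd]
    ring
  have hR : ∫ x, φ x * ∫ τ, segDeriv g y x τ ∂ν = c 1 - c 0 := by
    simp only [← integral_const_mul]
    rw [integral_integral_swap hprod]
    have hii : IntervalIntegrable (fun τ => -∫ x, f x * fderiv ℝ φ (x - τ • y) y) volume 0 1 := by
      rw [intervalIntegrable_iff_integrableOn_Ioc_of_le zero_le_one]
      have := hprod.integral_prod_right
      simp only [hτ] at this
      exact this
    have := intervalIntegral.integral_eq_sub_of_hasDerivAt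
      (fun τ _ => hasDerivAt_integral_translate hf hφ hc y τ) hii
    rw [intervalIntegral.integral_of_le zero_le_one] at this
    simp only [hτ]
    exact this
  rw [hR]
  exact hL

/-- Polynomial growth on average passes from the weak gradient to the function: the integral of `f`
over the unit ball at `y` differs from the one at `0` by at most `‖y‖` times the integral of the
gradient over a ball of radius `1 + ‖y‖`. -/
theorem polyInt_of_hasWeakPartial {f : EuclideanSpace ℝ (Fin n) → ℝ}
    {g : Fin n → EuclideanSpace ℝ (Fin n) → ℝ} (hf : LocallyIntegrable f)
    (h : ∀ i, HasWeakPartial i f (g i)) (hg : ∀ i, PolyInt (g i)) : PolyInt f := by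
  wlog hfm : Measurable f generalizing f
  · have hae := hf.aestronglyMeasurable.ae_eq_mk
    exact (this (hf.congr hae) (fun i => (h i).congr hae (ae_eq_refl _))
      hf.aestronglyMeasurable.stronglyMeasurable_mk.measurable).congr hae.symm
  wlog hgm : ∀ i, Measurable (g i) generalizing g
  · have hae := fun i => (hg i).aestronglyMeasurable.ae_eq_mk
    exact this (g := fun i => (hg i).aestronglyMeasurable.mk (g i))
      (fun i => (hg i).congr (hae i)) (fun i => (h i).congr (ae_eq_refl _) (hae i))
      (fun i => (hg i).aestronglyMeasurable.stronglyMeasurable_mk.measurable)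
  choose N₁ hN₁ using fun i => (hg i).lintegral_lt_top
  set N := Finset.univ.sup N₁ with hN
  set S : ℝ≥0∞ := ∑ i, ∫⁻ x, wt N x * ‖g i x‖ₑ with hS
  have hSfin : S < ⊤ := ENNReal.sum_lt_top.2 fun i _ =>
    (lintegral_mono fun x => mul_le_mul_left (wt_anti (Finset.le_sup (Finset.mem_univ i)) x)
      _).trans_lt (hN₁ i)
  have hA0 : ballInt f 0 < ⊤ :=
    (ballInt_le (r := 0) (by simp)).trans_lt (setLIntegral_ball_lt_top hf _)
  have hball : ∀ y, ballInt f y ≤ ‖y‖ₑ * (ENNReal.ofReal ((2 + ‖y‖) ^ N) * S) + ballInt f 0 := by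
    intro y
    have h1 : ∀ x, ‖f (x + y)‖ₑ ≤ ‖f (x + y) - f x‖ₑ + ‖f (x + 0)‖ₑ := by
      intro x
      have := enorm_add_le (f (x + y) - f x) (f x)
      simpa using this
    have h2 : ∫⁻ x in Metric.ball 0 1, ‖f (x + y) - f x‖ₑ ≤
        ‖y‖ₑ * ∑ i, ∫⁻ x in Metric.ball 0 (1 + ‖y‖), ‖g i x‖ₑ := by
      refine le_trans ?_ (lintegral_segDeriv_le hgm y 1)
      refine lintegral_mono_ae (ae_restrict_of_ae ?_)
      filter_upwards [ae_sub_eq_integral_segDeriv hf hgm h y] with x hx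
      rw [hx]
      exact enorm_integral_le_lintegral_enorm _
    have h3 : ∀ i, ∫⁻ x in Metric.ball 0 (1 + ‖y‖), ‖g i x‖ₑ ≤
        ENNReal.ofReal ((2 + ‖y‖) ^ N) * ∫⁻ x, wt N x * ‖g i x‖ₑ := by
      intro i
      rw [← lintegral_const_mul' _ _ ENNReal.ofReal_ne_top]
      refine le_trans (setLIntegral_mono' measurableSet_ball fun x hx => ?_)
        (setLIntegral_le_lintegral _ _)
      rw [← mul_assoc, wt, ← ENNReal.ofReal_mul (by positivity)]
      refine le_mul_of_one_le_left zero_le ?_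
      rw [ENNReal.one_le_ofReal, ← div_eq_mul_inv, one_le_div (by positivity)]
      rw [mem_ball_zero_iff] at hx
      exact pow_le_pow_left₀ (by positivity) (by linarith) N
    calc ballInt f y ≤ ∫⁻ x in Metric.ball 0 1, (‖f (x + y) - f x‖ₑ + ‖f (x + 0)‖ₑ) :=
          lintegral_mono h1
      _ = (∫⁻ x in Metric.ball 0 1, ‖f (x + y) - f x‖ₑ) + ballInt f 0 :=
          lintegral_add_left ((hfm.comp (measurable_id.add_const y)).sub hfm).enorm _
      _ ≤ _ := by
          gcongr
          refine h2.trans ?_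
          rw [hS, Finset.mul_sum (a := ENNReal.ofReal ((2 + ‖y‖) ^ N))]
          exact mul_le_mul' le_rfl (Finset.sum_le_sum fun i _ => h3 i)
  refine polyInt_of_ballInt hfm (N + n + 2) ?_
  have h4 : ∀ y : EuclideanSpace ℝ (Fin n), wt (N + n + 2) y * ballInt f y ≤
      (ENNReal.ofReal (2 ^ N) * S + ballInt f 0) * wt (n + 1) y := by
    intro y
    have h5 : wt (N + n + 2) y * (‖y‖ₑ * ENNReal.ofReal ((2 + ‖y‖) ^ N)) ≤
        ENNReal.ofReal (2 ^ N) * wt (n + 1) y := by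
      rw [wt, wt, ← ofReal_norm, ← ENNReal.ofReal_mul (by positivity),
        ← ENNReal.ofReal_mul (by positivity), ← ENNReal.ofReal_mul (by positivity)]
      apply ENNReal.ofReal_le_ofReal
      have hy := norm_nonneg y
      rw [inv_mul_le_iff₀ (by positivity)]
      have h6 : (2 + ‖y‖) ^ N ≤ (2 * (1 + ‖y‖)) ^ N := by gcongr; linarith
      have h7 : (1 + ‖y‖) ^ (N + n + 2) * (2 ^ N * ((1 + ‖y‖) ^ (n + 1))⁻¹) =
          (1 + ‖y‖) * (2 * (1 + ‖y‖)) ^ N := by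
        rw [mul_pow, show N + n + 2 = N + 1 + (n + 1) by ring, pow_add]
        field_simp
        ring
      rw [h7]
      gcongr
      linarith
    calc wt (N + n + 2) y * ballInt f y
        ≤ wt (N + n + 2) y * (‖y‖ₑ * (ENNReal.ofReal ((2 + ‖y‖) ^ N) * S) + ballInt f 0) := by
          gcongr
          exact hball y
      _ = wt (N + n + 2) y * (‖y‖ₑ * ENNReal.ofReal ((2 + ‖y‖) ^ N)) * S +
          ballInt f 0 * wt (N + n + 2) y := by ring
      _ ≤ ENNReal.ofReal (2 ^ N) * wt (n + 1) y * S + ballInt f 0 * wt (n + 1) y := by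
          gcongr
          exact wt_anti (by omega) y
      _ = _ := by ring
  refine (lintegral_mono h4).trans_lt ?_
  rw [lintegral_const_mul _ (measurable_wt _)]
  exact ENNReal.mul_lt_top (ENNReal.add_lt_top.2
    ⟨ENNReal.mul_lt_top ENNReal.ofReal_lt_top hSfin, hA0⟩) (lintegral_wt_lt_top (by omega))

end GradientGrowth

/-! ### Weighted estimates for averages of differences -/

section WeightedAverages

variable {n : ℕ}

/-- Hölder's inequality (or Jensen's) for the measure with density `w`. -/
theorem lintegral_mul_rpow_le {α : Type*} [MeasurableSpace α] {μ : Measure α} {w f : α → ℝ≥0∞}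
    (hw : Measurable w) (hf : Measurable f) {p : ℝ} (hp : 1 ≤ p) :
    (∫⁻ x, w x * f x ∂μ) ^ p ≤ (∫⁻ x, w x ∂μ) ^ (p - 1) * ∫⁻ x, w x * f x ^ p ∂μ := by
  have hp0 : 0 < p := by linarith
  rcases hp.eq_or_lt with rfl | hp1
  · simp
  have hpq := Real.HolderConjugate.conjExponent hp1
  have h := ENNReal.lintegral_mul_le_Lp_mul_Lq (μ.withDensity w) hpq hf.aemeasurable
    (aemeasurable_const (b := (1 : ℝ≥0∞)))
  simp only [Pi.mul_apply, mul_one, ENNReal.one_rpow] at h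
  rw [lintegral_withDensity_eq_lintegral_mul _ hw hf,
    lintegral_withDensity_eq_lintegral_mul _ hw (hf.pow_const p),
    lintegral_withDensity_eq_lintegral_mul _ hw measurable_const] at h
  simp only [Pi.mul_apply, mul_one] at h
  calc (∫⁻ x, w x * f x ∂μ) ^ p
      ≤ ((∫⁻ x, w x * f x ^ p ∂μ) ^ (1 / p) * (∫⁻ x, w x ∂μ) ^ (1 / p.conjExponent)) ^ p := by
        gcongr
    _ = _ := by
        rw [ENNReal.mul_rpow_of_nonneg _ _ hp0.le, ← ENNReal.rpow_mul, ← ENNReal.rpow_mul,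
          one_div_mul_cancel hp0.ne', ENNReal.rpow_one, mul_comm]
        congr 2
        rw [Real.conjExponent]
        field_simp

/-- The weight is at most `(t / ρ)^N` for `t ≤ ρ`, where `N > q` gives convergence at `0`, and at
most `1` for `t > ρ`, where `q > 0` gives convergence at infinity. -/
theorem lintegral_Ioi_rpow_mul_wt_le {q : ℝ} (hq : 0 < q) {N : ℕ} (hN : q < N) {ρ : ℝ}
    (hρ : 0 < ρ) :
    ∫⁻ t in Set.Ioi (0 : ℝ), ENNReal.ofReal (t ^ (-q - 1)) *
      ENNReal.ofReal (((1 + t⁻¹ * ρ) ^ N)⁻¹) ≤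
        ENNReal.ofReal (1 / (N - q) + 1 / q) * (ENNReal.ofReal ρ ^ q)⁻¹ := by
  have hNq : 0 < (N : ℝ) - q := by linarith
  have h1 : ∫⁻ t in Set.Ioc 0 ρ, ENNReal.ofReal (t ^ (-q - 1)) *
      ENNReal.ofReal (((1 + t⁻¹ * ρ) ^ N)⁻¹) ≤ ENNReal.ofReal (ρ ^ (-q) / (N - q)) := by
    have hii : IntegrableOn (fun t : ℝ => t ^ ((N : ℝ) - q - 1) * ρ ^ (-(N : ℝ)))
        (Set.Ioc 0 ρ) := by
      rw [← intervalIntegrable_iff_integrableOn_Ioc_of_le hρ.le]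
      exact (intervalIntegral.intervalIntegrable_rpow' (by linarith)).mul_const _
    have hval : ∫ t in Set.Ioc 0 ρ, t ^ ((N : ℝ) - q - 1) * ρ ^ (-(N : ℝ)) =
        ρ ^ (-q) / (N - q) := by
      rw [← intervalIntegral.integral_of_le hρ.le, intervalIntegral.integral_mul_const,
        integral_rpow (Or.inl (by linarith))]
      rw [show (N : ℝ) - q - 1 + 1 = N - q by ring, Real.zero_rpow hNq.ne', sub_zero,
        div_mul_eq_mul_div, ← Real.rpow_add hρ]
      congr 2
      ring
    rw [← hval, ofReal_integral_eq_lintegral_ofReal hii]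
    · refine setLIntegral_mono' measurableSet_Ioc fun t ht => ?_
      have ht0 : 0 < t := ht.1
      rw [← ENNReal.ofReal_mul (by positivity)]
      apply ENNReal.ofReal_le_ofReal
      have e1 : t ^ ((N : ℝ) - q - 1) * ρ ^ (-(N : ℝ)) =
          t ^ (-q - 1) * ((t⁻¹ * ρ) ^ N)⁻¹ := by
        rw [show (N : ℝ) - q - 1 = (-q - 1) + N by ring, Real.rpow_add ht0, Real.rpow_natCast,
          Real.rpow_neg hρ.le, Real.rpow_natCast, mul_pow, mul_inv, inv_pow, inv_inv]
        ring
      rw [e1]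
      gcongr
      linarith
    · filter_upwards [ae_restrict_mem measurableSet_Ioc] with t ht
      have ht0 : 0 < t := ht.1
      positivity
  have h2 : ∫⁻ t in Set.Ioi ρ, ENNReal.ofReal (t ^ (-q - 1)) *
      ENNReal.ofReal (((1 + t⁻¹ * ρ) ^ N)⁻¹) ≤ ENNReal.ofReal (ρ ^ (-q) / q) := by
    have hval : ∫ t in Set.Ioi ρ, t ^ (-q - 1) = ρ ^ (-q) / q := by
      rw [integral_Ioi_rpow_of_lt (by linarith) hρ, show -q - 1 + 1 = -q by ring, neg_div_neg_eq]
    rw [← hval, ofReal_integral_eq_lintegral_ofReal (integrableOn_Ioi_rpow_of_lt (by linarith) hρ)]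
    · refine setLIntegral_mono' measurableSet_Ioi fun t ht => ?_
      have ht0 : 0 < t := hρ.trans ht
      refine mul_le_of_le_one_right zero_le ?_
      rw [← ENNReal.ofReal_one]
      apply ENNReal.ofReal_le_ofReal
      refine inv_le_one_of_one_le₀ (one_le_pow₀ ?_)
      have : 0 < t⁻¹ * ρ := by positivity
      linarith
    · filter_upwards [ae_restrict_mem measurableSet_Ioi] with t ht
      have ht0 : 0 < t := hρ.trans ht
      positivity
  rw [← Set.Ioc_union_Ioi_eq_Ioi hρ.le]
  refine (lintegral_union_le _ _ _).trans ((add_le_add h1 h2).trans (le_of_eq ?_))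
  rw [← ENNReal.ofReal_add (by positivity) (by positivity),
    ENNReal.ofReal_rpow_of_pos hρ, ← ENNReal.ofReal_inv_of_pos (by positivity),
    ← ENNReal.ofReal_mul (by positivity), Real.rpow_neg hρ.le]
  congr 1
  ring

/-- Integrating out the dilation parameter turns averages of `Ω(t z)` into the weight `|h|^(-q)`. -/
theorem lintegral_dilation_le (hn : 1 ≤ n) {q : ℝ} (hq : 0 < q) {N : ℕ} (hN : q < N)
    {Ω : EuclideanSpace ℝ (Fin n) → ℝ≥0∞} (hΩ : Measurable Ω) :
    ∫⁻ t in Set.Ioi (0 : ℝ), ENNReal.ofReal (t ^ (n - q - 1)) * ∫⁻ z, wt N z * Ω (t • z) ≤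
      ENNReal.ofReal (1 / (N - q) + 1 / q) * ∫⁻ h, Ω h / ‖h‖ₑ ^ q := by
  have hne : Nonempty (Fin n) := ⟨⟨0, hn⟩⟩
  have h1 : ∀ t ∈ Set.Ioi (0 : ℝ), ENNReal.ofReal (t ^ (n - q - 1)) *
      ∫⁻ z, wt N z * Ω (t • z) =
        ∫⁻ h, ENNReal.ofReal (t ^ (-q - 1)) * wt N (t⁻¹ • h) * Ω h := by
    intro t ht
    have ht0 : (0 : ℝ) < t := ht
    have e1 := lintegral_comp_smul_euclidean ht0
      (fun h : EuclideanSpace ℝ (Fin n) => wt N (t⁻¹ • h) * Ω h)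
    simp only [inv_smul_smul₀ ht0.ne'] at e1
    simp only [mul_assoc]
    rw [lintegral_const_mul' _ _ ENNReal.ofReal_ne_top, ← e1, ← mul_assoc,
      ← ENNReal.ofReal_mul (by positivity), ← Real.rpow_natCast, ← Real.rpow_add ht0]
    congr 3
    ring
  have hm : Measurable fun z : ℝ × EuclideanSpace ℝ (Fin n) =>
      ENNReal.ofReal (z.1 ^ (-q - 1)) * wt N (z.1⁻¹ • z.2) * Ω z.2 := by
    refine ((Measurable.ennreal_ofReal ?_).mul ((measurable_wt N).comp ?_)).mul
      (hΩ.comp measurable_snd)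
    · exact measurable_fst.pow_const _
    · exact measurable_fst.inv.smul measurable_snd
  rw [setLIntegral_congr_fun measurableSet_Ioi h1, lintegral_lintegral_swap hm.aemeasurable,
    ← lintegral_const_mul' _ _ ENNReal.ofReal_ne_top]
  refine lintegral_mono_ae ?_
  have h0 : ∀ᵐ h : EuclideanSpace ℝ (Fin n), h ≠ 0 := by
    simp [ae_iff]
  filter_upwards [h0] with h hh
  have hm2 : Measurable fun t : ℝ => ENNReal.ofReal (t ^ (-q - 1)) * wt N (t⁻¹ • h) := by
    refine (Measurable.ennreal_ofReal ?_).mul ((measurable_wt N).comp ?_)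
    · exact measurable_id.pow_const _
    · exact measurable_id.inv.smul_const h
  rw [lintegral_mul_const _ hm2, ENNReal.div_eq_inv_mul, ← mul_assoc]
  refine mul_le_mul_left ?_ _
  rw [← ofReal_norm]
  refine le_trans (le_of_eq ?_) (lintegral_Ioi_rpow_mul_wt_le hq hN (norm_pos_iff.2 hh))
  refine setLIntegral_congr_fun measurableSet_Ioi fun t ht => ?_
  have ht0 : (0 : ℝ) < t := ht
  simp only [wt, norm_smul, norm_inv, Real.norm_of_nonneg ht0.le]

theorem measurable_fwdDiff_iter {g : EuclideanSpace ℝ (Fin n) → ℝ} (hg : Measurable g) (d : ℕ) :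
    Measurable fun z : EuclideanSpace ℝ (Fin n) × EuclideanSpace ℝ (Fin n) =>
      (fwdDiff z.1)^[d] g z.2 := by
  induction d with
  | zero => exact hg.comp measurable_snd
  | succ d ih =>
    simp only [Function.iterate_succ_apply']
    have : Measurable fun z : EuclideanSpace ℝ (Fin n) × EuclideanSpace ℝ (Fin n) =>
        (fwdDiff z.1)^[d] g (z.2 + z.1) :=
      ih.comp (measurable_fst.prodMk (measurable_snd.add measurable_fst))
    exact this.sub ih

theorem eLpNorm_ofReal_rpow {p : ℝ} (hp : 1 ≤ p) (F : EuclideanSpace ℝ (Fin n) → ℝ) :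
    eLpNorm F (ENNReal.ofReal p) volume ^ p = ∫⁻ x, ‖F x‖ₑ ^ p := by
  have hp0 : 0 < p := by linarith
  rw [eLpNorm_eq_lintegral_rpow_enorm_toReal (by simpa using hp0) ENNReal.ofReal_ne_top,
    ENNReal.toReal_ofReal hp0.le, ← ENNReal.rpow_mul, one_div_mul_cancel hp0.ne',
    ENNReal.rpow_one]

/-- The weighted `L^p` norm of an average of `d`-th differences at scale `t`, against a Schwartz
kernel, is controlled by the Besov integral. No cancellation of the kernel is needed here. -/
theorem lintegral_average_fwdDiff_le (hn : 1 ≤ n) {σ p : ℝ} (hσ : 0 < σ) (hp : 1 ≤ p)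
    (M : 𝓢(EuclideanSpace ℝ (Fin n), ℝ)) (d : ℕ) :
    ∃ C : ℝ≥0, ∀ g : EuclideanSpace ℝ (Fin n) → ℝ, Measurable g →
      ∫⁻ t in Set.Ioi (0 : ℝ), ENNReal.ofReal (t ^ (-(σ * p) - 1)) *
        ∫⁻ x, (∫⁻ z, ‖M z‖ₑ * ‖(fwdDiff (t • z))^[d] g (x - t • z)‖ₑ) ^ p ≤
          C * besovInt d (n + σ * p) p g := by
  set q : ℝ := n + σ * p with hqdef
  have hq : 0 < q := by positivity
  obtain ⟨N, hN⟩ := exists_nat_gt q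
  obtain ⟨c, hc0, hc⟩ := schwartz_decay M N
  have hMle : ∀ z, ‖M z‖ₑ ≤ ENNReal.ofReal c * wt N z := fun z => by
    rw [wt, ← ENNReal.ofReal_mul hc0, ← ofReal_norm]
    exact ENNReal.ofReal_le_ofReal (hc z)
  set S : ℝ≥0∞ := (∫⁻ z, ‖M z‖ₑ) ^ (p - 1) with hS
  have hSfin : S ≠ ⊤ := ENNReal.rpow_ne_top_of_nonneg (by linarith) M.integrable.2.ne
  set C : ℝ≥0∞ := S * ENNReal.ofReal c * ENNReal.ofReal (1 / (N - q) + 1 / q) with hC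
  have hCfin : C ≠ ⊤ :=
    ENNReal.mul_ne_top (ENNReal.mul_ne_top hSfin ENNReal.ofReal_ne_top) ENNReal.ofReal_ne_top
  refine ⟨C.toNNReal, fun g hg => ?_⟩
  rw [ENNReal.coe_toNNReal hCfin]
  set Ω : EuclideanSpace ℝ (Fin n) → ℝ≥0∞ := fun h => ∫⁻ x, ‖(fwdDiff h)^[d] g x‖ₑ ^ p with hΩdef
  have hΩ : Measurable Ω :=
    Measurable.lintegral_prod_right' ((measurable_fwdDiff_iter hg d).enorm.pow_const p)
  have hB : besovInt d q p g = ∫⁻ h, Ω h / ‖h‖ₑ ^ q :=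
    lintegral_congr fun h => by rw [eLpNorm_ofReal_rpow hp]
  have hMm : Measurable fun z => ‖M z‖ₑ := M.continuous.measurable.enorm
  have hstep : ∀ t : ℝ, ∫⁻ x, (∫⁻ z, ‖M z‖ₑ * ‖(fwdDiff (t • z))^[d] g (x - t • z)‖ₑ) ^ p ≤
      S * (ENNReal.ofReal c * ∫⁻ z, wt N z * Ω (t • z)) := by
    intro t
    have hm : Measurable fun y : EuclideanSpace ℝ (Fin n) × EuclideanSpace ℝ (Fin n) =>
        ‖(fwdDiff (t • y.2))^[d] g (y.1 - t • y.2)‖ₑ :=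
      ((measurable_fwdDiff_iter hg d).comp ((measurable_snd.const_smul t).prodMk
        (measurable_fst.sub (measurable_snd.const_smul t)))).enorm
    calc ∫⁻ x, (∫⁻ z, ‖M z‖ₑ * ‖(fwdDiff (t • z))^[d] g (x - t • z)‖ₑ) ^ p
        ≤ ∫⁻ x, S * ∫⁻ z, ‖M z‖ₑ * ‖(fwdDiff (t • z))^[d] g (x - t • z)‖ₑ ^ p :=
          lintegral_mono fun x =>
            lintegral_mul_rpow_le hMm (hm.comp (measurable_const.prodMk measurable_id)) hp
      _ = S * ∫⁻ z, ‖M z‖ₑ * Ω (t • z) := by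
          rw [lintegral_const_mul' _ _ hSfin, lintegral_lintegral_swap
            (((hMm.comp measurable_snd).mul (hm.pow_const p)).aemeasurable)]
          congr 1
          refine lintegral_congr fun z => ?_
          rw [lintegral_const_mul' _ _ (by simp),
            lintegral_sub_right_eq_self (fun x => ‖(fwdDiff (t • z))^[d] g x‖ₑ ^ p) (t • z)]
      _ ≤ S * ∫⁻ z, ENNReal.ofReal c * (wt N z * Ω (t • z)) := by
          refine mul_le_mul_right (lintegral_mono fun z => ?_) S
          rw [← mul_assoc]
          exact mul_le_mul_left (hMle z) _
      _ = _ := by rw [lintegral_const_mul' _ _ ENNReal.ofReal_ne_top]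
  have hexp : -(σ * p) - 1 = n - q - 1 := by rw [hqdef]; ring
  rw [hexp, hB, hC, mul_assoc]
  calc _ ≤ ∫⁻ t in Set.Ioi (0 : ℝ), S * ENNReal.ofReal c *
        (ENNReal.ofReal (t ^ (n - q - 1)) * ∫⁻ z, wt N z * Ω (t • z)) := by
        refine lintegral_mono fun t => ?_
        refine (mul_le_mul_right (hstep t) _).trans (le_of_eq ?_)
        ring
    _ = S * ENNReal.ofReal c * ∫⁻ t in Set.Ioi (0 : ℝ),
        ENNReal.ofReal (t ^ (n - q - 1)) * ∫⁻ z, wt N z * Ω (t • z) :=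
        lintegral_const_mul' _ _ (ENNReal.mul_ne_top hSfin ENNReal.ofReal_ne_top)
    _ ≤ _ := by
        gcongr
        exact lintegral_dilation_le hn hq hN hΩ

end WeightedAverages

/-! ### Kernels with cancellation are bounded by the Besov seminorm -/

section BesovBounds

variable {n : ℕ}

theorem measurable_dilConv (e : ℤ) (K : 𝓢(EuclideanSpace ℝ (Fin n), ℝ))
    {g : EuclideanSpace ℝ (Fin n) → ℝ} (hg : Measurable g) : Measurable (dilConv e K g) := by
  have hm : Measurable fun z : (EuclideanSpace ℝ (Fin n) × ℝ) × EuclideanSpace ℝ (Fin n) =>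
      dilKer e K z.1 z.2 * g z.2 := by
    refine Measurable.mul (Measurable.mul ?_ (K.continuous.measurable.comp ?_))
      (hg.comp measurable_snd)
    · exact (measurable_snd.comp measurable_fst).pow_const e
    · exact (measurable_snd.comp measurable_fst).inv.smul
        ((measurable_fst.comp measurable_fst).sub measurable_snd)
  exact hm.stronglyMeasurable.integral_prod_right.measurable

theorem dilConv_shift (e : ℤ) (k : ℤ) (K : 𝓢(EuclideanSpace ℝ (Fin n), ℝ))
    (g : EuclideanSpace ℝ (Fin n) → ℝ) {z : EuclideanSpace ℝ (Fin n) × ℝ} (hz : 0 < z.2) :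
    dilConv (e + k) K g z = z.2 ^ k * dilConv e K g z := by
  simp only [dilConv, dilKer, zpow_add₀ hz.ne']
  rw [← integral_const_mul]
  congr 1
  funext y
  ring

theorem dilKer_comp_sub_smul (K : 𝓢(EuclideanSpace ℝ (Fin n), ℝ)) {t : ℝ} (ht : 0 < t)
    (x z : EuclideanSpace ℝ (Fin n)) : dilKer 0 K (x, t) (x - t • z) = K z := by
  simp only [dilKer, sub_sub_cancel, inv_smul_smul₀ ht.ne', zpow_zero, one_mul]

theorem integrable_kernel_mul (K : 𝓢(EuclideanSpace ℝ (Fin n), ℝ))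
    {g : EuclideanSpace ℝ (Fin n) → ℝ} (hg : PolyInt g) (x : EuclideanSpace ℝ (Fin n)) {t : ℝ}
    (ht : 0 < t) : Integrable fun z => K z * g (x - t • z) := by
  have h1 := (integrable_dilKer_mul 0 K hg (z := (x, t)) ht).comp_sub_left x
  have h2 := h1.comp_smul ht.ne'
  simpa only [dilKer_comp_sub_smul K ht] using h2

theorem dilConv_neg_eq (K : 𝓢(EuclideanSpace ℝ (Fin n), ℝ))
    (g : EuclideanSpace ℝ (Fin n) → ℝ) (x : EuclideanSpace ℝ (Fin n)) {t : ℝ}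
    (ht : 0 < t) : dilConv (-n) K g (x, t) = ∫ z, K z * g (x - t • z) := by
  have h1 : dilConv (-n) K g (x, t) = t ^ (-(n : ℤ)) * dilConv 0 K g (x, t) := by
    have := dilConv_shift 0 (-n) K g (z := (x, t)) ht
    rwa [zero_add] at this
  have h2 : dilConv 0 K g (x, t) = t ^ n * ∫ z, K z * g (x - t • z) := by
    have h3 := Measure.integral_comp_smul (volume : Measure (EuclideanSpace ℝ (Fin n)))
      (fun w => dilKer 0 K (x, t) (x - w) * g (x - w)) t
    simp only [dilKer_comp_sub_smul K ht, finrank_euclideanSpace_fin, smul_eq_mul] at h3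
    rw [h3, integral_sub_left_eq_self (fun y => dilKer 0 K (x, t) y * g y) volume x,
      abs_of_pos (by positivity), ← mul_assoc, mul_inv_cancel₀ (by positivity), one_mul]
    rfl
  rw [h1, h2, ← mul_assoc, zpow_neg, zpow_natCast, inv_mul_cancel₀ (by positivity), one_mul]

theorem integral_pd_eq_zero (i : Fin n) (K : 𝓢(EuclideanSpace ℝ (Fin n), ℝ)) :
    ∫ x, pd i K x = 0 := by
  have h := integral_mul_fderiv_eq_neg_fderiv_mul_of_integrable (μ := volume)
    (f := fun _ : EuclideanSpace ℝ (Fin n) => (1 : ℝ)) (g := K)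
    (v := (EuclideanSpace.single i 1 : EuclideanSpace ℝ (Fin n)))
    (by simp) (by simpa [← pd_apply] using (pd i K).integrable) (by simpa using K.integrable)
    (fun x _ => differentiableAt_const _) (fun x _ => K.differentiableAt)
  simpa [← pd_apply] using h

theorem IsSumDeriv.integral_eq_zero {K : 𝓢(EuclideanSpace ℝ (Fin n), ℝ)} (hK : IsSumDeriv 1 K) :
    ∫ x, K x = 0 := by
  obtain ⟨L, -, rfl⟩ := hK
  simp only [sum_apply]
  rw [integral_finsetSum _ fun i _ => (pd i (L i)).integrable]
  simp [integral_pd_eq_zero]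

/-- `∫₀^∞ ∫ t^(-σp-1) |(M_t * g)(x)|^p dx dt` with `M_t(x) = t^(-n) M(x/t)`. -/
noncomputable def kernelNorm (σ p : ℝ) (M : 𝓢(EuclideanSpace ℝ (Fin n), ℝ))
    (g : EuclideanSpace ℝ (Fin n) → ℝ) : ℝ≥0∞ :=
  ∫⁻ t in Set.Ioi (0 : ℝ), ENNReal.ofReal (t ^ (-(σ * p) - 1)) *
    ∫⁻ x, ‖dilConv (-n) M g (x, t)‖ₑ ^ p

/-- The kernel `M` satisfies the Besov estimate with differences of order `d`. The constant does not
depend on `g`, and `g` is taken measurable so that Tonelli's theorem applies to `M_t * g`. -/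
def BesovBounded (d : ℕ) (σ p : ℝ) (M : 𝓢(EuclideanSpace ℝ (Fin n), ℝ)) : Prop :=
  ∃ C : ℝ≥0, ∀ g : EuclideanSpace ℝ (Fin n) → ℝ, PolyInt g → Measurable g →
    kernelNorm σ p M g ≤ C * besovInt d (n + σ * p) p g

/-- It suffices to dominate `M_t * g` by an average of `d`-th differences. -/
theorem besovBounded_of_le (hn : 1 ≤ n) {σ p : ℝ} (hσ : 0 < σ) (hp : 1 ≤ p) {d : ℕ}
    {M : 𝓢(EuclideanSpace ℝ (Fin n), ℝ)}
    (h : ∀ g : EuclideanSpace ℝ (Fin n) → ℝ, PolyInt g → ∀ x, ∀ t : ℝ, 0 < t →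
      ‖dilConv (-n) M g (x, t)‖ₑ ≤ ∫⁻ z, ‖M z‖ₑ * ‖(fwdDiff (t • z))^[d] g (x - t • z)‖ₑ) :
    BesovBounded d σ p M := by
  obtain ⟨C, hC⟩ := lintegral_average_fwdDiff_le hn hσ hp M d
  refine ⟨C, fun g hg hgm => le_trans ?_ (hC g hgm)⟩
  refine setLIntegral_mono' measurableSet_Ioi fun t ht => ?_
  gcongr with x
  exact h g hg x t ht

/-- A kernel of mean zero allows `g(x)` to be subtracted from `g(x - t z)`. -/
theorem besovBounded_one (hn : 1 ≤ n) {σ p : ℝ} (hσ : 0 < σ) (hp : 1 ≤ p)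
    {M : 𝓢(EuclideanSpace ℝ (Fin n), ℝ)} (hM : ∫ z, M z = 0) : BesovBounded 1 σ p M := by
  refine besovBounded_of_le hn hσ hp fun g hg x t ht => ?_
  have h1 : dilConv (-n) M g (x, t) = ∫ z, -(M z * (fwdDiff (t • z))^[1] g (x - t • z)) := by
    rw [dilConv_neg_eq M g x ht, ← sub_zero (∫ z, M z * g (x - t • z)),
      ← zero_mul (g x), ← hM, ← integral_mul_const,
      ← integral_sub (integrable_kernel_mul M hg x ht) (M.integrable.mul_const _)]
    congr 1
    funext z
    simp only [Function.iterate_one, fwdDiff, sub_add_cancel]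
    ring
  rw [h1]
  refine (enorm_integral_le_lintegral_enorm _).trans (le_of_eq ?_)
  refine lintegral_congr fun z => ?_
  rw [enorm_neg, enorm_mul]

/-- For an even kernel of mean zero, averaging the integrals over `z` and `-z` and subtracting
`g(x)` produces a second difference. -/
theorem besovBounded_two_of_even (hn : 1 ≤ n) {σ p : ℝ} (hσ : 0 < σ) (hp : 1 ≤ p)
    {M : 𝓢(EuclideanSpace ℝ (Fin n), ℝ)} (hM : ∫ z, M z = 0) (heven : ∀ z, M (-z) = M z) :
    BesovBounded 2 σ p M := by
  refine besovBounded_of_le hn hσ hp fun g hg x t ht => ?_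
  have hI := integrable_kernel_mul M hg x ht
  have hI' : Integrable fun z => M z * g (x + t • z) := by
    have := hI.comp_neg
    simpa only [heven, smul_neg, sub_neg_eq_add] using this
  have h0 : ∫ z, M z * g (x + t • z) = ∫ z, M z * g (x - t • z) := by
    rw [← integral_neg_eq_self]
    simp only [heven, smul_neg, sub_eq_add_neg]
  have h1 : dilConv (-n) M g (x, t) =
      ∫ z, 2⁻¹ * (M z * (fwdDiff (t • z))^[2] g (x - t • z)) := by
    have h2 : ∫ z, M z * (fwdDiff (t • z))^[2] g (x - t • z) =
        ∫ z, (M z * g (x + t • z) - M z * (2 * g x) + M z * g (x - t • z)) := by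
      congr 1
      funext z
      rw [fwdDiff_two_apply, two_smul, ← add_assoc, sub_add_cancel]
      ring
    have hS : Integrable fun z => M z * g (x + t • z) - M z * (2 * g x) :=
      hI'.sub (M.integrable.mul_const _)
    rw [integral_const_mul, h2, integral_add hS hI,
      integral_sub hI' (M.integrable.mul_const _), integral_mul_const, hM, h0,
      dilConv_neg_eq M g x ht]
    ring
  rw [h1]
  refine (enorm_integral_le_lintegral_enorm _).trans (lintegral_mono fun z => ?_)
  rw [enorm_mul, enorm_mul]
  refine mul_le_of_le_one_left zero_le ?_
  rw [Real.enorm_of_nonneg (by norm_num), ENNReal.ofReal_le_one]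
  norm_num

theorem BesovBounded.add {d : ℕ} {σ p : ℝ} (hp : 1 ≤ p) {M₁ M₂ : 𝓢(EuclideanSpace ℝ (Fin n), ℝ)}
    (h₁ : BesovBounded d σ p M₁) (h₂ : BesovBounded d σ p M₂) : BesovBounded d σ p (M₁ + M₂) := by
  obtain ⟨C₁, hC₁⟩ := h₁
  obtain ⟨C₂, hC₂⟩ := h₂
  have h2 : ((2 : ℝ≥0) ^ (p - 1) : ℝ≥0) = (2 : ℝ≥0∞) ^ (p - 1) := by
    rw [ENNReal.coe_rpow_of_nonneg _ (by linarith)]; rfl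
  refine ⟨2 ^ (p - 1) * (C₁ + C₂), fun g hg hgm => ?_⟩
  have hm : ∀ M : 𝓢(EuclideanSpace ℝ (Fin n), ℝ), Measurable fun z : EuclideanSpace ℝ (Fin n) × ℝ =>
      ‖dilConv (-n) M g z‖ₑ ^ p := fun M => (measurable_dilConv _ M hgm).enorm.pow_const p
  have hm' : ∀ M : 𝓢(EuclideanSpace ℝ (Fin n), ℝ), Measurable fun t : ℝ =>
      ENNReal.ofReal (t ^ (-(σ * p) - 1)) * ∫⁻ x, ‖dilConv (-n) M g (x, t)‖ₑ ^ p := fun M =>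
    (measurable_id.pow_const _).ennreal_ofReal.mul (hm M).lintegral_prod_left'
  have hadd : ∀ x, ∀ t : ℝ, 0 < t → dilConv (-n) (M₁ + M₂) g (x, t) =
      dilConv (-n) M₁ g (x, t) + dilConv (-n) M₂ g (x, t) := by
    intro x t ht
    rw [dilConv_neg_eq _ g x ht, dilConv_neg_eq _ g x ht, dilConv_neg_eq _ g x ht,
      ← integral_add (integrable_kernel_mul M₁ hg x ht) (integrable_kernel_mul M₂ hg x ht)]
    congr 1
    funext z
    rw [add_apply]
    ring
  have key : kernelNorm σ p (M₁ + M₂) g ≤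
      2 ^ (p - 1) * (kernelNorm σ p M₁ g + kernelNorm σ p M₂ g) := by
    unfold kernelNorm
    rw [← lintegral_add_left (hm' M₁), ← lintegral_const_mul' _ _
      (ENNReal.rpow_ne_top_of_nonneg (by linarith) (by norm_num))]
    refine setLIntegral_mono' measurableSet_Ioi fun t ht => ?_
    have hmt : Measurable fun x => ‖dilConv (-n) M₁ g (x, t)‖ₑ ^ p :=
      (hm M₁).comp (measurable_id.prodMk measurable_const)
    rw [← mul_add, mul_left_comm, ← lintegral_add_left hmt,
      ← lintegral_const_mul' _ _ (ENNReal.rpow_ne_top_of_nonneg (by linarith) (by norm_num))]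
    gcongr with x
    rw [hadd x t ht]
    refine le_trans ?_ (ENNReal.rpow_add_le_mul_rpow_add_rpow _ _ hp)
    gcongr
    exact enorm_add_le _ _
  refine key.trans ?_
  push_cast
  rw [h2, mul_assoc, add_mul]
  gcongr
  · exact hC₁ g hg hgm
  · exact hC₂ g hg hgm

theorem besovBounded_zero (d : ℕ) {σ p : ℝ} (hp : 1 ≤ p) :
    BesovBounded d σ p (0 : 𝓢(EuclideanSpace ℝ (Fin n), ℝ)) := by
  refine ⟨0, fun g _ _ => ?_⟩
  simp [kernelNorm, dilConv, dilKer, ENNReal.zero_rpow_of_pos (by linarith : 0 < p)]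

theorem besovBounded_sum {ι : Type*} {d : ℕ} {σ p : ℝ} (hp : 1 ≤ p) (s : Finset ι)
    {M : ι → 𝓢(EuclideanSpace ℝ (Fin n), ℝ)} (h : ∀ i ∈ s, BesovBounded d σ p (M i)) :
    BesovBounded d σ p (∑ i ∈ s, M i) := by
  classical
  induction s using Finset.induction_on with
  | empty => simpa using besovBounded_zero d hp
  | insert a s ha ih =>
    rw [Finset.sum_insert ha]
    exact (h a (by simp)).add hp (ih fun i hi => h i (by simp [hi]))

/-- A first derivative is controlled by two values and the integral of the second derivative: the
mean value theorem gives a point where it is `w 1 - w 0`. -/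
theorem enorm_deriv_le_of_unit_step {w w₁ w₂ : ℝ → ℝ} (h1 : ∀ τ, HasDerivAt w (w₁ τ) τ)
    (h2 : ∀ τ, HasDerivAt w₁ (w₂ τ) τ) (hc : Continuous w₂) :
    ‖w₁ 0‖ₑ ≤ ‖w 1‖ₑ + ‖w 0‖ₑ + ∫⁻ τ in Set.Ioc (0 : ℝ) 1, ‖w₂ τ‖ₑ := by
  obtain ⟨c, hc01, hcw⟩ := exists_hasDerivAt_eq_slope w w₁ zero_lt_one
    (fun τ _ => (h1 τ).continuousAt.continuousWithinAt) (fun τ _ => h1 τ)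
  have h3 : ∫ τ in (0 : ℝ)..c, w₂ τ = w₁ c - w₁ 0 :=
    intervalIntegral.integral_eq_sub_of_hasDerivAt (fun τ _ => h2 τ) (hc.intervalIntegrable _ _)
  have h4 : w₁ 0 = w 1 + -w 0 + -∫ τ in Set.Ioc 0 c, w₂ τ := by
    rw [← intervalIntegral.integral_of_le hc01.1.le, h3, hcw]
    ring
  rw [h4]
  refine (enorm_add_le _ _).trans (add_le_add ((enorm_add_le _ _).trans ?_) ?_)
  · rw [enorm_neg]
  · rw [enorm_neg]
    refine (enorm_integral_le_lintegral_enorm _).trans (lintegral_mono_set ?_)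
    exact Set.Ioc_subset_Ioc_right hc01.2.le

/-- Along a segment of length `t` in the direction `eᵢ`, differentiating `K_t * g` produces
`(∂ᵢK)_t * g`: the step `t` cancels the factor `t⁻¹`. -/
theorem hasDerivAt_dilConv_line (K : 𝓢(EuclideanSpace ℝ (Fin n), ℝ))
    {g : EuclideanSpace ℝ (Fin n) → ℝ} (hg : PolyInt g) (i : Fin n)
    (x : EuclideanSpace ℝ (Fin n)) {t : ℝ} (ht : 0 < t) (τ : ℝ) :
    HasDerivAt (fun τ : ℝ => dilConv (-n) K g (x + (τ * t) • EuclideanSpace.single i 1, t))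
      (dilConv (-n) (pd i K) g (x + (τ * t) • EuclideanSpace.single i 1, t)) τ := by
  have hl : HasDerivAt (fun τ : ℝ =>
      ((x + (τ * t) • EuclideanSpace.single i 1, t) : EuclideanSpace ℝ (Fin n) × ℝ))
      (t • stdBasis (Sum.inl i)) τ := by
    have h1 : HasDerivAt (fun τ : ℝ => x + (τ * t) • (EuclideanSpace.single i 1 :
        EuclideanSpace ℝ (Fin n))) ((1 * t) • EuclideanSpace.single i 1) τ :=
      (((hasDerivAt_id τ).mul_const t).smul_const _).const_add x
    have h2 := h1.prodMk (hasDerivAt_const τ t)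
    simpa [stdBasis] using h2
  set z : EuclideanSpace ℝ (Fin n) × ℝ := (x + (τ * t) • EuclideanSpace.single i 1, t) with hz
  have hz2 : 0 < z.2 := ht
  have hd := (hasFDerivAt_dilConv (-n) K hg hz2).differentiableAt.hasFDerivAt
  have h3 := hd.comp_hasDerivAt τ hl
  refine h3.congr_deriv ?_
  rw [map_smul, fderiv_dilConv_stdBasis _ _ hg hz2]
  have h4 := dilConv_shift (-n) (-1) (pd i K) g hz2
  rw [show (-n - 1 : ℤ) = -n + -1 by ring]
  simp only [dirOp, Sum.elim_inl, smul_eq_mul]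
  rw [h4, zpow_neg_one, ← mul_assoc, mul_inv_cancel₀ ht.ne', one_mul]

/-- Besov bounds for `K` and `∂ᵢ∂ᵢK` give one for `∂ᵢK`. This is how odd kernels, for which no
second difference appears by symmetrization, are reduced to even ones. -/
theorem BesovBounded.pd_of_pd_pd {d : ℕ} {σ p : ℝ} (hp : 1 ≤ p)
    {K : 𝓢(EuclideanSpace ℝ (Fin n), ℝ)} (i : Fin n) (h₀ : BesovBounded d σ p K)
    (h₂ : BesovBounded d σ p (pd i (pd i K))) : BesovBounded d σ p (pd i K) := by
  obtain ⟨C₀, hC₀⟩ := h₀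
  obtain ⟨C₂, hC₂⟩ := h₂
  have h3 : ((3 : ℝ≥0) ^ (p - 1) : ℝ≥0) = (3 : ℝ≥0∞) ^ (p - 1) := by
    rw [ENNReal.coe_rpow_of_nonneg _ (by linarith)]; rfl
  have h3fin : (3 : ℝ≥0∞) ^ (p - 1) ≠ ⊤ :=
    ENNReal.rpow_ne_top_of_nonneg (by linarith) (by norm_num)
  refine ⟨3 ^ (p - 1) * (2 * C₀ + C₂), fun g hg hgm => ?_⟩
  have hm : ∀ M : 𝓢(EuclideanSpace ℝ (Fin n), ℝ), Measurable fun z : EuclideanSpace ℝ (Fin n) × ℝ =>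
      ‖dilConv (-n) M g z‖ₑ ^ p := fun M => (measurable_dilConv _ M hgm).enorm.pow_const p
  have hm' : ∀ M : 𝓢(EuclideanSpace ℝ (Fin n), ℝ), Measurable fun t : ℝ =>
      ENNReal.ofReal (t ^ (-(σ * p) - 1)) * ∫⁻ x, ‖dilConv (-n) M g (x, t)‖ₑ ^ p := fun M =>
    (measurable_id.pow_const _).ennreal_ofReal.mul (hm M).lintegral_prod_left'
  have hmx : ∀ (M : 𝓢(EuclideanSpace ℝ (Fin n), ℝ)) (t : ℝ),
      Measurable fun x => ‖dilConv (-n) M g (x, t)‖ₑ ^ p := fun M t =>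
    (hm M).comp (measurable_id.prodMk measurable_const)
  have hslice : ∀ t : ℝ, 0 < t → ∫⁻ x, ‖dilConv (-n) (pd i K) g (x, t)‖ₑ ^ p ≤
      3 ^ (p - 1) * (2 * (∫⁻ x, ‖dilConv (-n) K g (x, t)‖ₑ ^ p) +
        ∫⁻ x, ‖dilConv (-n) (pd i (pd i K)) g (x, t)‖ₑ ^ p) := by
    intro t ht
    set v : EuclideanSpace ℝ (Fin n) := EuclideanSpace.single i 1 with hv
    have hmτ : Measurable fun y : EuclideanSpace ℝ (Fin n) × ℝ =>
        ‖dilConv (-n) (pd i (pd i K)) g (y.1 + (y.2 * t) • v, t)‖ₑ ^ p := by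
      refine (hm _).comp (Measurable.prodMk ?_ measurable_const)
      exact measurable_fst.add ((measurable_snd.mul_const t).smul_const v)
    have hpt : ∀ x, ‖dilConv (-n) (pd i K) g (x, t)‖ₑ ^ p ≤ 3 ^ (p - 1) *
        (‖dilConv (-n) K g (x + t • v, t)‖ₑ ^ p + ‖dilConv (-n) K g (x, t)‖ₑ ^ p +
          ∫⁻ τ in Set.Ioc (0 : ℝ) 1,
            ‖dilConv (-n) (pd i (pd i K)) g (x + (τ * t) • v, t)‖ₑ ^ p) := by
      intro x
      have hcont : Continuous fun τ : ℝ => dilConv (-n) (pd i (pd i K)) g (x + (τ * t) • v, t) :=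
        continuous_iff_continuousAt.2 fun τ =>
          (hasDerivAt_dilConv_line (pd i (pd i K)) hg i x ht τ).continuousAt
      have h4 := enorm_deriv_le_of_unit_step (fun τ => hasDerivAt_dilConv_line K hg i x ht τ)
        (fun τ => hasDerivAt_dilConv_line (pd i K) hg i x ht τ) hcont
      simp only [zero_mul, zero_smul, add_zero, one_mul] at h4
      have h5 : (∫⁻ τ in Set.Ioc (0 : ℝ) 1,
          ‖dilConv (-n) (pd i (pd i K)) g (x + (τ * t) • v, t)‖ₑ) ^ p ≤
          ∫⁻ τ in Set.Ioc (0 : ℝ) 1,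
            ‖dilConv (-n) (pd i (pd i K)) g (x + (τ * t) • v, t)‖ₑ ^ p := by
        have := lintegral_mul_rpow_le (μ := volume.restrict (Set.Ioc (0 : ℝ) 1))
          (measurable_const (a := (1 : ℝ≥0∞))) hcont.measurable.enorm hp
        simpa using this
      have h6 := ENNReal.rpow_sum_le_const_mul_sum_rpow Finset.univ
        ![‖dilConv (-n) K g (x + t • v, t)‖ₑ, ‖dilConv (-n) K g (x, t)‖ₑ,
          ∫⁻ τ in Set.Ioc (0 : ℝ) 1,
            ‖dilConv (-n) (pd i (pd i K)) g (x + (τ * t) • v, t)‖ₑ] hp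
      simp only [Fin.sum_univ_three, Finset.card_univ, Fintype.card_fin, Matrix.cons_val_zero,
        Matrix.cons_val_one, Matrix.cons_val] at h6
      calc _ ≤ _ := ENNReal.rpow_le_rpow h4 (by linarith)
        _ ≤ _ := h6
        _ ≤ _ := by
          push_cast
          gcongr
    calc ∫⁻ x, ‖dilConv (-n) (pd i K) g (x, t)‖ₑ ^ p
        ≤ ∫⁻ x, 3 ^ (p - 1) *
          (‖dilConv (-n) K g (x + t • v, t)‖ₑ ^ p + ‖dilConv (-n) K g (x, t)‖ₑ ^ p +
            ∫⁻ τ in Set.Ioc (0 : ℝ) 1,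
              ‖dilConv (-n) (pd i (pd i K)) g (x + (τ * t) • v, t)‖ₑ ^ p) := lintegral_mono hpt
      _ = 3 ^ (p - 1) * ((∫⁻ x, ‖dilConv (-n) K g (x, t)‖ₑ ^ p) +
          (∫⁻ x, ‖dilConv (-n) K g (x, t)‖ₑ ^ p) + ∫⁻ τ in Set.Ioc (0 : ℝ) 1, ∫⁻ x,
              ‖dilConv (-n) (pd i (pd i K)) g (x + (τ * t) • v, t)‖ₑ ^ p) := by
          have ma : Measurable fun x => ‖dilConv (-n) K g (x + t • v, t)‖ₑ ^ p :=
            (hmx K t).comp (measurable_id.add_const (t • v))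
          have mab : Measurable fun x => ‖dilConv (-n) K g (x + t • v, t)‖ₑ ^ p +
              ‖dilConv (-n) K g (x, t)‖ₑ ^ p := ma.add (hmx K t)
          rw [lintegral_const_mul' _ _ h3fin, lintegral_add_left mab,
            lintegral_add_left ma, lintegral_lintegral_swap hmτ.aemeasurable,
            lintegral_add_right_eq_self (fun x => ‖dilConv (-n) K g (x, t)‖ₑ ^ p) (t • v)]
      _ = _ := by
          have : ∀ τ : ℝ, ∫⁻ x, ‖dilConv (-n) (pd i (pd i K)) g (x + (τ * t) • v, t)‖ₑ ^ p =
              ∫⁻ x, ‖dilConv (-n) (pd i (pd i K)) g (x, t)‖ₑ ^ p := fun τ =>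
            lintegral_add_right_eq_self
              (fun x => ‖dilConv (-n) (pd i (pd i K)) g (x, t)‖ₑ ^ p) ((τ * t) • v)
          simp only [this, setLIntegral_const, two_mul]
          simp
  have key : kernelNorm σ p (pd i K) g ≤
      3 ^ (p - 1) * (2 * kernelNorm σ p K g + kernelNorm σ p (pd i (pd i K)) g) := by
    unfold kernelNorm
    rw [← lintegral_const_mul' 2 _ (by norm_num), ← lintegral_add_left ((hm' K).const_mul 2),
      ← lintegral_const_mul' _ _ h3fin]
    refine setLIntegral_mono' measurableSet_Ioi fun t ht => ?_
    refine (mul_le_mul_right (hslice t ht) _).trans (le_of_eq ?_)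
    ring
  refine key.trans ?_
  push_cast
  rw [h3, mul_assoc, add_mul, mul_assoc 2]
  gcongr
  · exact hC₀ g hg hgm
  · exact hC₂ g hg hgm

/-- The reflection `K ↦ K(-·)`. -/
noncomputable def reflect (K : 𝓢(EuclideanSpace ℝ (Fin n), ℝ)) : 𝓢(EuclideanSpace ℝ (Fin n), ℝ) :=
  SchwartzMap.compCLMOfContinuousLinearEquiv ℝ
    (ContinuousLinearEquiv.neg ℝ : EuclideanSpace ℝ (Fin n) ≃L[ℝ] EuclideanSpace ℝ (Fin n)) K

theorem reflect_apply (K : 𝓢(EuclideanSpace ℝ (Fin n), ℝ)) (x : EuclideanSpace ℝ (Fin n)) :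
    reflect K x = K (-x) := rfl

/-- Differentiation reverses parity; `ε = 1` for even and `ε = -1` for odd functions. -/
theorem pd_neg_of_parity {K : 𝓢(EuclideanSpace ℝ (Fin n), ℝ)} {ε : ℝ}
    (h : ∀ x, K (-x) = ε * K x) (i : Fin n) (x : EuclideanSpace ℝ (Fin n)) :
    pd i K (-x) = -ε * pd i K x := by
  have h1 : HasFDerivAt (fun x => K (-x)) _ x := (K.hasFDerivAt (-x)).comp x (hasFDerivAt_id x).neg
  have h2 : HasFDerivAt (fun x => K (-x)) _ x :=
    ((K.hasFDerivAt x).const_mul ε).congr_of_eventuallyEq (.of_forall h)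
  have h3 := DFunLike.congr_fun (h1.unique h2) (EuclideanSpace.single i 1)
  rw [pd_apply, pd_apply]
  simp at h3
  linarith

/-- Kernels `∂ᵢ∂ⱼL` are split into their even and odd parts. -/
theorem besovBounded_two (hn : 1 ≤ n) {σ p : ℝ} (hσ : 0 < σ) (hp : 1 ≤ p)
    {M : 𝓢(EuclideanSpace ℝ (Fin n), ℝ)} (hM : IsSumDeriv 2 M) : BesovBounded 2 σ p M := by
  -- for odd `L` the kernel `∂ᵢ∂ⱼL` is odd, but `∂ⱼL` and `∂ᵢ∂ᵢ∂ⱼL` are even with mean zero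
  have hodd : ∀ (i j : Fin n) (L : 𝓢(EuclideanSpace ℝ (Fin n), ℝ)), (∀ x, L (-x) = -1 * L x) →
      BesovBounded 2 σ p (pd i (pd j L)) := by
    intro i j L hL
    have e1 : ∀ x, pd j L (-x) = 1 * pd j L x := fun x => by
      simpa using pd_neg_of_parity hL j x
    have e2 : ∀ x, pd i (pd j L) (-x) = -1 * pd i (pd j L) x := pd_neg_of_parity e1 i
    have e3 : ∀ x, pd i (pd i (pd j L)) (-x) = pd i (pd i (pd j L)) x := fun x => by
      simpa using pd_neg_of_parity e2 i x
    exact BesovBounded.pd_of_pd_pd hp i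
      (besovBounded_two_of_even hn hσ hp (integral_pd_eq_zero j L) (by simpa using e1))
      (besovBounded_two_of_even hn hσ hp (integral_pd_eq_zero i _) e3)
  have heven : ∀ (i j : Fin n) (L : 𝓢(EuclideanSpace ℝ (Fin n), ℝ)), (∀ x, L (-x) = 1 * L x) →
      BesovBounded 2 σ p (pd i (pd j L)) := by
    intro i j L hL
    have e2 : ∀ x, pd i (pd j L) (-x) = pd i (pd j L) x := fun x => by
      simpa using pd_neg_of_parity (pd_neg_of_parity hL j) i x
    exact besovBounded_two_of_even hn hσ hp (integral_pd_eq_zero i _) e2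
  obtain ⟨A, hA, rfl⟩ := hM
  choose B _ hAB using hA
  refine besovBounded_sum hp _ fun i _ => ?_
  have hsum : pd i (A i) = ∑ j, pd i (pd j (B i j)) := by
    rw [hAB i]
    induction (Finset.univ : Finset (Fin n)) using Finset.induction_on with
    | empty => simp [pd_zero]
    | insert a s ha ih => rw [Finset.sum_insert ha, Finset.sum_insert ha, pd_add, ih]
  rw [hsum]
  refine besovBounded_sum hp _ fun j _ => ?_
  set L := B i j
  have hdec : L = (1 / 2 : ℝ) • (L + reflect L) + (1 / 2 : ℝ) • (L + (-1 : ℝ) • reflect L) := by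
    module
  rw [hdec, pd_add, pd_add]
  refine BesovBounded.add hp (heven i j _ fun x => ?_) (hodd i j _ fun x => ?_)
  · simp only [smul_apply, add_apply, reflect_apply, neg_neg, smul_eq_mul]
    ring
  · simp only [smul_apply, add_apply, reflect_apply, neg_neg, smul_eq_mul]
    ring

/-- A sum of derivatives of order `d ∈ {1, 2}`, to be used with `d = ⌊σ⌋ + 1`, is bounded by the
Besov integral of order `σ`. -/
theorem IsSumDeriv.besovBounded (hn : 1 ≤ n) {σ p : ℝ} (hσ : 0 < σ) (hp : 1 ≤ p) {d : ℕ}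
    (hd : d = 1 ∨ d = 2) {M : 𝓢(EuclideanSpace ℝ (Fin n), ℝ)} (hM : IsSumDeriv d M) :
    BesovBounded d σ p M := by
  rcases hd with rfl | rfl
  · exact besovBounded_one hn hσ hp hM.integral_eq_zero
  · exact besovBounded_two hn hσ hp hM

end BesovBounds

/-! ### The gradient of the heat extension -/

section Assembly

variable {n : ℕ}

theorem IsSumDeriv.mono {k l : ℕ} (hkl : k ≤ l) {K : 𝓢(EuclideanSpace ℝ (Fin n), ℝ)}
    (hK : IsSumDeriv l K) : IsSumDeriv k K := by
  induction l generalizing k K with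
  | zero =>
    obtain rfl : k = 0 := by omega
    exact hK
  | succ l ih =>
    cases k with
    | zero => trivial
    | succ k =>
      obtain ⟨A, hA, rfl⟩ := hK
      exact ⟨A, fun i => ih (by omega) (hA i), rfl⟩

theorem MemSobolevLoc.hasWeakDeriv {l : ℕ} {p : ℝ} {f : EuclideanSpace ℝ (Fin n) → ℝ}
    (h : MemSobolevLoc l p f) {α : Fin n → ℕ} (hα : ∑ i, α i ≤ l) :
    HasWeakDeriv α f (weakDeriv α f) := by
  have he : ∃ g, HasWeakDeriv α f g := (h.2 α hα).imp fun _ hg => hg.1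
  rw [weakDeriv, dif_pos he]
  exact he.choose_spec

theorem sum_add_single (β : Fin n → ℕ) (i : Fin n) :
    ∑ j, (β + Pi.single i 1 : Fin n → ℕ) j = ∑ j, β j + 1 := by
  simp [Finset.sum_add_distrib]

/-- Polynomial growth on average passes from the derivatives of the highest order to the lower
ones. -/
theorem polyInt_of_top_order {l : ℕ} {G : (Fin n → ℕ) → EuclideanSpace ℝ (Fin n) → ℝ}
    (hloc : ∀ β, ∑ i, β i ≤ l → LocallyIntegrable (G β))
    (hw : ∀ β i, ∑ i, β i < l → HasWeakPartial i (G β) (G (β + Pi.single i 1)))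
    (htop : ∀ β, ∑ i, β i = l → PolyInt (G β)) (β : Fin n → ℕ) (hβ : ∑ i, β i ≤ l) :
    PolyInt (G β) := by
  obtain ⟨j, hj⟩ := Nat.exists_eq_add_of_le hβ
  induction j generalizing β with
  | zero => exact htop β hj.symm
  | succ j ih =>
    refine polyInt_of_hasWeakPartial (hloc β hβ) (fun i => hw β i (by omega)) fun i => ?_
    have := sum_add_single β i
    exact ih _ (by omega) (by omega)

theorem dilConv_congr {f g : EuclideanSpace ℝ (Fin n) → ℝ} (h : f =ᵐ[volume] g) (e : ℤ)
    (K : 𝓢(EuclideanSpace ℝ (Fin n), ℝ)) : dilConv e K f = dilConv e K g := by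
  funext z
  refine integral_congr_ae ?_
  filter_upwards [h] with y hy
  rw [hy]

theorem lintegral_halfSpace {F : EuclideanSpace ℝ (Fin n) × ℝ → ℝ≥0∞} (hF : Measurable F) :
    ∫⁻ z in halfSpace n, F z = ∫⁻ t in Set.Ioi (0 : ℝ), ∫⁻ x, F (x, t) := by
  have h1 : halfSpace n = Set.univ ×ˢ Set.Ioi (0 : ℝ) := by
    ext z
    simp [halfSpace]
  rw [h1, Measure.volume_eq_prod, ← Measure.prod_restrict, Measure.restrict_univ,
    lintegral_prod_symm' _ hF]

theorem lintegral_halfSpace_dilConv (σ p : ℝ) (M : 𝓢(EuclideanSpace ℝ (Fin n), ℝ))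
    {g : EuclideanSpace ℝ (Fin n) → ℝ} (hg : Measurable g) :
    ∫⁻ z in halfSpace n, ENNReal.ofReal (z.2 ^ (-(σ * p) - 1)) * ‖dilConv (-n) M g z‖ₑ ^ p =
      kernelNorm σ p M g := by
  have hm : Measurable fun z : EuclideanSpace ℝ (Fin n) × ℝ => ‖dilConv (-n) M g z‖ₑ ^ p :=
    (measurable_dilConv _ M hg).enorm.pow_const p
  have hw : Measurable fun z : EuclideanSpace ℝ (Fin n) × ℝ =>
      ENNReal.ofReal (z.2 ^ (-(σ * p) - 1)) := (measurable_snd.pow_const _).ennreal_ofReal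
  have hwm : Measurable fun z : EuclideanSpace ℝ (Fin n) × ℝ =>
      ENNReal.ofReal (z.2 ^ (-(σ * p) - 1)) * ‖dilConv (-n) M g z‖ₑ ^ p := hw.mul hm
  rw [lintegral_halfSpace hwm, kernelNorm]
  refine lintegral_congr fun t => ?_
  rw [← lintegral_const_mul' _ _ ENNReal.ofReal_ne_top]

theorem ofReal_gradNorm_le (k : ℕ) (u : EuclideanSpace ℝ (Fin n) × ℝ → ℝ)
    (z : EuclideanSpace ℝ (Fin n) × ℝ) :
    ENNReal.ofReal (gradNorm k u z) ≤ ∑ b : Fin k → Fin n ⊕ Unit,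
      ‖iteratedFDeriv ℝ k u z (fun j => stdBasis (b j))‖ₑ := by
  have h : gradNorm k u z ≤ ∑ b : Fin k → Fin n ⊕ Unit,
      |iteratedFDeriv ℝ k u z (fun j => stdBasis (b j))| := by
    refine Real.sqrt_le_iff.2 ⟨Finset.sum_nonneg fun _ _ => abs_nonneg _, ?_⟩
    refine le_trans (le_of_eq ?_) (Finset.sum_sq_le_sq_sum_of_nonneg fun _ _ => abs_nonneg _)
    simp only [sq_abs]
  refine (ENNReal.ofReal_le_ofReal h).trans (le_of_eq ?_)
  rw [ENNReal.ofReal_sum_of_nonneg fun _ _ => abs_nonneg _]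
  simp only [Real.enorm_eq_ofReal_abs]

/-- The derivatives of order `l + r` of the heat extension of `f` are `t^(-r) (M_t * ∂^β f)`,
summed over `|β| = l`, where the kernels `M` are sums of derivatives of order `r`. -/
theorem exists_iteratedFDeriv_heatExt_eq (k l r : ℕ) (hk : k = l + r) :
    ∃ M : (Fin k → Fin n ⊕ Unit) → (Fin n → ℕ) → 𝓢(EuclideanSpace ℝ (Fin n), ℝ),
      (∀ b β, IsSumDeriv r (M b β)) ∧
      ∀ (f : EuclideanSpace ℝ (Fin n) → ℝ) (G : (Fin n → ℕ) → EuclideanSpace ℝ (Fin n) → ℝ),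
        f =ᵐ[volume] G 0 →
        (∀ β, ∑ i, β i ≤ l → PolyInt (G β)) →
        (∀ β i, ∑ i, β i < l → HasWeakPartial i (G β) (G (β + Pi.single i 1))) →
        ∀ z ∈ halfSpace n, ∀ b : Fin k → Fin n ⊕ Unit,
          iteratedFDeriv ℝ k (heatExt f) z (fun j => stdBasis (b j)) =
            ∑ β ∈ Finset.piAntidiag (Finset.univ : Finset (Fin n)) l,
              z.2 ^ (-(r : ℤ)) * dilConv (-n) (M b β) (G β) z := by
  choose K hK hKeq using fun b : Fin k → Fin n ⊕ Unit => iteratedFDeriv_heatExt k b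
  choose M hM hMeq using fun b : Fin k → Fin n ⊕ Unit =>
    exists_dilConv_eq_sum l r l 0 (by simp) (K b) (hk ▸ hK b)
  refine ⟨M, hM, fun f G hf hG hw z hz b => ?_⟩
  have hf' : PolyInt f := (hG 0 (by simp)).congr hf.symm
  rw [hKeq b f hf' z hz, dilConv_congr hf, hMeq b G hG hw _ z hz]
  refine Finset.sum_congr rfl fun β _ => ?_
  rw [← dilConv_shift _ _ _ _ hz]
  congr 1
  push_cast [hk]
  ring

theorem sum_rpow_le_rpow_sum {ι : Type*} (s : Finset ι) (F : ι → ℝ≥0∞) {p : ℝ} (hp : 1 ≤ p) :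
    ∑ i ∈ s, F i ^ p ≤ (∑ i ∈ s, F i) ^ p := by
  classical
  induction s using Finset.induction_on with
  | empty => simp
  | insert a s ha ih =>
    rw [Finset.sum_insert ha, Finset.sum_insert ha]
    exact (add_le_add_right ih _).trans (ENNReal.add_rpow_le_rpow_add _ _ hp)

/-- The weighted norm of the gradient is controlled by the Besov integrals of the weak derivatives
of order `l`. -/
theorem exists_lintegral_gradNorm_le (hn : 1 ≤ n) {σ p a : ℝ} (hσ : 0 < σ) (hp : 1 ≤ p)
    {k l r d : ℕ} (hk : k = l + r) (hd : d = 1 ∨ d = 2) (hdr : d ≤ r)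
    (ha : a - r * p = -(σ * p) - 1) :
    ∃ C : ℝ≥0, ∀ (f : EuclideanSpace ℝ (Fin n) → ℝ)
      (G : (Fin n → ℕ) → EuclideanSpace ℝ (Fin n) → ℝ), f =ᵐ[volume] G 0 →
      (∀ β, ∑ i, β i ≤ l → PolyInt (G β)) →
      (∀ β i, ∑ i, β i < l → HasWeakPartial i (G β) (G (β + Pi.single i 1))) →
      ∫⁻ z in halfSpace n, ENNReal.ofReal (z.2 ^ a * gradNorm k (heatExt f) z ^ p) ≤
        C * ∑ β ∈ Finset.piAntidiag (Finset.univ : Finset (Fin n)) l,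
          besovInt d (n + σ * p) p (G β) := by
  classical
  obtain ⟨M, hM, hMeq⟩ := exists_iteratedFDeriv_heatExt_eq (n := n) k l r hk
  choose C hC using fun b β => IsSumDeriv.besovBounded hn hσ hp hd ((hM b β).mono hdr)
  set S := Finset.piAntidiag (Finset.univ : Finset (Fin n)) l with hS
  set A : Finset ((Fin k → Fin n ⊕ Unit) × (Fin n → ℕ)) := Finset.univ ×ˢ S with hA
  have hcoe : (((A.card : ℝ≥0) ^ (p - 1) : ℝ≥0) : ℝ≥0∞) = (A.card : ℝ≥0∞) ^ (p - 1) := by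
    rw [ENNReal.coe_rpow_of_nonneg _ (by linarith)]; rfl
  refine ⟨(A.card : ℝ≥0) ^ (p - 1) * ∑ b, ∑ β ∈ S, C b β, fun f G hf hG hw => ?_⟩
  -- the weak derivatives are only a.e. measurable, and the kernel estimates ask for measurability
  have hrep : ∀ β, ∃ g : EuclideanSpace ℝ (Fin n) → ℝ, ∑ i, β i ≤ l →
      Measurable g ∧ G β =ᵐ[volume] g := by
    intro β
    by_cases hβ : ∑ i, β i ≤ l
    · have := (hG β hβ).aestronglyMeasurable
      exact ⟨this.mk _, fun _ => ⟨this.stronglyMeasurable_mk.measurable, this.ae_eq_mk⟩⟩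
    · exact ⟨0, fun h => absurd h hβ⟩
  choose g hg using hrep
  have hSl : ∀ β ∈ S, ∑ i, β i = l := fun β hβ => (Finset.mem_piAntidiag.1 hβ).1
  have hgm : ∀ β ∈ S, Measurable (g β) := fun β hβ => (hg β (hSl β hβ).le).1
  have hgG : ∀ β ∈ S, G β =ᵐ[volume] g β := fun β hβ => (hg β (hSl β hβ).le).2
  have hpt : ∀ z ∈ halfSpace n,
      ENNReal.ofReal (z.2 ^ a * gradNorm k (heatExt f) z ^ p) ≤
        (A.card : ℝ≥0∞) ^ (p - 1) * ∑ q ∈ A, ENNReal.ofReal (z.2 ^ (-(σ * p) - 1)) *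
          ‖dilConv (-n) (M q.1 q.2) (g q.2) z‖ₑ ^ p := by
    intro z hz
    have hz' : 0 < z.2 := hz
    have h1 : ENNReal.ofReal (gradNorm k (heatExt f) z) ≤ ENNReal.ofReal (z.2 ^ (-(r : ℝ))) *
        ∑ q ∈ A, ‖dilConv (-n) (M q.1 q.2) (g q.2) z‖ₑ := by
      refine (ofReal_gradNorm_le _ _ _).trans ?_
      rw [hA, Finset.sum_product, Finset.mul_sum]
      refine Finset.sum_le_sum fun b _ => ?_
      rw [hMeq f G hf hG hw z hz b, ← Finset.mul_sum, enorm_mul]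
      refine mul_le_mul' (le_of_eq ?_) ((enorm_sum_le _ _).trans (le_of_eq ?_))
      · rw [Real.enorm_of_nonneg (by positivity), Real.rpow_neg hz'.le, zpow_neg,
          zpow_natCast, Real.rpow_natCast]
      · exact Finset.sum_congr rfl fun β hβ => by rw [dilConv_congr (hgG β hβ)]
    calc ENNReal.ofReal (z.2 ^ a * gradNorm k (heatExt f) z ^ p)
        = ENNReal.ofReal (z.2 ^ a) * ENNReal.ofReal (gradNorm k (heatExt f) z) ^ p := by
          rw [ENNReal.ofReal_mul (by positivity),
            ENNReal.ofReal_rpow_of_nonneg 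
              (show 0 ≤ gradNorm k (heatExt f) z from Real.sqrt_nonneg _)
              (by linarith)]
      _ ≤ ENNReal.ofReal (z.2 ^ a) * (ENNReal.ofReal (z.2 ^ (-(r : ℝ))) *
          ∑ q ∈ A, ‖dilConv (-n) (M q.1 q.2) (g q.2) z‖ₑ) ^ p := by gcongr
      _ = ENNReal.ofReal (z.2 ^ (-(σ * p) - 1)) *
          (∑ q ∈ A, ‖dilConv (-n) (M q.1 q.2) (g q.2) z‖ₑ) ^ p := by
          rw [ENNReal.mul_rpow_of_nonneg _ _ (by linarith), ← mul_assoc,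
            ENNReal.ofReal_rpow_of_nonneg (by positivity) (by linarith), ← Real.rpow_mul hz'.le,
            ← ENNReal.ofReal_mul (by positivity), ← Real.rpow_add hz', ← ha]
          ring_nf
      _ ≤ ENNReal.ofReal (z.2 ^ (-(σ * p) - 1)) * ((A.card : ℝ≥0∞) ^ (p - 1) *
          ∑ q ∈ A, ‖dilConv (-n) (M q.1 q.2) (g q.2) z‖ₑ ^ p) := by
          gcongr
          exact ENNReal.rpow_sum_le_const_mul_sum_rpow A _ hp
      _ = _ := by rw [mul_left_comm, Finset.mul_sum]
  have hmeas : ∀ q ∈ A, Measurable fun z : EuclideanSpace ℝ (Fin n) × ℝ =>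
      ENNReal.ofReal (z.2 ^ (-(σ * p) - 1)) * ‖dilConv (-n) (M q.1 q.2) (g q.2) z‖ₑ ^ p :=
    fun q hq => (measurable_snd.pow_const _).ennreal_ofReal.mul
      ((measurable_dilConv _ _ (hgm q.2 (Finset.mem_product.1 hq).2)).enorm.pow_const p)
  calc ∫⁻ z in halfSpace n, ENNReal.ofReal (z.2 ^ a * gradNorm k (heatExt f) z ^ p)
      ≤ ∫⁻ z in halfSpace n, (A.card : ℝ≥0∞) ^ (p - 1) * ∑ q ∈ A,
          ENNReal.ofReal (z.2 ^ (-(σ * p) - 1)) *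
            ‖dilConv (-n) (M q.1 q.2) (g q.2) z‖ₑ ^ p :=
        setLIntegral_mono' isOpen_halfSpace.measurableSet hpt
    _ = (A.card : ℝ≥0∞) ^ (p - 1) * ∑ q ∈ A, kernelNorm σ p (M q.1 q.2) (g q.2) := by
        rw [lintegral_const_mul' _ _ (by rw [← hcoe]; exact ENNReal.coe_ne_top),
          lintegral_finsetSum _ hmeas]
        congr 1
        exact Finset.sum_congr rfl fun q hq =>
          lintegral_halfSpace_dilConv σ p _ (hgm q.2 (Finset.mem_product.1 hq).2)
    _ ≤ (A.card : ℝ≥0∞) ^ (p - 1) * ∑ q ∈ A, C q.1 q.2 *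
          ∑ β ∈ S, besovInt d (n + σ * p) p (G β) := by
        gcongr with q hq
        have hq2 := (Finset.mem_product.1 hq).2
        refine (hC q.1 q.2 (g q.2) ((hG q.2 (hSl _ hq2).le).congr (hgG _ hq2))
          (hgm _ hq2)).trans ?_
        rw [← besovInt_congr (hgG _ hq2)]
        gcongr
        exact Finset.single_le_sum (f := fun β => besovInt d (n + σ * p) p (G β))
          (fun _ _ => zero_le) hq2
    _ = _ := by
        push_cast
        rw [← Finset.sum_mul, hcoe, hA, Finset.sum_product, mul_assoc]

/-- For `0 < s < k` and `l` the largest natural number below `s`, the fractional order `σ = s - l`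
lies in `(0, 1]`, and at least `⌊σ⌋ + 1` of `k` derivatives remain when `l` of them are moved onto
`f`. -/
theorem besovOrder_spec {k : ℕ} {s : ℝ} (hs : 0 < s) (hsk : s < k) :
    0 < s - besovOrder s ∧ (⌊s - besovOrder s⌋₊ + 1 = 1 ∨ ⌊s - besovOrder s⌋₊ + 1 = 2) ∧
      ∃ r : ℕ, k = besovOrder s + r ∧ ⌊s - besovOrder s⌋₊ + 1 ≤ r := by
  obtain ⟨h1, h2⟩ := besovOrder_isGreatest hs
  have h1' : (besovOrder s : ℝ) < s := h1
  have h3 : s ≤ besovOrder s + 1 := by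
    by_contra! h
    have := h2 (a := besovOrder s + 1) (by simpa using h)
    omega
  have hlk : besovOrder s < k := by exact_mod_cast h1'.trans hsk
  have h4 : ⌊s - besovOrder s⌋₊ < k - besovOrder s := by
    rw [Nat.floor_lt (by linarith), Nat.cast_sub hlk.le]
    linarith
  have h5 : ⌊s - besovOrder s⌋₊ ≤ 1 := Nat.floor_le_of_le (by rw [Nat.cast_one]; linarith)
  exact ⟨by linarith, by omega, k - besovOrder s, by omega, by omega⟩

end Assembly

end HeatBesov

open HeatBesov in
theorem theorem1p2 (n m : ℕ) (hn : 1 ≤ n) (p a : ℝ) (hp : 1 ≤ p)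
    (ha : -1 < a) (ha' : a < p * (m + 1) - 1) :
    ∃ C : ℝ≥0, ∀ f : EuclideanSpace ℝ (Fin n) → ℝ,
      HeatBesov.MemHomBesov (m + 1 - (a + 1) / p) p f →
        (∀ (x : EuclideanSpace ℝ (Fin n)) (t : ℝ), 0 < t →
          Integrable (fun y => HeatBesov.gaussWt t (x - y) * f y)) ∧
        ContDiffOn ℝ (m + 1 : ℕ) (HeatBesov.heatExt f) (HeatBesov.halfSpace n) ∧
        ∫⁻ z in HeatBesov.halfSpace n,
            ENNReal.ofReal
              (z.2 ^ a * HeatBesov.gradNorm (m + 1) (HeatBesov.heatExt f) z ^ p)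
          ≤ C * HeatBesov.besovSeminorm (m + 1 - (a + 1) / p) p f ^ p := by
  have hp0 : 0 < p := by linarith
  set s : ℝ := m + 1 - (a + 1) / p with hs
  have hsk : s < (m + 1 : ℕ) := by
    have : 0 < (a + 1) / p := div_pos (by linarith) hp0
    push_cast
    linarith
  have hs0 : 0 < s := by
    have : (a + 1) / p < m + 1 := by
      rw [div_lt_iff₀ hp0]
      linarith
    linarith
  obtain ⟨hσ, hd, r, hk, hdr⟩ := besovOrder_spec hs0 hsk
  set l := besovOrder s with hl
  set σ := s - l with hσ_def
  have hexp : a - r * p = -(σ * p) - 1 := by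
    have h1 : (m : ℝ) + 1 = l + r := by exact_mod_cast hk
    have h2 : (a + 1) / p * p = a + 1 := div_mul_cancel₀ _ hp0.ne'
    rw [hσ_def, hs, h1]
    linarith
  obtain ⟨C, hC⟩ := exists_lintegral_gradNorm_le (n := n) hn hσ hp hk hd hdr hexp
  refine ⟨C, fun f hf => ?_⟩
  have hG : ∀ {β : Fin n → ℕ}, ∑ i, β i ≤ l → HasWeakDeriv β f (weakDeriv β f) :=
    fun hβ => hf.1.hasWeakDeriv hβ
  have hw : ∀ (β : Fin n → ℕ) (i : Fin n), ∑ i, β i < l →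
      HasWeakPartial i (weakDeriv β f) (weakDeriv (β + Pi.single i 1) f) := fun β i hβ =>
    (hG hβ.le).hasWeakPartial (hG (by rw [sum_add_single]; exact hβ))
  have hf0 : f =ᵐ[volume] weakDeriv 0 f := (hG (by simp)).ae_eq_of_zero
  have hpoly : ∀ β : Fin n → ℕ, ∑ i, β i ≤ l → PolyInt (weakDeriv β f) := by
    refine polyInt_of_top_order (fun β hβ => (hG hβ).2.1) hw fun β hβ => ?_
    have hfin := hf.2 β hβ
    rw [besovSeminormBase_eq, ENNReal.rpow_lt_top_iff_of_pos (by positivity)] at hfin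
    exact polyInt_of_besovInt (hG hβ.le).2.1 hp (by positivity) hd hfin
  have hfp : PolyInt f := (hpoly 0 (by simp)).congr hf0.symm
  refine ⟨fun x t ht => ?_, ?_, (hC f _ hf0 hpoly hw).trans ?_⟩
  · simp only [gaussWt_eq_dilKer]
    exact integrable_dilKer_mul _ _ hfp ht
  · rw [heatExt_eq_dilConv]
    exact contDiffOn_dilConv _ _ _ hfp
  · gcongr
    rw [besovSeminorm]
    refine le_trans (le_of_eq ?_) (sum_rpow_le_rpow_sum _ _ hp)
    refine Finset.sum_congr rfl fun β _ => ?_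
    rw [besovSeminormBase_eq, ← ENNReal.rpow_mul, one_div_mul_cancel hp0.ne', ENNReal.rpow_one]
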